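/- Let $p\ge 3$ be a prime and let $A$ be an unbounded reduced Abelian $p$-group; $\mu_{fin}=\inf_n r(p^nB)$ denotes the final rank of a basic subgroup $B$ of $A$ (it does not depend on $B$), where $r$ is the rank. For an automorphism $\varepsilon$ with $\varepsilon^2=1$ put $A_\varepsilon^{\pm}=\{a\in A:\varepsilon a=\pm a\}$, so that $A=A_\varepsilon^+\oplus A_\varepsilon^-$. Call $\varepsilon$ an extreme involution, $Extreme(\varepsilon)$, if it has order $2$ and one of $A_\varepsilon^{+},A_\varepsilon^{-}$ is indecomposable; that one is denoted $A_\varepsilon$, the other one $A_\varepsilon^{\perp}$, and $ord(\varepsilon)=|A_\varepsilon|$. A pair $(\xi,\varepsilon)$ consists of automorphisms with $\xi^2=1$, $Extreme(\varepsilon)$ and $\xi\varepsilon=\varepsilon\xi$; $A_{(\xi,\varepsilon)}$ is the one of $A_\xi^+,A_\xi^-$ that contains $A_\varepsilon$, and $A_{\overline{(\xi,\varepsilon)}}$ is the other one. For extreme $\varepsilon'$ and a subgroup $H$ of $A$ we say that $\varepsilon'$ lies in $H$ if $A_{\varepsilon'}\subset H$, and then $\varepsilon'\in(\xi,\varepsilon)$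 means that $\varepsilon'$ lies in $A_{(\xi,\varepsilon)}$; $(\xi_1,\varepsilon_1)\subsetneq(\xi_0,\varepsilon_0)$ means $A_{(\xi_1,\varepsilon_1)}\subsetneq A_{(\xi_0,\varepsilon_0)}$. For an automorphism $f$ and extreme involutions $\varepsilon_1,\varepsilon_2$ let $\varepsilon_1\overset{f}{\mapsto}\varepsilon_2$ mean that $A_{\varepsilon_1}\cap A_{\varepsilon_2}=0$, $f(A_{\varepsilon_1})\subset A_{\varepsilon_1}\oplus A_{\varepsilon_2}$, $f(A_{\varepsilon_1}^\perp)\supset A_{\varepsilon_1}^\perp\cap A_{\varepsilon_2}^\perp$, $f(A_{\varepsilon_1})\ne A_{\varepsilon_1}$ and $f(A_{\varepsilon_1})\neq A_{\varepsilon_2}$. Define $$ByOrd(\xi,\varepsilon)\iff\forall\varepsilon'\Big(Extreme(\varepsilon')\wedge\xi\varepsilon'=\varepsilon'\xi\Rightarrow\big(\varepsilon'\in(\xi,\varepsilon)\Leftrightarrow ord(\varepsilon')\ge ord(\varepsilon)\big)\Big),$$ and, for a pair $(\xi_0,\varepsilon_0)$, let $Final(\xi_0,\varepsilon_0)$ mean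 that $ByOrd(\xi_0,\varepsilon_0)$ holds and that for every pair $(\xi_1,\varepsilon_1)\subsetneq(\xi_0,\varepsilon_0)$ with $ByOrd(\xi_1,\varepsilon_1)$ there is an automorphism $f$ of $A$ such that $f(A_\varepsilon)=A_\varepsilon$ for every extreme involution $\varepsilon$ lying in $A_{\overline{(\xi_1,\varepsilon_1)}}$, and such that for every extreme involution $\varepsilon$ lying in $A_{(\xi_0,\varepsilon_0)}\cap A_{\overline{(\xi_1,\varepsilon_1)}}$ there is an extreme involution $\varepsilon'\in(\xi_1,\varepsilon_1)$ with $\varepsilon'\overset{f}{\mapsto}\varepsilon$. Then: (1) the property "$(\xi_0,\varepsilon_0)$ is a pair and $Final(\xi_0,\varepsilon_0)$ holds" of two elements of the group $\operatorname{Aut}A$ is expressed by a first-order formula of the language of groups, which is the same for all $p\geq 3$ and all such $A$; (2) this formula specifies the decompositions $A=A_{low}\oplus A_{fin}$ in which every indecomposable direct summand of $A_{low}$ has smaller order than every indecomposable direct summand of $A_{fin}$ and the basic subgroup of $A_{fin}$ has rank $\mu_{fin}$: for subgroups $A_{low},A_{fin}$ of $A$, these conditions hold if and only if $A_{low}=A_{\overline{(\xi_0,\varepsilon_0)}}$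 and $A_{fin}=A_{(\xi_0,\varepsilon_0)}$ for some pair $(\xi_0,\varepsilon_0)$ with $Final(\xi_0,\varepsilon_0)$; (3) such a decomposition exists. -/

import Mathlib

open Cardinal

noncomputable section

namespace AutFinal

/-! ### The first-order language of groups and its structure on `Aut A` -/

/-- The operation symbols of the language of groups. -/
inductive GroupFunc : ℕ → Type
  | mul : GroupFunc 2
  | inv : GroupFunc 1
  | one : GroupFunc 0

/-- The first-order language of groups `(·, ⁻¹, 1)`, with equality and no other relation. -/
def groupLang : FirstOrder.Language where
  Functions := GroupFunc
  Relations := fun _ => Empty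

/-- `Aut A` as a first-order structure: `f · g` is the composite `a ↦ f (g a)`. -/
instance autStructure (A : Type*) [AddCommGroup A] : groupLang.Structure (A ≃+ A) where
  funMap := fun {n} s =>
    match n, s with
    | _, GroupFunc.mul => fun x => (x 1).trans (x 0)
    | _, GroupFunc.inv => fun x => (x 0).symm
    | _, GroupFunc.one => fun _ => AddEquiv.refl A
  RelMap := fun r => r.elim

/-! ### Abelian `p`-groups -/

section Groups

variable {A : Type*} [AddCommGroup A]

/-- Every element of `A` has order a power of `p`. -/
def IsAbelianPGroup (p : ℕ) (A : Type*) [AddCommGroup A] : Prop :=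
  ∀ a : A, ∃ n : ℕ, p ^ n • a = 0

/-- `A` has no nonzero divisible subgroup. -/
def IsReducedGroup (A : Type*) [AddCommGroup A] : Prop :=
  ∀ D : AddSubgroup A, (∀ n : ℕ, n ≠ 0 → ∀ x ∈ D, ∃ y ∈ D, n • y = x) → D = ⊥

/-- No positive integer annihilates `A`. -/
def IsUnboundedGroup (A : Type*) [AddCommGroup A] : Prop :=
  ∀ n : ℕ, n ≠ 0 → ∃ a : A, n • a ≠ 0

/-- The subgroup `H` is nonzero and is not a direct sum of two nonzero subgroups. -/
def Indecomposable (H : AddSubgroup A) : Prop :=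
  H ≠ ⊥ ∧ ∀ X Y : AddSubgroup A, X ⊓ Y = ⊥ → X ⊔ Y = H → X = ⊥ ∨ Y = ⊥

/-- `X` is an indecomposable direct summand of the subgroup `H`. -/
def IsIndecSummand (X H : AddSubgroup A) : Prop :=
  Indecomposable X ∧ ∃ Y : AddSubgroup A, X ⊓ Y = ⊥ ∧ X ⊔ Y = H

/-- The elements of `s` are independent: the sum of the cyclic groups they generate is direct. -/
def IndependentElems (s : Set A) : Prop :=
  iSupIndep fun a : s => AddSubgroup.zmultiples (a : A)

/-- An independent system consisting of elements of infinite or of prime power order (in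
particular not containing `0`, whose order is `1`). -/
def IsRankSystem (s : Set A) : Prop :=
  IndependentElems s ∧ ∀ a ∈ s, addOrderOf a = 0 ∨ IsPrimePow (addOrderOf a)

/-- The rank of an Abelian group: the cardinality of a maximal independent system of elements of
infinite and prime power orders. (All these systems have the same cardinality.) -/
def rank (A : Type*) [AddCommGroup A] : Cardinal :=
  sInf {κ | ∃ s : Set A, Maximal IsRankSystem s ∧ #s = κ}

/-- `B` is a `p`-basic subgroup of `A`: a direct sum of infinite cyclic groups and cyclic
`p`-groups, pure in `A`, with `p`-divisible quotient `A / B`. -/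
structure IsBasic (p : ℕ) (B : AddSubgroup A) : Prop where
  directSum : ∃ s : Set A, IndependentElems s ∧ AddSubgroup.closure s = B ∧
    ∀ a ∈ s, addOrderOf a = 0 ∨ ∃ k : ℕ, addOrderOf a = p ^ k
  pure : ∀ (n : ℤ), ∀ g ∈ B, (∃ x : A, n • x = g) → ∃ x ∈ B, n • x = g
  divisible : ∀ x : A ⧸ B, ∃ y : A ⧸ B, p • y = x

/-- The final rank of `B`: the infimum of the cardinals `r(pⁿ B)`. -/
def finalRank (p : ℕ) (B : AddSubgroup A) : Cardinal :=
  ⨅ n : ℕ, rank (B.map (nsmulAddMonoidHom (p ^ n)))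

/-- The basic subgroup of `A` (it exists, and any one may be taken) has rank `κ`. -/
def HasBasicRank (p : ℕ) (A : Type*) [AddCommGroup A] (κ : Cardinal) : Prop :=
  (∃ B : AddSubgroup A, IsBasic p B) ∧ ∀ B : AddSubgroup A, IsBasic p B → rank B = κ

/-- The basic subgroup of `A` (it exists, and any one may be taken) has final rank `κ`. -/
def HasFinalRank (p : ℕ) (A : Type*) [AddCommGroup A] (κ : Cardinal) : Prop :=
  (∃ B : AddSubgroup A, IsBasic p B) ∧ ∀ B : AddSubgroup A, IsBasic p B → finalRank p B = κ

/-- `A = A₁ ⊕ A₂`, where every indecomposable direct summand of `A₁` has smaller order than every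
indecomposable direct summand of `A₂`, and the rank of the basic subgroup of `A₂` is the final
rank of the basic subgroup of `A`. -/
structure IsLowFin (p : ℕ) (A₁ A₂ : AddSubgroup A) : Prop where
  compl : IsCompl A₁ A₂
  order_lt : ∀ X Y : AddSubgroup A, IsIndecSummand X A₁ → IsIndecSummand Y A₂ → #X < #Y
  rank_eq : ∃ κ : Cardinal, HasFinalRank p A κ ∧ HasBasicRank p A₂ κ

/-! ### Involutions -/

/-- `A_ε⁺ = {a | ε a = a}`. -/
def plusPart (ε : A ≃+ A) : AddSubgroup A where
  carrier := {a | ε a = a}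
  zero_mem' := map_zero ε
  add_mem' := by
    intro a b ha hb
    simp only [Set.mem_ofPred_eq] at ha hb ⊢
    rw [map_add, ha, hb]
  neg_mem' := by
    intro a ha
    simp only [Set.mem_ofPred_eq] at ha ⊢
    rw [map_neg, ha]

/-- `A_ε⁻ = {a | ε a = -a}`. -/
def minusPart (ε : A ≃+ A) : AddSubgroup A where
  carrier := {a | ε a = -a}
  zero_mem' := by simp
  add_mem' := by
    intro a b ha hb
    simp only [Set.mem_ofPred_eq] at ha hb ⊢
    rw [map_add, ha, hb, neg_add]
  neg_mem' := by
    intro a ha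
    simp only [Set.mem_ofPred_eq] at ha ⊢
    rw [map_neg, ha]

def Commutes (f g : A ≃+ A) : Prop := ∀ a, f (g a) = g (f a)

/-- `ε` is an extreme involution: an automorphism of order `2` such that one of `A_ε⁺`, `A_ε⁻` is
indecomposable. -/
def Extreme (ε : A ≃+ A) : Prop :=
  (∀ a, ε (ε a) = a) ∧ ε ≠ AddEquiv.refl A ∧
    (Indecomposable (plusPart ε) ∨ Indecomposable (minusPart ε))

open Classical in
/-- The indecomposable one `A_ε` of the two summands `A_ε⁺`, `A_ε⁻` of an extreme involution. -/
def core (ε : A ≃+ A) : AddSubgroup A :=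
  if Indecomposable (minusPart ε) then minusPart ε else plusPart ε

open Classical in
/-- The other summand `A_ε^⊥` of an extreme involution. -/
def perp (ε : A ≃+ A) : AddSubgroup A :=
  if Indecomposable (minusPart ε) then plusPart ε else minusPart ε

/-- The order of an extreme involution `ε`, i.e. the order of the summand `A_ε`. -/
def ord (ε : A ≃+ A) : Cardinal := #(core ε)

/-- `(ξ, ε)` is a pair: `ξ² = 1`, `ε` is an extreme involution, and `ξ ε = ε ξ`. -/
def Pair (ξ ε : A ≃+ A) : Prop :=
  (∀ a, ξ (ξ a) = a) ∧ Extreme ε ∧ Commutes ξ ε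

open Classical in
/-- `A_(ξ, ε)`: the one of `A_ξ⁺`, `A_ξ⁻` that contains `A_ε`. -/
def pairPart (ξ ε : A ≃+ A) : AddSubgroup A :=
  if core ε ≤ plusPart ξ then plusPart ξ else minusPart ξ

open Classical in
/-- The complement of `A_(ξ, ε)`: the other one of `A_ξ⁺`, `A_ξ⁻`. -/
def pairCompl (ξ ε : A ≃+ A) : AddSubgroup A :=
  if core ε ≤ plusPart ξ then minusPart ξ else plusPart ξ

/-- `f(ε)`, the involution `f ε f⁻¹`. -/
def conj (f ε : A ≃+ A) : A ≃+ A := (f.symm.trans ε).trans f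

/-- `ε ∈ ε₁ ⊕ ε₂`. -/
def InSum (ε ε₁ ε₂ : A ≃+ A) : Prop :=
  core ε₁ ⊓ core ε₂ = ⊥ ∧ core ε ≤ core ε₁ ⊔ core ε₂ ∧ perp ε₁ ⊓ perp ε₂ ≤ perp ε

/-- `f(ε₁) = ε₂` for extreme involutions: `f` maps `A_ε₁` onto `A_ε₂`. -/
def Sends (f ε₁ ε₂ : A ≃+ A) : Prop :=
  (core ε₁).map f.toAddMonoidHom = core ε₂

/-- `ε₁ ↦ ε₂` under `f`: `f(ε₁) ∈ ε₁ ⊕ ε₂`, `f(ε₁) ≠ ε₁` and `f(ε₁) ≠ ε₂`. -/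
def MapsOnto (f ε₁ ε₂ : A ≃+ A) : Prop :=
  Extreme ε₁ ∧ Extreme ε₂ ∧ InSum (conj f ε₁) ε₁ ε₂ ∧ ¬ Sends f ε₁ ε₁ ∧ ¬ Sends f ε₁ ε₂

/-- Among the extreme involutions compatible with the decomposition given by `ξ`, those lying in
`(ξ, ε)` are exactly those whose order is at least that of `ε`. -/
def ByOrd (ξ ε : A ≃+ A) : Prop :=
  ∀ ε' : A ≃+ A, Extreme ε' → Commutes ξ ε' → (core ε' ≤ pairPart ξ ε ↔ ord ε ≤ ord ε')

/-- The condition `Final(ξ₀, ε₀)`; all its quantifiers range over `Aut A`. -/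
def Final (ξ₀ ε₀ : A ≃+ A) : Prop :=
  ByOrd ξ₀ ε₀ ∧
    ∀ ξ₁ ε₁ : A ≃+ A, Pair ξ₁ ε₁ → pairPart ξ₁ ε₁ < pairPart ξ₀ ε₀ → ByOrd ξ₁ ε₁ →
      ∃ f : A ≃+ A,
        (∀ ε : A ≃+ A, Extreme ε → core ε ≤ pairCompl ξ₁ ε₁ → Sends f ε ε) ∧
        (∀ ε : A ≃+ A, Extreme ε → core ε ≤ pairPart ξ₀ ε₀ ⊓ pairCompl ξ₁ ε₁ →
          ∃ ε' : A ≃+ A, Extreme ε' ∧ core ε' ≤ pairPart ξ₁ ε₁ ∧ MapsOnto f ε' ε)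

end Groups

end AutFinal

end

namespace AutFinal

universe u

/-! ### Elementary facts on Abelian `p`-groups -/

section PGroup

variable {p : ℕ} {M : Type*} [AddCommGroup M]

/-! As `p` is odd, 2 is invertible on `A`, so involutions correspond to projections (`Rep`) and
extreme involutions to projections onto nonzero cyclic summands (`Cyc`). Every condition becomes one
about direct summands, and all of them are compared with a single pivot, `IsFinalProj p w m`: the
complement of the range of `w` is killed by `p ^ m`, the elements of order `p` in the range are
divisible by `p ^ m`, and the layer `p ^ m A / p ^ (m + 1) A` has the least cardinality among all
layers. `Final`, `IsLowFin` and the group-theoretic condition `GroupFinal` are each shown equivalent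
to it.

Ranks enter through the layers. In an unbounded reduced group all layers are infinite, and the layer
of index `n` has the cardinality of the rank of `p ^ n B`. The final rank is therefore the least
layer cardinality, and a summand with the first two properties of the pivot has a basic subgroup
whose rank is the layer of index `m`. Those two properties are what `ByOrd` says
(`Setting.byOrd_iff`), so only minimality is left to the quantifier over automorphisms.

If the layer is minimal and `w = π + δ` with `δ` bounded, then a basis for `π` has enough elements
of large order to map onto all elements of the range of `δ`. The resulting homomorphism `φ` takes
every value at a generator of a cyclic summand (`IsFinalProj.exists_hom`), and the required
automorphism is `1 + φ`, suitably extended. If the layer is not minimal, `w` splits off a summand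
with small layers whose bounded complement has a larger basis (`Setting.exists_small_summand`). For
any automorphism `f`, the image of `δ f π` is too small to contain a nonzero multiple of every basis
element of `δ`, and a missed one refutes the condition.

The formula is not a transcription of `Final`. `GroupFinal` speaks only of commutation in `Aut A`:
extremality through double centralizers, sides of `ξ` through conjugates, comparison of orders
through the center, and the link between two extreme involutions through `Couples`. It is proved
equivalent to the same pivot. Since `Couples` is weaker than containment of subgroups, its
refutation needs the finer choice of a cyclic summand in `Setting.exists_cyc_divisible`. -/

theorem IsAbelianPGroup.inverse (hp : p.Prime) (hM : IsAbelianPGroup p M) {u : ℤ}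
    (hu : ¬ (p : ℤ) ∣ u) (x : M) : ∃ v : ℤ, (v * u) • x = x := by
  obtain ⟨n, hn⟩ := hM x
  have hc : IsCoprime u ((p : ℤ) ^ n) := by
    apply IsCoprime.pow_right
    exact ((Nat.prime_iff_prime_int.mp hp).coprime_iff_not_dvd.mpr hu).symm
  obtain ⟨a, b, hab⟩ := hc
  refine ⟨a, ?_⟩
  have h1 : ((p : ℤ) ^ n) • x = 0 := by
    rw [← hn, ← natCast_zsmul]; push_cast; rfl
  calc (a * u) • x = (a * u) • x + b • ((p : ℤ) ^ n) • x := by rw [h1]; simp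
    _ = x := by rw [← mul_smul, ← add_smul, hab, one_smul]

theorem IsAbelianPGroup.eq_zero_of_smul (hp : p.Prime) (hM : IsAbelianPGroup p M) {u : ℤ}
    (hu : ¬ (p : ℤ) ∣ u) {x : M} (h : u • x = 0) : x = 0 := by
  obtain ⟨v, hv⟩ := hM.inverse hp hu x
  rw [← hv, mul_smul, h, smul_zero]

theorem IsAbelianPGroup.subgroup (hM : IsAbelianPGroup p M) (H : AddSubgroup M) :
    IsAbelianPGroup p H := fun a => by
  obtain ⟨n, hn⟩ := hM a
  exact ⟨n, Subtype.ext (by simpa using hn)⟩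

theorem IsAbelianPGroup.quotient (hM : IsAbelianPGroup p M) (H : AddSubgroup M) :
    IsAbelianPGroup p (M ⧸ H) := fun a => by
  induction a using QuotientAddGroup.induction_on with
  | H a =>
    obtain ⟨n, hn⟩ := hM a
    refine ⟨n, ?_⟩
    rw [← QuotientAddGroup.mk_nsmul, hn, QuotientAddGroup.mk_zero]

theorem IsAbelianPGroup.exists_order (hM : IsAbelianPGroup p M) {x : M} (hx : x ≠ 0) :
    ∃ k : ℕ, p ^ k • x ≠ 0 ∧ p ^ (k + 1) • x = 0 := by
  classical
  have h := hM x
  have h0 : Nat.find h ≠ 0 := fun h0 => hx (by have := Nat.find_spec h; rw [h0] at this; simpa using this)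
  obtain ⟨k, hk⟩ := Nat.exists_eq_succ_of_ne_zero h0
  exact ⟨k, Nat.find_min h (by omega), by rw [← Nat.succ_eq_add_one, ← hk]; exact Nat.find_spec h⟩

theorem pow_smul_eq_zero_of_le {m n : ℕ} (h : m ≤ n) {x : M} (hx : p ^ m • x = 0) :
    p ^ n • x = 0 := by
  obtain ⟨c, rfl⟩ := Nat.exists_eq_add_of_le h
  rw [pow_add, mul_comm, mul_smul, hx, smul_zero]

/-- An integer is a power of `p` times an integer prime to `p`. -/
theorem exists_pow_mul (hp : p.Prime) {c : ℤ} (hc : c ≠ 0) :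
    ∃ (i : ℕ) (u : ℤ), c = (p : ℤ) ^ i * u ∧ ¬ (p : ℤ) ∣ u := by
  have hf : FiniteMultiplicity (p : ℤ) c :=
    Int.finiteMultiplicity_iff.mpr ⟨by simpa using hp.one_lt.ne', hc⟩
  obtain ⟨u, hu, hd⟩ := hf.exists_eq_pow_mul_and_not_dvd
  exact ⟨_, u, hu, hd⟩

/-- If a multiple `c • y` of an element of order `p ^ (j + 1)` equals `p ^ n • x`, then either it is
`p ^ n` times a multiple of `y`, or `p ^ j • y` is divisible by `p ^ (j + 1)`. -/
theorem smul_eq_pow_smul (hp : p.Prime) (hM : IsAbelianPGroup p M) {y x : M} {j n : ℕ} {c : ℤ}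
    (hy : p ^ (j + 1) • y = 0) (h : c • y = p ^ n • x)
    (hdiv : ∀ z : M, p ^ (j + 1) • z ≠ p ^ j • y) : ∃ t : ℤ, c • y = ((p : ℤ) ^ n * t) • y := by
  by_cases hc : c = 0
  · exact ⟨0, by simp [hc]⟩
  obtain ⟨i, u, rfl, hu⟩ := exists_pow_mul hp hc
  by_cases hin : n ≤ i
  · obtain ⟨k, rfl⟩ := Nat.exists_eq_add_of_le hin
    exact ⟨(p : ℤ) ^ k * u, by rw [pow_add]; ring_nf⟩
  by_cases hij : j + 1 ≤ i
  · refine ⟨0, ?_⟩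
    have : p ^ i • y = 0 := pow_smul_eq_zero_of_le hij hy
    rw [mul_comm, mul_smul, show ((p : ℤ) ^ i) • y = p ^ i • y by rw [← natCast_zsmul]; push_cast; rfl, this]
    simp
  -- Now `c = p ^ i * u` with `i < n` and `i ≤ j`. Multiplying the relation by `p ^ (j - i)` and by
  -- an inverse of `u` exhibits `p ^ j • y` as a multiple of `p ^ (j + 1)`.
  exfalso
  obtain ⟨v, hv⟩ := hM.inverse hp hu (p ^ j • y)
  obtain ⟨k, rfl⟩ := Nat.exists_eq_add_of_le (show i ≤ j by omega)
  obtain ⟨l, rfl⟩ := Nat.exists_eq_add_of_le (show i + 1 ≤ n by omega)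
  apply hdiv ((p ^ l * v) • x)
  rw [← hv]
  have h2 := congrArg (fun z => ((p : ℤ) ^ k * v) • z) h
  simp only [← natCast_zsmul, ← mul_smul] at h2 ⊢
  push_cast at h2 ⊢
  rw [show (p : ℤ) ^ (i + k + 1) * (p ^ l * v) = (p : ℤ) ^ k * v * p ^ (i + 1 + l) by ring, ← h2]
  congr 1
  ring

/-- A `p`-group all of whose elements of order `p` and of height at least `n` have infinite height
satisfies `p ^ n M = p ^ (n + 1) M`. -/
theorem exists_pure_generator (hM : IsAbelianPGroup p M) {n : ℕ}
    (h : ∃ x : M, ∀ z : M, p ^ (n + 1) • z ≠ p ^ n • x) :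
    ∃ (k : ℕ) (y : M), n ≤ k ∧ p ^ k • y ≠ 0 ∧ p ^ (k + 1) • y = 0 ∧
      ∀ z : M, p ^ (k + 1) • z ≠ p ^ k • y := by
  by_contra! hcon
  -- An element of order `p` in `p ^ n M` climbs one height at a time, since by the negated claim
  -- none of its representations `p ^ (n + k) • z` is the last one.
  have h1 : ∀ k, ∀ x : M, p • p ^ n • x = 0 → ∃ z, p ^ n • x = p ^ (n + k) • z := by
    intro k x hx
    induction k with
    | zero => exact ⟨x, rfl⟩
    | succ k ih =>
      obtain ⟨z, hz⟩ := ih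
      by_cases h0 : p ^ (n + k) • z = 0
      · exact ⟨0, by rw [hz, h0, smul_zero]⟩
      obtain ⟨w, hw⟩ := hcon (n + k) z (by omega) h0 (by rw [pow_succ', mul_smul, ← hz, hx])
      exact ⟨w, by rw [hz, ← hw]; rfl⟩
  -- Induction on the exponent of `p ^ n • x`. Dividing `p ^ n • (p • x)` by one extra power of `p`
  -- leaves `x - p ^ k • z`, whose `p ^ n`-multiple is killed by `p`.
  have h2 : ∀ r k, ∀ x : M, p ^ r • p ^ n • x = 0 → ∃ z, p ^ n • x = p ^ (n + k) • z := by
    intro r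
    induction r with
    | zero => exact fun k x hx => ⟨0, by simpa using hx⟩
    | succ r ih =>
      intro k x hx
      obtain ⟨z, hz⟩ := ih (k + 1) (p • x) (by
        rw [smul_comm (p ^ n) p x, ← mul_smul, ← pow_succ, hx])
      obtain ⟨w, hw⟩ := h1 k (x - p ^ k • z) (by
        rw [smul_sub, smul_sub, smul_comm p (p ^ n) x, hz, sub_eq_zero]
        simp only [← mul_smul]; congr 1; ring)
      refine ⟨w + z, ?_⟩
      rw [smul_add, ← hw, smul_sub, pow_add p n k, mul_smul, sub_add_cancel]
  obtain ⟨x, hx⟩ := h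
  obtain ⟨r, hr⟩ := hM (p ^ n • x)
  obtain ⟨z, hz⟩ := h2 r 1 x hr
  exact hx z hz.symm

/-- If `p ^ n M = p ^ (n + 1) M`, this subgroup is divisible by `p`, and by every integer prime to
`p` because those act invertibly on a `p`-group. It would be a nonzero divisible subgroup. -/
theorem IsReducedGroup.exists_not_divisible (hp : p.Prime) (hM : IsAbelianPGroup p M)
    (hR : IsReducedGroup M) {n : ℕ} (hn : ∃ x : M, p ^ n • x ≠ 0) :
    ∃ x : M, ∀ z : M, p ^ (n + 1) • z ≠ p ^ n • x := by
  by_contra! hcon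
  obtain ⟨x, hx⟩ := hn
  have hpow : ∀ k, ∀ x : M, ∃ z, p ^ (n + k) • z = p ^ n • x := by
    intro k
    induction k with
    | zero => exact fun x => ⟨x, rfl⟩
    | succ k ih =>
      intro x
      obtain ⟨z, hz⟩ := ih x
      obtain ⟨w, hw⟩ := hcon z
      refine ⟨w, ?_⟩
      rw [← hz, show n + (k + 1) = k + (n + 1) by ring, pow_add, mul_smul, hw, ← mul_smul, ← pow_add,
        add_comm]
  have := hR (nsmulAddMonoidHom (p ^ n) : M →+ M).range (by
    rintro N hN _ ⟨y, rfl⟩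
    obtain ⟨i, u, hiu, hu⟩ := exists_pow_mul hp (show (N : ℤ) ≠ 0 by exact_mod_cast hN)
    obtain ⟨z, hz⟩ := hpow i y
    obtain ⟨v, hv⟩ := hM.inverse hp hu (p ^ n • y)
    refine ⟨v • p ^ n • z, ⟨v • z, by rw [nsmulAddMonoidHom_apply, smul_comm]⟩, ?_⟩
    rw [← natCast_zsmul, hiu, nsmulAddMonoidHom_apply, ← hv, ← hz]
    simp only [← mul_smul, ← natCast_zsmul]
    congr 1
    push_cast
    ring)
  apply hx
  have hm : p ^ n • x ∈ (nsmulAddMonoidHom (p ^ n) : M →+ M).range := ⟨x, rfl⟩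
  rwa [this, AddSubgroup.mem_bot] at hm

end PGroup

/-! ### Pure independent systems -/

section Pure

variable {p : ℕ} {M : Type*} [AddCommGroup M]

/-- The integral combination of elements of `M` with the given coefficients. -/
noncomputable abbrev comb (c : M →₀ ℤ) : M := Finsupp.linearCombination ℤ (id : M → M) c

theorem mem_closure_iff_comb {s : Set M} {x : M} :
    x ∈ AddSubgroup.closure s ↔ ∃ c ∈ Finsupp.supported ℤ ℤ s, comb c = x := by
  have h := Finsupp.mem_span_image_iff_linearCombination ℤ (v := (id : M → M)) (s := s) (x := x)
  rw [Set.image_id] at h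
  rw [← h, ← Submodule.span_int_eq_addSubgroupClosure]
  rfl

theorem independentElems_iff {s : Set M} :
    IndependentElems s ↔
      ∀ c ∈ Finsupp.supported ℤ ℤ s, comb c = 0 → ∀ a, c a • a = 0 := by
  classical
  have hsup : ∀ i : s, (⨆ j, ⨆ (_ : j ≠ i), AddSubgroup.zmultiples ((j : s) : M)) =
      AddSubgroup.closure (s \ {(i : M)}) := by
    intro i
    apply le_antisymm
    · refine iSup₂_le fun j hj => ?_
      rw [AddSubgroup.zmultiples_le]
      exact AddSubgroup.subset_closure ⟨j.2, fun h => hj (Subtype.ext h)⟩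
    · rw [AddSubgroup.closure_le]
      rintro x ⟨hx, hxi⟩
      have : AddSubgroup.zmultiples x ≤ ⨆ j, ⨆ (_ : j ≠ i), AddSubgroup.zmultiples ((j : s) : M) :=
        le_iSup₂_of_le (⟨x, hx⟩ : s) (fun h => hxi (by rw [← h]; rfl)) le_rfl
      exact this (AddSubgroup.mem_zmultiples x)
  constructor
  · intro h c hc h0 a
    by_cases ha : a ∈ s
    · have hd := h ⟨a, ha⟩
      rw [hsup, AddSubgroup.disjoint_def] at hd
      apply hd (AddSubgroup.zsmul_mem_zmultiples a (c a))
      have hsplit := Finsupp.erase_add_single a c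
      rw [← hsplit] at h0
      simp only [comb, map_add, Finsupp.linearCombination_single, id] at h0
      rw [show c a • a = - comb (c.erase a) by rw [eq_neg_iff_add_eq_zero, add_comm]; exact h0]
      apply neg_mem
      rw [mem_closure_iff_comb]
      refine ⟨_, ?_, rfl⟩
      rw [Finsupp.mem_supported] at hc ⊢
      rw [Finsupp.support_erase, Finset.coe_erase]
      exact Set.sdiff_subset_sdiff_left hc
    · rw [Finsupp.mem_supported'] at hc
      rw [hc a ha, zero_smul]
  · intro h i
    rw [hsup, AddSubgroup.disjoint_def]
    rintro x ⟨t, rfl⟩ hx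
    rw [mem_closure_iff_comb] at hx
    obtain ⟨c, hc, hcx⟩ := hx
    have hci : c (i : M) = 0 := by
      rw [Finsupp.mem_supported'] at hc
      exact hc _ (by simp)
    have := h (Finsupp.single (i : M) t - c) (sub_mem (Finsupp.single_mem_supported _ _ i.2)
      (Finsupp.supported_mono Set.sdiff_subset hc)) (by
        simp [comb, Finsupp.linearCombination_single]
        rw [sub_eq_zero]; exact hcx.symm) i
    simpa [hci] using this

/-- A system of elements is pure independent if whenever a combination of them is divisible by a power
of `p`, each of its terms is so in the cyclic group of its generator. -/
def PureIndep (p : ℕ) (s : Set M) : Prop :=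
  ∀ c ∈ Finsupp.supported ℤ ℤ s, ∀ (n : ℕ) (x : M), p ^ n • x = comb c →
    ∀ a, ∃ t : ℤ, c a • a = ((p : ℤ) ^ n * t) • a

/-- A set of nonzero elements is a basis of a basic subgroup. -/
structure IsPBase (p : ℕ) (s : Set M) : Prop where
  pureIndep : PureIndep p s
  zero_notMem : (0 : M) ∉ s
  covers : ∀ x : M, ∃ c ∈ Finsupp.supported ℤ ℤ s, ∃ z : M, x = comb c + p • z

/-- Zero is divisible by every power of `p`, in particular by one that kills `a`. -/
theorem PureIndep.independent (hM : IsAbelianPGroup p M) {s : Set M} (hs : PureIndep p s)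
    {c : M →₀ ℤ} (hc : c ∈ Finsupp.supported ℤ ℤ s) (h0 : comb c = 0) (a : M) : c a • a = 0 := by
  obtain ⟨n, hn⟩ := hM a
  obtain ⟨t, ht⟩ := hs c hc n 0 (by rw [h0, smul_zero]) a
  rw [ht, mul_comm, mul_smul, show ((p : ℤ) ^ n) • a = p ^ n • a by
    rw [← natCast_zsmul]; push_cast; rfl, hn, smul_zero]

theorem pureIndep_singleton (hp : p.Prime) (hM : IsAbelianPGroup p M) {y : M} {j : ℕ}
    (hy : p ^ (j + 1) • y = 0) (hdiv : ∀ z : M, p ^ (j + 1) • z ≠ p ^ j • y) :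
    PureIndep p {y} := by
  intro c hc n x hx a
  by_cases ha : a = y
  · subst ha
    have hc' : c = Finsupp.single a (c a) := by
      ext b
      by_cases hb : b = a
      · simp [hb]
      · rw [Finsupp.mem_supported'] at hc
        rw [hc b (by simpa using hb), Finsupp.single_eq_of_ne hb]
    rw [hc'] at hx
    simp only [comb, Finsupp.linearCombination_single, id] at hx
    exact smul_eq_pow_smul hp hM hy hx.symm hdiv
  · rw [Finsupp.mem_supported'] at hc
    exact ⟨0, by rw [hc a (by simpa using ha)]; simp⟩

/-- A property tested on finitely supported combinations has finite character, so unions of chains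
inherit it. -/
theorem zorn_of_finsupp {α : Type*} (P : (α →₀ ℤ) → Prop) {s₀ : Set α}
    (h₀ : ∀ c ∈ Finsupp.supported ℤ ℤ s₀, P c) :
    ∃ s, s₀ ⊆ s ∧ Maximal (fun s : Set α => ∀ c ∈ Finsupp.supported ℤ ℤ s, P c) s := by
  apply zorn_subset_nonempty {s : Set α | ∀ c ∈ Finsupp.supported ℤ ℤ s, P c} ?_ s₀ h₀
  intro C hC hchain hne
  refine ⟨⋃₀ C, ?_, fun s hs => Set.subset_sUnion_of_mem hs⟩
  intro c hc
  rw [Finsupp.mem_supported] at hc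
  obtain ⟨t, htC, ht⟩ := hchain.directedOn.exists_mem_subset_of_finite_of_subset_sUnion hne
    c.support.finite_toSet hc
  exact hC htC c ((Finsupp.mem_supported _ _).mpr ht)

theorem comb_mem_closure {s : Set M} {c : M →₀ ℤ} (hc : c ∈ Finsupp.supported ℤ ℤ s) :
    comb c ∈ AddSubgroup.closure s := mem_closure_iff_comb.mpr ⟨c, hc, rfl⟩

/-- Divide a combination by a power of `p` using divisibility of its terms. -/
theorem exists_comb_eq_pow_smul {s : Set M} {c : M →₀ ℤ} (hc : c ∈ Finsupp.supported ℤ ℤ s) {n : ℕ}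
    (h : ∀ a, ∃ t : ℤ, c a • a = ((p : ℤ) ^ n * t) • a) :
    ∃ d ∈ Finsupp.supported ℤ ℤ s, comb c = p ^ n • comb d := by
  classical
  choose t ht using h
  refine ⟨Finsupp.onFinset c.support (fun a => if a ∈ c.support then t a else 0) (by
    intro a ha; by_contra h'; simp [h'] at ha), ?_, ?_⟩
  · rw [Finsupp.mem_supported] at hc ⊢
    exact (Finset.coe_subset.mpr Finsupp.support_onFinset_subset).trans hc
  · rw [comb, comb, Finsupp.linearCombination_apply, Finsupp.linearCombination_apply, Finsupp.sum,
      Finsupp.onFinset_sum _ (by simp), Finset.smul_sum]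
    refine Finset.sum_congr rfl fun a ha => ?_
    simp only [ha, if_true, id]
    rw [ht a, mul_smul, ← natCast_zsmul]
    push_cast; rfl

/-- Every pure independent system of nonzero elements extends to a basis of a basic subgroup. -/
theorem PureIndep.exists_base (hp : p.Prime) (hM : IsAbelianPGroup p M) {s₀ : Set M}
    (h₀ : PureIndep p s₀) (hz : (0 : M) ∉ s₀) : ∃ s, s₀ ⊆ s ∧ IsPBase p s := by
  classical
  obtain ⟨s, hs₀, hmax⟩ := zorn_of_finsupp (fun c : M →₀ ℤ => ∀ (n : ℕ) (x : M), p ^ n • x = comb c →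
    ∀ a, ∃ t : ℤ, c a • a = ((p : ℤ) ^ n * t) • a) h₀
  have hs : PureIndep p s := hmax.prop
  have hcov : ∀ x : M, ∃ c ∈ Finsupp.supported ℤ ℤ s, ∃ z : M, x = comb c + p • z := by
    by_contra! hcon
    obtain ⟨x, hx⟩ := hcon
    set B := AddSubgroup.closure s with hB
    obtain ⟨j, y', -, hy0, hy1, hy2⟩ := exists_pure_generator (hM.quotient B) (n := 0)
      ⟨(x : M ⧸ B), by
        intro z
        induction z using QuotientAddGroup.induction_on with
        | H z =>
        intro h
        rw [pow_zero, one_smul, ← QuotientAddGroup.mk_nsmul, eq_comm,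
          ← sub_eq_zero, ← QuotientAddGroup.mk_sub, QuotientAddGroup.eq_zero_iff] at h
        obtain ⟨c, hc, hcx⟩ := mem_closure_iff_comb.mp h
        exact hx c hc z (by rw [hcx]; simp)⟩
    obtain ⟨y₀, rfl⟩ := QuotientAddGroup.mk_surjective y'
    rw [← QuotientAddGroup.mk_nsmul, QuotientAddGroup.eq_zero_iff] at hy1
    obtain ⟨c₁, hc₁, hcy⟩ := mem_closure_iff_comb.mp hy1
    -- Purity divides the relation `p ^ (j + 1) • y₀ ∈ B` inside `B`. Subtracting the quotient gives
    -- a representative `y` of the same coset that is itself killed by `p ^ (j + 1)`.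
    obtain ⟨d₁, hd₁, hcd⟩ := exists_comb_eq_pow_smul hc₁ (hs c₁ hc₁ (j + 1) y₀ hcy.symm)
    set y := y₀ - comb d₁ with hy
    have hyy : (y : M ⧸ B) = y₀ := by
      rw [hy, QuotientAddGroup.mk_sub, (QuotientAddGroup.eq_zero_iff _).mpr (comb_mem_closure hd₁),
        sub_zero]
    have hyz : p ^ (j + 1) • y = 0 := by rw [hy, smul_sub, ← hcd, hcy, sub_self]
    rw [← hyy] at hy0 hy2
    have hyB : y ∉ B := fun h => hy0 (by rw [(QuotientAddGroup.eq_zero_iff _).mpr h, smul_zero])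
    have hys : y ∉ s := fun h => hyB (AddSubgroup.subset_closure h)
    refine hys (hmax.le_of_ge (y := insert y s) ?_ (Set.subset_insert y s) (Set.mem_insert y s))
    intro c hc n x hx a
    rw [Finsupp.mem_supported] at hc
    have hce : c.erase y ∈ Finsupp.supported ℤ ℤ s := by
      rw [Finsupp.mem_supported, Finsupp.support_erase, Finset.coe_erase]
      intro b hb
      exact (hc hb.1).resolve_left hb.2
    have hsum : comb c = comb (c.erase y) + c y • y := by
      conv_lhs => rw [← Finsupp.erase_add_single y c]
      simp [comb, Finsupp.linearCombination_single]
    have hq : (c y) • (y : M ⧸ B) = p ^ n • (x : M ⧸ B) := by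
      rw [← QuotientAddGroup.mk_nsmul, hx, hsum, QuotientAddGroup.mk_add,
        (QuotientAddGroup.eq_zero_iff _).mpr (comb_mem_closure hce), zero_add,
        QuotientAddGroup.mk_zsmul]
    obtain ⟨t, ht⟩ := smul_eq_pow_smul hp (hM.quotient B)
      (by rw [← QuotientAddGroup.mk_nsmul, hyz, QuotientAddGroup.mk_zero]) hq hy2
    -- The congruence modulo `B` is an equality in `M`: `y` and its coset have the same order `p ^
    -- (j + 1)`, so the cyclic group of `y` meets `B` trivially.
    have ht' : c y • y = ((p : ℤ) ^ n * t) • y := by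
      rw [← QuotientAddGroup.mk_zsmul, ← QuotientAddGroup.mk_zsmul, ← sub_eq_zero,
        ← QuotientAddGroup.mk_sub, QuotientAddGroup.eq_zero_iff, ← sub_smul] at ht
      rw [← sub_eq_zero, ← sub_smul]
      set r := c y - (p : ℤ) ^ n * t
      by_cases hr : r = 0
      · rw [hr, zero_smul]
      obtain ⟨i, u, hr', hu⟩ := exists_pow_mul hp hr
      by_cases hij : j + 1 ≤ i
      · have : p ^ i • y = 0 := pow_smul_eq_zero_of_le hij hyz
        rw [hr', mul_comm, mul_smul, show ((p : ℤ) ^ i) • y = p ^ i • y by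
          rw [← natCast_zsmul]; push_cast; rfl, this, smul_zero]
      exfalso
      obtain ⟨k, rfl⟩ := Nat.exists_eq_add_of_le (show i ≤ j by omega)
      obtain ⟨v, hv⟩ := hM.inverse hp hu (p ^ (i + k) • y)
      apply hy0
      rw [← QuotientAddGroup.mk_nsmul, QuotientAddGroup.eq_zero_iff, ← hv]
      have h3 := B.zsmul_mem ht ((p : ℤ) ^ k * v)
      rw [hr', ← mul_smul] at h3
      convert h3 using 1
      rw [← natCast_zsmul, ← mul_smul]
      congr 1
      push_cast
      ring
    by_cases ha : a = y
    · exact ⟨t, by rw [ha]; exact ht'⟩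
    · obtain ⟨t', ht''⟩ := hs (c.erase y) hce n (x - t • y) (by
        rw [smul_sub, hx, hsum, ht', mul_smul, ← natCast_zsmul, Nat.cast_pow, add_sub_cancel_right]) a
      exact ⟨t', by rwa [Finsupp.erase_ne ha] at ht''⟩
  -- Adjoining 0 does not disturb purity, so the maximal system may contain it and it has to be
  -- removed.
  refine ⟨s \ {0}, fun a ha => ⟨hs₀ ha, fun h => hz (by rwa [← h])⟩, ?_, by simp, ?_⟩
  · exact fun c hc => hs c (Finsupp.supported_mono Set.sdiff_subset hc)
  · intro x
    obtain ⟨c, hc, z, hx⟩ := hcov x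
    refine ⟨c.erase 0, ?_, z, ?_⟩
    · rw [Finsupp.mem_supported] at hc ⊢
      rw [Finsupp.support_erase, Finset.coe_erase]
      exact Set.sdiff_subset_sdiff_left hc
    · rw [hx]
      conv_lhs => rw [← Finsupp.erase_add_single 0 c]
      simp [comb, Finsupp.linearCombination_single]

theorem exists_isPBase (hp : p.Prime) (hM : IsAbelianPGroup p M) : ∃ s : Set M, IsPBase p s := by
  obtain ⟨s, -, hs⟩ := PureIndep.exists_base hp hM (s₀ := ∅) (by
    intro c hc n x hx a
    have : c = 0 := by
      rw [Finsupp.supported_empty] at hc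
      exact (Submodule.mem_bot ℤ).mp hc
    exact ⟨0, by simp [this]⟩) (by simp)
  exact ⟨s, hs⟩

theorem IsPBase.covers_pow {s : Set M} (hs : IsPBase p s) (k : ℕ) (x : M) :
    ∃ c ∈ Finsupp.supported ℤ ℤ s, ∃ z : M, x = comb c + p ^ k • z := by
  induction k with
  | zero => exact ⟨0, zero_mem _, x, by simp [comb]⟩
  | succ k ih =>
    obtain ⟨c, hc, z, hx⟩ := ih
    obtain ⟨d, hd, w, hz⟩ := hs.covers z
    refine ⟨c + (p : ℤ) ^ k • d, add_mem hc (Submodule.smul_mem _ _ hd), w, ?_⟩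
    rw [hx, hz]
    simp only [comb, map_add, map_smul, smul_add, ← add_assoc, pow_succ, mul_smul]
    congr 2
    rw [← natCast_zsmul]; push_cast; rfl

/-- Homomorphisms to a bounded group may be prescribed on a basis of a basic subgroup. -/
theorem IsPBase.exists_hom {s : Set M} (hs : IsPBase p s) {D : Type*}
    [AddCommGroup D] {k : ℕ} (hD : ∀ d : D, p ^ k • d = 0) (v : M → D)
    (hv : ∀ a ∈ s, ∀ c : ℤ, c • a = 0 → c • v a = 0) :
    ∃ h : M →+ D, ∀ a ∈ s, h a = v a := by
  -- `M` is a quotient of (combinations of `s`) × `M` through `(c, z) ↦ comb c + p ^ k • z`. The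
  -- prescribed map ignores `z`, as it must since `p ^ k` kills the target; purity of `s` makes it
  -- vanish on the kernel.
  let L : (Finsupp.supported ℤ ℤ s) × M →+ M :=
    ((Finsupp.linearCombination ℤ (id : M → M)).toAddMonoidHom.comp
      (Finsupp.supported ℤ ℤ s).subtype.toAddMonoidHom).coprod (nsmulAddMonoidHom (p ^ k))
  let L' : (Finsupp.supported ℤ ℤ s) × M →+ D :=
    ((Finsupp.linearCombination ℤ v).toAddMonoidHom.comp
      (Finsupp.supported ℤ ℤ s).subtype.toAddMonoidHom).coprod 0
  have hL : Function.Surjective L := by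
    intro x
    obtain ⟨c, hc, z, hx⟩ := hs.covers_pow k x
    exact ⟨(⟨c, hc⟩, z), by rw [hx]; rfl⟩
  have hker : L.ker ≤ L'.ker := by
    rintro ⟨⟨c, hc⟩, z⟩ h
    have h1 : comb c + p ^ k • z = 0 := h
    have h2 := hs.pureIndep c hc k (-z) (by rw [smul_neg, eq_comm]; exact eq_neg_of_add_eq_zero_left h1)
    change Finsupp.linearCombination ℤ v c + 0 = 0
    rw [add_zero, Finsupp.linearCombination_apply, Finsupp.sum]
    refine Finset.sum_eq_zero fun a ha => ?_
    obtain ⟨t, ht⟩ := h2 a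
    have has : a ∈ s := (Finsupp.mem_supported _ _).mp hc ha
    have h3 := hv a has (c a - (p : ℤ) ^ k * t) (by rw [sub_smul, ht, sub_self])
    rw [sub_smul, sub_eq_zero] at h3
    rw [h3, mul_comm, mul_smul, show ((p : ℤ) ^ k) • v a = p ^ k • v a by
      rw [← natCast_zsmul]; push_cast; rfl, hD, smul_zero]
  refine ⟨L.liftOfSurjective hL ⟨L', hker⟩, fun a ha => ?_⟩
  have := AddMonoidHom.liftOfRightInverse_comp_apply L _ (Function.rightInverse_surjInv hL) ⟨L', hker⟩
    (⟨Finsupp.single a 1, Finsupp.single_mem_supported _ _ ha⟩, 0)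
  have h1 : L (⟨Finsupp.single a 1, Finsupp.single_mem_supported _ _ ha⟩, 0) = a := by
    simp [L]
  have h2 : L' (⟨Finsupp.single a 1, Finsupp.single_mem_supported _ _ ha⟩, 0) = v a := by
    simp [L']
  rw [h1] at this
  exact this.trans h2

end Pure

/-! ### Basic subgroups and their ranks -/

section Ranks

variable {p : ℕ} {M : Type u} [AddCommGroup M]

/-- The elements `x` with `p ^ n x ∈ p ^ (n + 1) M`. -/
def layerKer (p n : ℕ) (M : Type*) [AddCommGroup M] : AddSubgroup M :=
  (nsmulAddMonoidHom (p ^ (n + 1)) : M →+ M).range.comap (nsmulAddMonoidHom (p ^ n))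

theorem mem_layerKer {n : ℕ} {x : M} : x ∈ layerKer p n M ↔ ∃ z : M, p ^ (n + 1) • z = p ^ n • x :=
  Iff.rfl

/-- The cardinality of `p ^ n M / p ^ (n + 1) M`. -/
noncomputable def layerCard (p n : ℕ) (M : Type u) [AddCommGroup M] : Cardinal.{u} :=
  #(M ⧸ layerKer p n M)

/-- The elements of `s` that `p ^ n` does not annihilate. -/
def highPart (p n : ℕ) (s : Set M) : Set M := {a ∈ s | p ^ n • a ≠ 0}

theorem mk_closure_le {κ : Cardinal.{u}} (hκ : ℵ₀ ≤ κ) {s : Set M} (hs : #s ≤ κ) :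
    #(AddSubgroup.closure s) ≤ κ := by
  rcases s.eq_empty_or_nonempty with rfl | hne
  · rw [AddSubgroup.closure_empty]
    exact (mk_le_one_iff_set_subsingleton.mpr (by simp)).trans (one_le_aleph0.trans hκ)
  have : Nonempty s := hne.to_subtype
  have hle : #(AddSubgroup.closure s) ≤ #(s →₀ ℤ) := by
    apply mk_le_of_surjective (f := fun c : s →₀ ℤ =>
      (⟨Finsupp.linearCombination ℤ (Subtype.val : s → M) c, by
        have h := (Finsupp.mem_span_iff_linearCombination ℤ s _).mpr ⟨c, rfl⟩
        rw [← Submodule.span_int_eq_addSubgroupClosure]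
        exact h⟩ : AddSubgroup.closure s))
    rintro ⟨x, hx⟩
    rw [← Submodule.span_int_eq_addSubgroupClosure] at hx
    obtain ⟨c, hc⟩ := (Finsupp.mem_span_iff_linearCombination ℤ s x).mp hx
    exact ⟨c, Subtype.ext hc⟩
  refine hle.trans ?_
  rw [mk_finsupp_lift_of_infinite']
  simpa using ⟨hs, hκ⟩

theorem IsAbelianPGroup.isAddTorsion (hp : p.Prime) (hM : IsAbelianPGroup p M) : IsAddTorsion M := by
  intro x
  obtain ⟨n, hn⟩ := hM x
  exact isOfFinAddOrder_iff_nsmul_eq_zero.mpr ⟨p ^ n, pow_pos hp.pos n, hn⟩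

theorem finite_closure (hp : p.Prime) (hM : IsAbelianPGroup p M) {s : Set M} (hs : s.Finite) :
    Finite (AddSubgroup.closure s) := by
  have : Finite s := hs
  exact AddCommGroup.finite_of_fg_isAddTorsion _ ((hM.subgroup _).isAddTorsion hp)

theorem layerKer_mono (n : ℕ) : layerKer p n M ≤ layerKer p (n + 1) M := by
  rintro x ⟨z, hz⟩
  refine ⟨z, ?_⟩
  simp only [nsmulAddMonoidHom_apply] at hz ⊢
  rw [pow_succ', mul_smul, hz, ← mul_smul, ← pow_succ']

theorem layerKer_le {m n : ℕ} (h : m ≤ n) : layerKer p m M ≤ layerKer p n M :=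
  monotone_nat_of_le_succ (fun n => layerKer_mono n) h

theorem mk_quotient_le_of_le {H K : AddSubgroup M} (h : H ≤ K) : #(M ⧸ K) ≤ #(M ⧸ H) := by
  apply mk_le_of_surjective (f := QuotientAddGroup.map H K (AddMonoidHom.id M) h)
  intro x
  obtain ⟨y, rfl⟩ := QuotientAddGroup.mk_surjective x
  exact ⟨(y : M ⧸ H), rfl⟩

theorem layerCard_anti {m n : ℕ} (h : m ≤ n) : layerCard p n M ≤ layerCard p m M :=
  mk_quotient_le_of_le (layerKer_le h)

variable {s : Set M}

/-- Purity turns `p ^ n • a` into a multiple of `p ^ (n + 1) • a`, and `1 - p t` acts injectively on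
a `p`-group. Hence distinct elements of the high part stay distinct in the layer. -/
theorem PureIndep.eq_zero_of_sub (hp : p.Prime) (hM : IsAbelianPGroup p M) (hs : PureIndep p s)
    {a b z : M} {n : ℕ} (ha : a ∈ s) (hb : b ∈ s) (hab : a ≠ b)
    (h : p ^ (n + 1) • z = p ^ n • (a - b)) : p ^ n • a = 0 := by
  classical
  obtain ⟨t, ht⟩ := hs (Finsupp.single a ((p : ℤ) ^ n) - Finsupp.single b ((p : ℤ) ^ n))
    (sub_mem (Finsupp.single_mem_supported _ _ ha) (Finsupp.single_mem_supported _ _ hb)) (n + 1) z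
    (by
      rw [h]
      simp only [comb, map_sub, Finsupp.linearCombination_single, id, smul_sub]
      simp only [← natCast_zsmul, Nat.cast_pow]) a
  rw [Finsupp.sub_apply, Finsupp.single_eq_same, Finsupp.single_eq_of_ne hab, sub_zero,
    ← sub_eq_zero, ← sub_smul] at ht
  have h2 : (1 - (p : ℤ) * t) • p ^ n • a = 0 := by
    rw [← ht, ← natCast_zsmul, ← mul_smul]
    congr 1
    push_cast
    ring
  refine hM.eq_zero_of_smul hp (fun hd => ?_) h2
  have : (p : ℤ) ∣ 1 := by simpa using dvd_add hd (dvd_mul_right (p : ℤ) t)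
  exact (Nat.prime_iff_prime_int.mp hp).not_isUnit (isUnit_of_dvd_one this)

theorem PureIndep.mk_highPart_le (hp : p.Prime) (hM : IsAbelianPGroup p M) (hs : PureIndep p s)
    (n : ℕ) : #(highPart p n s) ≤ layerCard p n M := by
  apply mk_le_of_injective (f := fun a : highPart p n s => ((a : M) : M ⧸ layerKer p n M))
  intro a b hab
  by_contra hne
  have h1 : (b : M) - a ∈ layerKer p n M := by
    have := QuotientAddGroup.eq.mp hab
    rwa [neg_add_eq_sub] at this
  obtain ⟨z, hz⟩ := mem_layerKer.mp h1
  exact b.2.2 (hs.eq_zero_of_sub hp hM b.2.1 a.2.1 (fun h => hne (Subtype.ext h.symm)) hz)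

theorem map_closure_eq (n : ℕ) : (AddSubgroup.closure s).map (nsmulAddMonoidHom (p ^ n)) =
    AddSubgroup.closure ((fun x => p ^ n • x) '' highPart p n s) := by
  rw [AddMonoidHom.map_closure]
  apply le_antisymm
  · rw [AddSubgroup.closure_le]
    rintro _ ⟨a, ha, rfl⟩
    by_cases h0 : p ^ n • a = 0
    · simp only [nsmulAddMonoidHom_apply, h0]; exact zero_mem _
    · exact AddSubgroup.subset_closure ⟨a, ⟨ha, h0⟩, rfl⟩
  · apply AddSubgroup.closure_mono
    rintro _ ⟨a, ha, rfl⟩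
    exact ⟨a, ha.1, rfl⟩

/-- `M` is generated by `s` modulo `p M`, so `p ^ n` times the subgroup generated by `s` covers the
layer. -/
theorem IsPBase.layerCard_le (hs : IsPBase p s) (n : ℕ) :
    layerCard p n M ≤ #((AddSubgroup.closure s).map (nsmulAddMonoidHom (p ^ n))) := by
  have hch : ∀ g : (AddSubgroup.closure s).map (nsmulAddMonoidHom (p ^ n)),
      ∃ b : M, p ^ n • b = g := fun g => by
    obtain ⟨b, -, hb⟩ := g.2
    exact ⟨b, hb⟩
  choose f hf using hch
  apply mk_le_of_surjective (f := fun g => ((f g : M) : M ⧸ layerKer p n M))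
  intro x
  obtain ⟨x, rfl⟩ := QuotientAddGroup.mk_surjective x
  obtain ⟨c, hc, z, hx⟩ := hs.covers x
  refine ⟨⟨p ^ n • comb c, _, comb_mem_closure hc, rfl⟩, ?_⟩
  rw [QuotientAddGroup.eq, mem_layerKer]
  refine ⟨z, ?_⟩
  rw [smul_add, smul_neg, hf, hx, smul_add, neg_add_cancel_left, pow_succ, mul_smul]

theorem IsPBase.mk_map_le (n : ℕ) {κ : Cardinal.{u}} (hκ : ℵ₀ ≤ κ)
    (h : #(highPart p n s) ≤ κ) :
    #((AddSubgroup.closure s).map (nsmulAddMonoidHom (p ^ n))) ≤ κ := by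
  rw [map_closure_eq]
  exact mk_closure_le hκ (mk_image_le.trans h)

theorem IsPBase.infinite_highPart (hp : p.Prime) (hM : IsAbelianPGroup p M) (hs : IsPBase p s) {n : ℕ}
    (h : ℵ₀ ≤ layerCard p n M) : ℵ₀ ≤ #(highPart p n s) := by
  by_contra hlt
  rw [not_le, lt_aleph0_iff_set_finite] at hlt
  have hfin := finite_closure hp hM (hlt.image (fun x => p ^ n • x))
  rw [← map_closure_eq] at hfin
  exact absurd (h.trans (hs.layerCard_le n)) (not_le.mpr (lt_aleph0_iff_finite.mpr hfin))

theorem IsPBase.layerCard_eq (hp : p.Prime) (hM : IsAbelianPGroup p M) (hs : IsPBase p s) {n : ℕ}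
    (h : ℵ₀ ≤ layerCard p n M) : layerCard p n M = #(highPart p n s) :=
  le_antisymm ((hs.layerCard_le n).trans (IsPBase.mk_map_le n (hs.infinite_highPart hp hM h) le_rfl))
    (hs.pureIndep.mk_highPart_le hp hM n)

theorem IsPBase.layerCard_le_of_mk_le (hs : IsPBase p s) (n : ℕ) {κ : Cardinal.{u}} (hκ : ℵ₀ ≤ κ)
    (h : #s ≤ κ) : layerCard p n M ≤ κ :=
  (hs.layerCard_le n).trans (IsPBase.mk_map_le n hκ ((mk_le_mk_of_subset fun _ ha => ha.1).trans h))

theorem IsPBase.mk_le (hp : p.Prime) (hM : IsAbelianPGroup p M) (hs : IsPBase p s) :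
    #s ≤ layerCard p 0 M := by
  refine le_trans (mk_le_mk_of_subset fun a ha => ?_) (hs.pureIndep.mk_highPart_le hp hM 0)
  exact ⟨ha, by rw [pow_zero, one_smul]; rintro rfl; exact hs.zero_notMem ha⟩

/-- The subgroup generated by a basis `s` covers `M` modulo every `p ^ k M`, so the first layer
alone bounds all these quotients. -/
theorem mk_quotient_pow_le (hp : p.Prime) (hM : IsAbelianPGroup p M) {κ : Cardinal.{u}} (hκ : ℵ₀ ≤ κ)
    (h : layerCard p 0 M ≤ κ) (k : ℕ) :
    #(M ⧸ (nsmulAddMonoidHom (p ^ k) : M →+ M).range) ≤ κ := by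
  obtain ⟨s, hs⟩ := exists_isPBase hp hM
  refine le_trans ?_ (mk_closure_le hκ ((hs.mk_le hp hM).trans h))
  apply mk_le_of_surjective (f := fun g : AddSubgroup.closure s =>
    ((g : M) : M ⧸ (nsmulAddMonoidHom (p ^ k) : M →+ M).range))
  intro x
  obtain ⟨x, rfl⟩ := QuotientAddGroup.mk_surjective x
  obtain ⟨c, hc, z, hx⟩ := hs.covers_pow k x
  refine ⟨⟨comb c, comb_mem_closure hc⟩, ?_⟩
  rw [QuotientAddGroup.eq]
  exact ⟨z, by rw [hx]; simp⟩

theorem mk_le_of_bounded (hp : p.Prime) (hM : IsAbelianPGroup p M) {κ : Cardinal.{u}} (hκ : ℵ₀ ≤ κ)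
    (h : layerCard p 0 M ≤ κ) {k : ℕ} (hk : ∀ x : M, p ^ k • x = 0) : #M ≤ κ := by
  refine le_trans ?_ (mk_quotient_pow_le hp hM hκ h k)
  apply mk_le_of_injective (f := fun x : M => (x : M ⧸ (nsmulAddMonoidHom (p ^ k) : M →+ M).range))
  intro x y hxy
  obtain ⟨z, hz⟩ := QuotientAddGroup.eq.mp hxy
  rw [nsmulAddMonoidHom_apply, hk] at hz
  exact (neg_add_eq_zero.mp hz.symm)

/-! #### The rank -/

theorem rank_le_mk (G : Type u) [AddCommGroup G] : rank G ≤ #G := by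
  unfold rank
  rcases Set.eq_empty_or_nonempty {κ | ∃ s : Set G, Maximal IsRankSystem s ∧ #s = κ} with h | ⟨κ, hκ⟩
  · rw [h, Cardinal.sInf_empty]; exact zero_le
  · refine (csInf_le' hκ).trans ?_
    obtain ⟨s, -, rfl⟩ := hκ
    exact mk_set_le s

theorem exists_maximal_isRankSystem (G : Type u) [AddCommGroup G] :
    ∃ s : Set G, Maximal IsRankSystem s := by
  obtain ⟨m, hm⟩ := zorn_subset {s : Set G | IsRankSystem s} (by
    intro C hC hchain
    rcases C.eq_empty_or_nonempty with rfl | hne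
    · refine ⟨∅, ⟨independentElems_iff.mpr ?_, by simp⟩, by simp⟩
      intro c hc _ a
      have : c = 0 := by
        rw [Finsupp.supported_empty] at hc
        exact (Submodule.mem_bot ℤ).mp hc
      simp [this]
    refine ⟨⋃₀ C, ⟨independentElems_iff.mpr ?_, ?_⟩, fun s hs => Set.subset_sUnion_of_mem hs⟩
    · intro c hc h0
      rw [Finsupp.mem_supported] at hc
      obtain ⟨t, htC, ht⟩ := hchain.directedOn.exists_mem_subset_of_finite_of_subset_sUnion hne
        c.support.finite_toSet hc
      exact independentElems_iff.mp (hC htC).1 c ((Finsupp.mem_supported _ _).mpr ht) h0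
    · rintro a ⟨t, ht, ha⟩
      exact (hC ht).2 a ha)
  exact ⟨m, hm⟩

/-- An element of order `p` outside the closure would have its whole cyclic group independent of
`s`, and could be adjoined. -/
theorem mem_closure_of_maximal (hp : p.Prime) (hM : IsAbelianPGroup p M)
    (hs : Maximal IsRankSystem s) {g : M} (hg : p • g = 0) : g ∈ AddSubgroup.closure s := by
  classical
  by_cases hg0 : g = 0
  · rw [hg0]; exact zero_mem _
  by_contra hgs
  have hnot : g ∉ s := fun h => hgs (AddSubgroup.subset_closure h)
  refine hnot (hs.le_of_ge (y := insert g s) ⟨independentElems_iff.mpr ?_, ?_⟩ (Set.subset_insert g s)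
    (Set.mem_insert g s))
  · intro c hc h0 a
    rw [Finsupp.mem_supported] at hc
    have hce : c.erase g ∈ Finsupp.supported ℤ ℤ s := by
      rw [Finsupp.mem_supported, Finsupp.support_erase, Finset.coe_erase]
      intro b hb
      exact (hc hb.1).resolve_left hb.2
    have hsum : comb c = comb (c.erase g) + c g • g := by
      conv_lhs => rw [← Finsupp.erase_add_single g c]
      simp [comb, Finsupp.linearCombination_single]
    have hcg : c g • g = 0 := by
      by_cases hd : (p : ℤ) ∣ c g
      · obtain ⟨t, ht⟩ := hd
        rw [ht, mul_comm, mul_smul, natCast_zsmul, hg, smul_zero]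
      · exfalso
        apply hgs
        obtain ⟨v, hv⟩ := hM.inverse hp hd g
        rw [← hv, mul_smul]
        apply AddSubgroup.zsmul_mem
        rw [show c g • g = - comb (c.erase g) by
          rw [eq_neg_iff_add_eq_zero, add_comm, ← hsum, h0]]
        exact neg_mem (comb_mem_closure hce)
    rw [hcg, add_zero] at hsum
    by_cases ha : a = g
    · rw [ha, hcg]
    · have := independentElems_iff.mp hs.prop.1 _ hce (by rw [← hsum, h0]) a
      rwa [Finsupp.erase_ne ha] at this
  · rintro a (rfl | ha)
    · right
      have : addOrderOf a = p :=
        haveI : Fact p.Prime := ⟨hp⟩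
        addOrderOf_eq_prime_iff.mpr ⟨hg, hg0⟩
      rw [this]
      exact hp.isPrimePow
    · exact hs.prop.2 a ha

theorem IsPBase.rank_eq (hp : p.Prime) (hM : IsAbelianPGroup p M) (hs : IsPBase p s) {n : ℕ}
    (h : ℵ₀ ≤ layerCard p n M) :
    rank ((AddSubgroup.closure s).map (nsmulAddMonoidHom (p ^ n))) = layerCard p n M := by
  rw [hs.layerCard_eq hp hM h]
  have hinf := hs.infinite_highPart hp hM h
  set G := (AddSubgroup.closure s).map (nsmulAddMonoidHom (p ^ n)) with hG
  -- `rank` is an infimum over maximal systems, so every one of them has to be measured. Above, `σ`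
  -- is bounded by the whole group. Below, the last nonzero multiples of the high basis elements are
  -- distinct elements of order `p` in the closure of `σ`, which is no larger than an infinite `σ`.
  have key : ∀ σ : Set G, Maximal IsRankSystem σ → #σ = #(highPart p n s) := by
    intro σ hσ
    have hlast : ∀ a : highPart p n s, ∃ r : ℕ, p ^ (n + r) • (a : M) ≠ 0 ∧
        p ^ (n + r + 1) • (a : M) = 0 := by
      rintro ⟨a, ha, ha0⟩
      obtain ⟨r, hr, hr'⟩ := hM.exists_order ha0
      refine ⟨r, ?_, ?_⟩
      · rwa [add_comm, pow_add, mul_smul]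
      · rwa [add_assoc, add_comm, pow_add, mul_smul]
    choose r hr hr' using hlast
    have hle : #(highPart p n s) ≤ #(AddSubgroup.closure σ) := by
      apply mk_le_of_injective (f := fun a : highPart p n s => (⟨⟨p ^ (n + r a) • (a : M), by
          rw [pow_add, mul_smul, hG]
          exact ⟨p ^ r a • (a : M), AddSubgroup.nsmul_mem _ (AddSubgroup.subset_closure a.2.1) _, rfl⟩⟩,
          mem_closure_of_maximal hp (hM.subgroup G) hσ (Subtype.ext (by
            simp only [AddSubgroup.coe_nsmul, AddSubgroup.coe_zero]
            rw [← mul_smul, ← pow_succ', hr']))⟩ : AddSubgroup.closure σ))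
      intro a b hab
      have hab' : p ^ (n + r a) • (a : M) = p ^ (n + r b) • (b : M) :=
        congrArg (fun x : AddSubgroup.closure σ => ((x : G) : M)) hab
      by_contra hne
      have hne' : (a : M) ≠ b := fun h => hne (Subtype.ext h)
      have := hs.pureIndep.independent hM (c := Finsupp.single (a : M) ((p : ℤ) ^ (n + r a)) -
        Finsupp.single (b : M) ((p : ℤ) ^ (n + r b))) (sub_mem
          (Finsupp.single_mem_supported _ _ a.2.1) (Finsupp.single_mem_supported _ _ b.2.1)) (by
          simp only [comb, map_sub, Finsupp.linearCombination_single, id]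
          rw [sub_eq_zero]
          simpa only [← natCast_zsmul, Nat.cast_pow] using hab') a
      rw [Finsupp.sub_apply, Finsupp.single_eq_same, Finsupp.single_eq_of_ne hne', sub_zero] at this
      exact hr a (by rw [← this, ← natCast_zsmul, Nat.cast_pow])
    have hσinf : ℵ₀ ≤ #σ := by
      by_contra hlt
      rw [not_le, lt_aleph0_iff_set_finite] at hlt
      have := finite_closure hp (hM.subgroup G) hlt
      exact absurd (hinf.trans hle) (not_le.mpr (lt_aleph0_iff_finite.mpr this))
    exact le_antisymm ((mk_set_le σ).trans (IsPBase.mk_map_le n hinf le_rfl))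
      (hle.trans (mk_closure_le hσinf le_rfl))
  obtain ⟨σ, hσ⟩ := exists_maximal_isRankSystem G
  have hset : {κ | ∃ σ : Set G, Maximal IsRankSystem σ ∧ #σ = κ} = {#(highPart p n s)} := by
    ext κ
    constructor
    · rintro ⟨τ, hτ, rfl⟩; exact key τ hτ
    · rintro rfl; exact ⟨σ, hσ, key σ hσ⟩
  rw [rank, hset, csInf_singleton]

/-! #### Basic subgroups -/

theorem IsPBase.isBasic (hp : p.Prime) (hM : IsAbelianPGroup p M) (hs : IsPBase p s) :
    IsBasic p (AddSubgroup.closure s) where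
  directSum := by
    refine ⟨s, independentElems_iff.mpr fun c hc h0 a => hs.pureIndep.independent hM hc h0 a, rfl, ?_⟩
    intro a ha
    obtain ⟨n, hn⟩ := hM a
    obtain ⟨k, -, hk⟩ := (Nat.dvd_prime_pow hp).mp (addOrderOf_dvd_of_nsmul_eq_zero hn)
    exact Or.inr ⟨k, hk⟩
  pure := by
    rintro n g hg ⟨x, hx⟩
    by_cases hn : n = 0
    · exact ⟨0, zero_mem _, by rw [← hx, hn]; simp⟩
    obtain ⟨i, u, rfl, hu⟩ := exists_pow_mul hp hn
    obtain ⟨c, hc, rfl⟩ := mem_closure_iff_comb.mp hg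
    obtain ⟨d, hd, hcd⟩ := exists_comb_eq_pow_smul hc (hs.pureIndep c hc i (u • x) (by
      rw [← hx, ← natCast_zsmul, ← mul_smul, Nat.cast_pow]))
    obtain ⟨v, hv⟩ := hM.inverse hp hu (comb d)
    refine ⟨v • comb d, AddSubgroup.zsmul_mem _ (comb_mem_closure hd) _, ?_⟩
    rw [hcd]
    conv_rhs => rw [← hv]
    rw [← natCast_zsmul, ← mul_smul, ← mul_smul, Nat.cast_pow]
    congr 1
    ring
  divisible := by
    intro x
    obtain ⟨x, rfl⟩ := QuotientAddGroup.mk_surjective x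
    obtain ⟨c, hc, z, hx⟩ := hs.covers x
    refine ⟨(z : M ⧸ AddSubgroup.closure s), ?_⟩
    rw [hx, QuotientAddGroup.mk_add, (QuotientAddGroup.eq_zero_iff _).mpr (comb_mem_closure hc),
      zero_add, QuotientAddGroup.mk_nsmul]

/-- Purity of `B` divides a combination inside `B`, and independence of the generators then compares
coefficients term by term. -/
theorem IsBasic.exists_isPBase {B : AddSubgroup M} (hB : IsBasic p B) :
    ∃ s : Set M, IsPBase p s ∧ AddSubgroup.closure s = B := by
  obtain ⟨s, hind, hcl, -⟩ := hB.directSum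
  rw [independentElems_iff] at hind
  have hcl' : AddSubgroup.closure (s \ {0}) = B := by
    rw [← hcl]
    apply le_antisymm (AddSubgroup.closure_mono Set.sdiff_subset)
    rw [AddSubgroup.closure_le]
    intro a ha
    by_cases h0 : a = 0
    · rw [h0]; exact zero_mem _
    · exact AddSubgroup.subset_closure ⟨ha, h0⟩
  refine ⟨s \ {0}, ⟨?_, by simp, ?_⟩, hcl'⟩
  · intro c hc n x hx a
    obtain ⟨b, hb, hbx⟩ := hB.pure ((p : ℤ) ^ n) (comb c) (hcl' ▸ comb_mem_closure hc)
      ⟨x, by rw [← hx, ← natCast_zsmul, Nat.cast_pow]⟩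
    rw [← hcl'] at hb
    obtain ⟨d, hd, rfl⟩ := mem_closure_iff_comb.mp hb
    have := hind (c - (p : ℤ) ^ n • d) (Finsupp.supported_mono Set.sdiff_subset
      (sub_mem hc (Submodule.smul_mem _ _ hd))) (by
        simp only [comb, map_sub, map_smul] at hbx ⊢
        rw [hbx, sub_self]) a
    refine ⟨d a, ?_⟩
    rwa [Finsupp.sub_apply, Finsupp.smul_apply, smul_eq_mul, sub_smul, sub_eq_zero] at this
  · intro x
    obtain ⟨y, hy⟩ := hB.divisible (x : M ⧸ B)
    obtain ⟨z, rfl⟩ := QuotientAddGroup.mk_surjective y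
    rw [← QuotientAddGroup.mk_nsmul, eq_comm, ← sub_eq_zero, ← QuotientAddGroup.mk_sub,
      QuotientAddGroup.eq_zero_iff, ← hcl'] at hy
    obtain ⟨c, hc, hcx⟩ := mem_closure_iff_comb.mp hy
    exact ⟨c, hc, z, by rw [hcx]; simp⟩

theorem exists_isBasic (hp : p.Prime) (hM : IsAbelianPGroup p M) : ∃ B : AddSubgroup M, IsBasic p B := by
  obtain ⟨s, hs⟩ := AutFinal.exists_isPBase hp hM
  exact ⟨_, hs.isBasic hp hM⟩

theorem IsBasic.rank_map (hp : p.Prime) (hM : IsAbelianPGroup p M) {B : AddSubgroup M}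
    (hB : IsBasic p B) {n : ℕ} (h : ℵ₀ ≤ layerCard p n M) :
    rank (B.map (nsmulAddMonoidHom (p ^ n))) = layerCard p n M := by
  obtain ⟨s, hs, rfl⟩ := hB.exists_isPBase
  exact hs.rank_eq hp hM h

theorem hasBasicRank_layerCard (hp : p.Prime) (hM : IsAbelianPGroup p M) (h : ℵ₀ ≤ layerCard p 0 M) :
    HasBasicRank p M (layerCard p 0 M) := by
  refine ⟨exists_isBasic hp hM, fun B hB => ?_⟩
  rw [← hB.rank_map hp hM h]
  have : B.map (nsmulAddMonoidHom (p ^ 0)) = B := by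
    ext x
    simp [AddSubgroup.mem_map]
  rw [this]

theorem hasFinalRank_iInf (hp : p.Prime) (hM : IsAbelianPGroup p M) (h : ∀ n, ℵ₀ ≤ layerCard p n M) :
    HasFinalRank p M (⨅ n, layerCard p n M) := by
  refine ⟨exists_isBasic hp hM, fun B hB => ?_⟩
  rw [finalRank]
  congr 1
  ext n
  rw [hB.rank_map hp hM (h n)]

theorem HasBasicRank.unique {κ κ' : Cardinal.{u}} (h : HasBasicRank p M κ) (h' : HasBasicRank p M κ') :
    κ = κ' := by
  obtain ⟨B, hB⟩ := h.1
  rw [← h.2 B hB, h'.2 B hB]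

theorem HasFinalRank.unique {κ κ' : Cardinal.{u}} (h : HasFinalRank p M κ) (h' : HasFinalRank p M κ') :
    κ = κ' := by
  obtain ⟨B, hB⟩ := h.1
  rw [← h.2 B hB, h'.2 B hB]

/-- In an unbounded reduced `p`-group all quotients `p ^ n M / p ^ (n + 1) M` are infinite. -/
theorem aleph0_le_layerCard (hp : p.Prime) (hM : IsAbelianPGroup p M) (hR : IsReducedGroup M)
    (hU : IsUnboundedGroup M) (n : ℕ) : ℵ₀ ≤ layerCard p n M := by
  obtain ⟨s, hs⟩ := AutFinal.exists_isPBase hp hM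
  by_contra hlt
  rw [not_le] at hlt
  have hfin : (highPart p n s).Finite :=
    lt_aleph0_iff_set_finite.mp ((hs.pureIndep.mk_highPart_le hp hM n).trans_lt hlt)
  -- With a finite high part, one power `p ^ N` kills all of `s`; the summand `n` takes care of the
  -- elements outside the high part. Then `p ^ N M = p ^ (N + 1) M`, contrary to reducedness.
  have hb : ∃ N, n ≤ N ∧ ∀ a ∈ s, p ^ N • a = 0 := by
    choose f hf using hM
    refine ⟨hfin.toFinset.sup f + n, by omega, fun a ha => ?_⟩
    by_cases h0 : p ^ n • a = 0
    · exact pow_smul_eq_zero_of_le (by omega) h0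
    · have : f a ≤ hfin.toFinset.sup f := Finset.le_sup (hfin.mem_toFinset.mpr ⟨ha, h0⟩)
      exact pow_smul_eq_zero_of_le (by omega) (hf a)
  obtain ⟨N, -, hN⟩ := hb
  obtain ⟨x, hx⟩ := hR.exists_not_divisible hp hM (n := N) (hU (p ^ N) (pow_pos hp.pos N).ne')
  obtain ⟨c, hc, z, hxz⟩ := hs.covers x
  apply hx z
  have h0 : p ^ N • comb c = 0 := by
    rw [comb, Finsupp.linearCombination_apply, Finsupp.sum, Finset.smul_sum]
    refine Finset.sum_eq_zero fun a ha => ?_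
    rw [smul_comm, id, hN a ((Finsupp.mem_supported _ _).mp hc ha), smul_zero]
  rw [hxz, smul_add, h0, zero_add, pow_succ, mul_smul]

end Ranks

/-- The standing assumptions: `p` is an odd prime and `A` an unbounded reduced Abelian `p`-group. -/
structure Setting (p : ℕ) (A : Type*) [AddCommGroup A] : Prop where
  prime : p.Prime
  odd : p ≠ 2
  pGroup : IsAbelianPGroup p A
  reduced : IsReducedGroup A
  unbounded : IsUnboundedGroup A

/-! ### Projections -/

section Projections

variable {p : ℕ} {A : Type u} [AddCommGroup A]

def Idem (e : A →+ A) : Prop := ∀ a, e (e a) = e a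

/-- `e ≤ w` in the order of projections: `w e = e w = e`. -/
def Below (e w : A →+ A) : Prop := (∀ a, w (e a) = e a) ∧ ∀ a, e (w a) = e a

/-- `e` is a projection onto the cyclic group of order `p ^ (k + 1)` generated by `a`. -/
structure Cyc (p : ℕ) (e : A →+ A) (a : A) (k : ℕ) : Prop where
  gen : e a = a
  ne : p ^ k • a ≠ 0
  zero : p ^ (k + 1) • a = 0
  span : ∀ x, ∃ c : ℤ, e x = c • a

/-- Every element of order `p` in the range of `w` is divisible by `p ^ m`. -/
def SocleDiv (p : ℕ) (w : A →+ A) (m : ℕ) : Prop := ∀ a, w a = a → p • a = 0 → ∃ b, p ^ m • b = a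

theorem Idem.compl {e : A →+ A} (he : Idem e) : Idem (AddMonoidHom.id A - e) := fun a => by
  simp [he a]

theorem Idem.mem_range {e : A →+ A} (he : Idem e) {a : A} : a ∈ e.range ↔ e a = a :=
  ⟨by rintro ⟨x, rfl⟩; exact he x, fun h => ⟨a, h⟩⟩

theorem Below.trans {e f w : A →+ A} (h : Below e f) (h' : Below f w) : Below e w :=
  ⟨fun a => by rw [← h.1 a, h'.1], fun a => by rw [← h.2 (w a), h'.2, h.2]⟩

theorem Below.sub_idem {e w : A →+ A} (h : Below e w) (he : Idem e) (hw : Idem w) : Idem (w - e) :=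
  fun a => by simp [hw a, h.1 a, h.2 a, he a]

theorem Below.sub {e w : A →+ A} (h : Below e w) (hw : Idem w) : Below (w - e) w :=
  ⟨fun a => by simp [hw a, h.1 a], fun a => by simp [hw a, h.2 a]⟩

theorem pow_dvd_of_smul_eq_zero (hp : p.Prime) (hA : IsAbelianPGroup p A) {a : A} {k : ℕ}
    (hne : p ^ k • a ≠ 0) {c : ℤ} (h : c • a = 0) : (p : ℤ) ^ (k + 1) ∣ c := by
  by_cases hc : c = 0
  · simp [hc]
  obtain ⟨i, u, rfl, hu⟩ := exists_pow_mul hp hc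
  by_cases hik : k + 1 ≤ i
  · exact (pow_dvd_pow _ hik).mul_right u
  exfalso
  apply hne
  rw [mul_comm, mul_smul] at h
  have h2 := hA.eq_zero_of_smul hp hu h
  apply pow_smul_eq_zero_of_le (show i ≤ k by omega)
  rw [← h2, ← natCast_zsmul, Nat.cast_pow]

variable {e w : A →+ A} {a : A} {k : ℕ}

theorem Cyc.idem (h : Cyc p e a k) : Idem e := fun x => by
  obtain ⟨c, hc⟩ := h.span x
  rw [hc, map_zsmul, h.gen]

theorem Cyc.pow_smul (h : Cyc p e a k) (x : A) : p ^ (k + 1) • e x = 0 := by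
  obtain ⟨c, hc⟩ := h.span x
  rw [hc, smul_comm, h.zero, smul_zero]

theorem Cyc.ne_zero (h : Cyc p e a k) : a ≠ 0 := fun h0 => h.ne (by rw [h0, smul_zero])

theorem Cyc.range_eq (h : Cyc p e a k) : e.range = AddSubgroup.zmultiples a := by
  ext x
  constructor
  · rintro ⟨y, rfl⟩
    obtain ⟨c, hc⟩ := h.span y
    exact ⟨c, hc.symm⟩
  · rintro ⟨c, rfl⟩
    exact ⟨c • a, by simp [h.gen]⟩

theorem mk_zmultiples (hp : p.Prime) (hne : p ^ k • a ≠ 0) (h0 : p ^ (k + 1) • a = 0) :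
    #(AddSubgroup.zmultiples a) = ((p ^ (k + 1) : ℕ) : Cardinal) := by
  have hord : addOrderOf a = p ^ (k + 1) := by
    have : Fact p.Prime := ⟨hp⟩
    exact addOrderOf_eq_prime_pow hne h0
  have hf : Finite (AddSubgroup.zmultiples a) := by
    apply Nat.finite_of_card_ne_zero
    rw [Nat.card_zmultiples, hord]
    exact (pow_pos hp.pos _).ne'
  rw [← Nat.cast_card, Nat.card_zmultiples, hord]

theorem Cyc.mk_range (hp : p.Prime) (h : Cyc p e a k) : #e.range = ((p ^ (k + 1) : ℕ) : Cardinal) := by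
  rw [h.range_eq, mk_zmultiples hp h.ne h.zero]

theorem pow_card_le_iff (hp : p.Prime) {k l : ℕ} :
    ((p ^ (k + 1) : ℕ) : Cardinal.{u}) ≤ ((p ^ (l + 1) : ℕ) : Cardinal.{u}) ↔ k ≤ l := by
  rw [Nat.cast_le, Nat.pow_le_pow_iff_right hp.one_lt]
  omega

/-- The projection is the coordinate along `a`: it fixes `a` and kills the other basis elements.
This is possible because the target is bounded. -/
theorem IsPBase.exists_cyc {s : Set A} (hs : IsPBase p s) (ha : a ∈ s)
    (hne : p ^ k • a ≠ 0) (h0 : p ^ (k + 1) • a = 0) :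
    ∃ e : A →+ A, Cyc p e a k := by
  classical
  obtain ⟨h, hh⟩ := hs.exists_hom (D := AddSubgroup.zmultiples a) (k := k + 1)
    (by rintro ⟨_, c, rfl⟩; exact Subtype.ext (by simp [smul_comm _ c, h0]))
    (fun b => if b = a then ⟨a, AddSubgroup.mem_zmultiples a⟩ else 0)
    (by
      intro b _ c hc
      split_ifs with hb
      · exact Subtype.ext (by simpa [hb] using hc)
      · simp)
  refine ⟨(AddSubgroup.subtype _).comp h, ?_, hne, h0, fun x => ?_⟩
  · simp [hh a ha]
  · obtain ⟨c, hc⟩ := (h x).2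
    exact ⟨c, hc.symm⟩

theorem exists_cyc_of_pure (hp : p.Prime) (hA : IsAbelianPGroup p A) (hne : p ^ k • a ≠ 0)
    (h0 : p ^ (k + 1) • a = 0) (hdiv : ∀ z : A, p ^ (k + 1) • z ≠ p ^ k • a) :
    ∃ e : A →+ A, Cyc p e a k := by
  obtain ⟨s, has, hs⟩ := (pureIndep_singleton hp hA h0 hdiv).exists_base hp hA
    (by rintro h; rw [← Set.mem_singleton_iff.mp h] at hne; exact hne (smul_zero _))
  exact hs.exists_cyc (has rfl) hne h0

theorem Cyc.comp (h : Cyc p e a k) (hw : Idem w) (ha : w a = a) :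
    Cyc p (e.comp w) a k ∧ Below (e.comp w) w := by
  refine ⟨⟨by simp [ha, h.gen], h.ne, h.zero, fun x => h.span (w x)⟩, fun x => ?_, fun x => by
    simp [hw x]⟩
  obtain ⟨c, hc⟩ := h.span (w x)
  simp [hc, ha]

theorem exists_cyc_below (hp : p.Prime) (hA : IsAbelianPGroup p A) (hw : Idem w) (ha : w a = a)
    (hne : p ^ k • a ≠ 0) (h0 : p ^ (k + 1) • a = 0)
    (hdiv : ∀ z : A, p ^ (k + 1) • z ≠ p ^ k • a) : ∃ e : A →+ A, Cyc p e a k ∧ Below e w := by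
  obtain ⟨e, he⟩ := exists_cyc_of_pure hp hA hne h0 hdiv
  exact ⟨_, he.comp hw ha⟩

theorem IsReducedGroup.subgroup (hR : IsReducedGroup A) (H : AddSubgroup A) : IsReducedGroup H := by
  intro D hD
  have := hR (D.map H.subtype) (by
    rintro n hn _ ⟨x, hx, rfl⟩
    obtain ⟨y, hy, hxy⟩ := hD n hn x hx
    exact ⟨y, ⟨y, hy, rfl⟩, by rw [← hxy]; simp⟩)
  exact (AddSubgroup.map_eq_bot_iff_of_injective D H.subtype_injective).mp this

theorem exists_cyc_of_pow_ne (hp : p.Prime) (hA : IsAbelianPGroup p A) (hR : IsReducedGroup A)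
    (hw : Idem w) {n : ℕ} (hn : ∃ x, p ^ n • w x ≠ 0) :
    ∃ (k : ℕ) (e : A →+ A) (a : A), n ≤ k ∧ Cyc p e a k ∧ Below e w := by
  obtain ⟨x, hx⟩ := hn
  have hH := hA.subgroup w.range
  obtain ⟨k, y, hnk, hne, h0, hdiv⟩ := exists_pure_generator hH
    ((hR.subgroup w.range).exists_not_divisible hp hH (n := n) ⟨⟨w x, x, rfl⟩, fun h => hx (by
      simpa using congrArg Subtype.val h)⟩)
  obtain ⟨e, he, hew⟩ := exists_cyc_below hp hA hw (hw.mem_range.mp y.2) (k := k)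
    (fun h => hne (Subtype.ext (by simpa using h))) (by simpa using congrArg Subtype.val h0) (by
      intro z hz
      apply hdiv ⟨w z, z, rfl⟩
      apply Subtype.ext
      have := congrArg w hz
      rw [map_nsmul, map_nsmul, hw.mem_range.mp y.2] at this
      simpa using this)
  exact ⟨k, e, y, hnk, he, hew⟩

theorem exists_cyc_of_ne_zero (hp : p.Prime) (hA : IsAbelianPGroup p A) (hR : IsReducedGroup A)
    (hw : Idem w) (hn : ∃ x, w x ≠ 0) : ∃ (k : ℕ) (e : A →+ A) (a : A), Cyc p e a k ∧ Below e w := by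
  obtain ⟨k, e, a, -, h⟩ := exists_cyc_of_pow_ne hp hA hR hw (n := 0) (by simpa using hn)
  exact ⟨k, e, a, h⟩

/-- Take the least `k + 1` for which `p ^ (k + 1)` does not divide the offending element, and write
the latter as `p ^ k • b`. Then `w b` generates a pure cyclic subgroup, hence a summand. -/
theorem exists_cyc_of_not_socleDiv (hp : p.Prime) (hA : IsAbelianPGroup p A) (hw : Idem w) {m : ℕ}
    (hm : ¬ SocleDiv p w m) : ∃ (k : ℕ) (e : A →+ A) (a : A), k < m ∧ Cyc p e a k ∧ Below e w := by
  classical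
  unfold SocleDiv at hm
  push Not at hm
  obtain ⟨x, hwx, hpx, hx⟩ := hm
  have hex : ∃ n, ∀ b, p ^ n • b ≠ x := ⟨m, hx⟩
  have hle : Nat.find hex ≤ m := Nat.find_le hx
  have h0 : Nat.find hex ≠ 0 := fun h => by
    have := Nat.find_spec hex
    rw [h] at this
    exact this x (by simp)
  obtain ⟨k, hk⟩ := Nat.exists_eq_succ_of_ne_zero h0
  have hlt := Nat.find_min hex (m := k) (by omega)
  push Not at hlt
  obtain ⟨b, hb⟩ := hlt
  have hspec := Nat.find_spec hex
  rw [hk] at hspec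
  have hwb : p ^ k • w b = x := by rw [← map_nsmul, hb, hwx]
  obtain ⟨e, he, hew⟩ := exists_cyc_below hp hA hw (hw b) (k := k)
    (by rw [hwb]; rintro rfl; exact hx 0 (smul_zero _))
    (by rw [pow_succ', mul_smul, hwb, hpx]) (by rw [hwb]; exact hspec)
  exact ⟨k, e, w b, by omega, he, hew⟩

theorem Cyc.le_of_socleDiv (h : Cyc p e a k)
    (hew : Below e w) {m : ℕ} (hm : SocleDiv p w m) : m ≤ k := by
  by_contra hlt
  obtain ⟨l, rfl⟩ := Nat.exists_eq_add_of_lt (not_le.mp hlt)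
  obtain ⟨b, hb⟩ := hm (p ^ k • a) (by rw [map_nsmul, ← h.gen, hew.1]) (by
    rw [← mul_smul, ← pow_succ', h.zero])
  obtain ⟨c, hc⟩ := h.span b
  apply h.ne
  have := congrArg e hb
  rw [map_nsmul, map_nsmul, h.gen, hc] at this
  rw [← this, smul_comm]
  rw [pow_smul_eq_zero_of_le (by omega) h.zero, smul_zero]

theorem Cyc.lt_of_bounded (h : Cyc p e a k) (hew : Below e w) {m : ℕ}
    (hm : ∀ x, p ^ m • w x = 0) : k < m := by
  by_contra hle
  apply h.ne
  apply pow_smul_eq_zero_of_le (not_lt.mp hle)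
  rw [← h.gen, ← hew.1, hm]

theorem Cyc.socleDiv (hp : p.Prime) (hA : IsAbelianPGroup p A) (h : Cyc p e a k) : SocleDiv p e k := by
  intro x hx hpx
  obtain ⟨c, hc⟩ := h.span x
  rw [hx] at hc
  rw [hc, ← natCast_zsmul, ← mul_smul] at hpx
  obtain ⟨t, ht⟩ := pow_dvd_of_smul_eq_zero hp hA h.ne hpx
  refine ⟨t • a, ?_⟩
  have hcc : c = (p : ℤ) ^ k * t := by
    have hp0 : (p : ℤ) ≠ 0 := by exact_mod_cast hp.pos.ne'
    apply mul_left_cancel₀ hp0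
    rw [ht]; ring
  rw [hc, hcc, mul_smul, ← natCast_zsmul, Nat.cast_pow]

/-- A cyclic summand of least order does it: a failure of divisibility would produce a smaller one.
-/
theorem exists_cyc_socleDiv (hp : p.Prime) (hA : IsAbelianPGroup p A) (hR : IsReducedGroup A)
    (hw : Idem w) (hn : ∃ x, w x ≠ 0) :
    ∃ (k : ℕ) (e : A →+ A) (a : A), Cyc p e a k ∧ Below e w ∧ SocleDiv p w k := by
  classical
  have hex : ∃ k, ∃ (e : A →+ A) (a : A), Cyc p e a k ∧ Below e w :=
    exists_cyc_of_ne_zero hp hA hR hw hn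
  obtain ⟨e, a, he, hew⟩ := Nat.find_spec hex
  refine ⟨_, e, a, he, hew, ?_⟩
  by_contra hcon
  obtain ⟨k, c, b, hk, hc, hcw⟩ := exists_cyc_of_not_socleDiv hp hA hw hcon
  exact Nat.find_min hex hk ⟨c, b, hc, hcw⟩

/-- Every `p`-group is the direct sum of a subgroup annihilated by `p ^ n` and of one whose elements of
order `p` are divisible by `p ^ n`. -/
theorem exists_bounded_projection (hp : p.Prime) (hA : IsAbelianPGroup p A) (n : ℕ) :
    ∃ e : A →+ A, Idem e ∧ (∀ x, p ^ n • e x = 0) ∧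
      ∀ x, e x = 0 → p • x = 0 → ∃ z, p ^ n • z = x := by
  classical
  obtain ⟨s, hs⟩ := exists_isPBase hp hA
  -- The projection fixes the basis elements killed by `p ^ n` and annihilates the others.
  obtain ⟨h, hh⟩ := hs.exists_hom (D := (nsmulAddMonoidHom (p ^ n) : A →+ A).ker) (k := n)
    (by rintro ⟨x, hx⟩; exact Subtype.ext (by simpa using hx))
    (fun b => if hb : p ^ n • b = 0 then ⟨b, hb⟩ else 0)
    (by
      intro b _ c hc
      split_ifs with hb
      · exact Subtype.ext (by simpa using hc)
      · simp)
  have hzero : ∀ x, p ^ n • ((h x : (nsmulAddMonoidHom (p ^ n) : A →+ A).ker) : A) = 0 :=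
    fun x => (h x).2
  have hcomb : ∀ c ∈ Finsupp.supported ℤ ℤ s, ((h (comb c) : (nsmulAddMonoidHom (p ^ n) : A →+ A).ker) : A) =
      comb (c.filter fun b => p ^ n • b = 0) := by
    intro c hc
    simp only [comb, Finsupp.linearCombination_apply, Finsupp.sum, Finsupp.support_filter, map_sum, id]
    rw [Finset.sum_filter, AddSubgroup.val_finsetSum]
    refine Finset.sum_congr rfl fun b hb => ?_
    rw [map_zsmul, hh b ((Finsupp.mem_supported _ _).mp hc hb)]
    split_ifs with h1
    · simp [h1]
    · simp
  have hval : ∀ c ∈ Finsupp.supported ℤ ℤ s, ∀ z,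
      ((h (comb c + p ^ n • z) : (nsmulAddMonoidHom (p ^ n) : A →+ A).ker) : A) =
        comb (c.filter fun b => p ^ n • b = 0) := by
    intro c hc z
    have h1 : h (p ^ n • z) = 0 := by rw [map_nsmul]; exact Subtype.ext (hzero z)
    rw [map_add, h1, add_zero, hcomb c hc]
  refine ⟨(AddSubgroup.subtype _).comp h, fun x => ?_, hzero, fun x hx hpx => ?_⟩
  · obtain ⟨c, hc, z, rfl⟩ := hs.covers_pow n x
    have hc' : c.filter (fun b => p ^ n • b = 0) ∈ Finsupp.supported ℤ ℤ s := by
      rw [Finsupp.mem_supported] at hc ⊢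
      exact (Finset.coe_subset.mpr (by rw [Finsupp.support_filter]; exact Finset.filter_subset _ _)).trans hc
    simp only [AddMonoidHom.comp_apply, AddSubgroup.subtype_apply]
    have hff : (c.filter fun b => p ^ n • b = 0).filter (fun b => p ^ n • b = 0) =
        c.filter fun b => p ^ n • b = 0 := by
      ext b
      by_cases hb : p ^ n • b = 0 <;> simp [hb]
    rw [hval c hc, hcomb _ hc', hff]
  · obtain ⟨c, hc, z, rfl⟩ := hs.covers_pow n x
    simp only [AddMonoidHom.comp_apply, AddSubgroup.subtype_apply] at hx
    rw [hval c hc] at hx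
    have hc2 : c.filter (fun b => ¬ p ^ n • b = 0) ∈ Finsupp.supported ℤ ℤ s := by
      rw [Finsupp.mem_supported] at hc ⊢
      exact (Finset.coe_subset.mpr (by rw [Finsupp.support_filter]; exact Finset.filter_subset _ _)).trans hc
    have hsplit : comb c = comb (c.filter fun b => ¬ p ^ n • b = 0) := by
      conv_lhs => rw [← Finsupp.filter_add_filter_not c (fun b => p ^ n • b = 0)]
      rw [comb, map_add, ← comb, hx, zero_add]
    have hpc : (p : ℤ) • c.filter (fun b => ¬ p ^ n • b = 0) ∈ Finsupp.supported ℤ ℤ s :=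
      Submodule.smul_mem _ _ hc2
    -- Only basis elements not killed by `p ^ n` remain in `comb c`. As `p • comb c` is divisible by
    -- `p ^ (n + 1)`, so is each term `p c_b b`; since `b` has order at least `p ^ (n + 1)`, one
    -- factor `p` cancels and `p ^ n` divides `c_b`.
    have hdiv := hs.pureIndep _ hpc (n + 1) (-z) (by
      rw [comb, map_smul, ← comb, ← hsplit, natCast_zsmul, smul_neg, neg_eq_iff_add_eq_zero, ← hpx,
        smul_add, ← mul_smul, ← pow_succ', add_comm])
    obtain ⟨d, hd, hcd⟩ := exists_comb_eq_pow_smul (p := p) (n := n) hc2 (by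
      intro b
      by_cases hb : p ^ n • b = 0
      · exact ⟨0, by simp [hb]⟩
      obtain ⟨t, ht⟩ := hdiv b
      rw [← sub_eq_zero, ← sub_smul] at ht
      obtain ⟨r, hr⟩ := pow_dvd_of_smul_eq_zero hp hA hb ht
      refine ⟨t + r, ?_⟩
      congr 1
      have hp0 : (p : ℤ) ≠ 0 := by exact_mod_cast hp.pos.ne'
      apply mul_left_cancel₀ hp0
      rw [Finsupp.smul_apply, smul_eq_mul] at hr
      linear_combination hr)
    exact ⟨comb d + z, by rw [smul_add, hsplit, hcd]⟩

/-- The relative version of `exists_bounded_projection`. -/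
theorem exists_bounded_decomposition (hp : p.Prime) (hA : IsAbelianPGroup p A) (hw : Idem w) (n : ℕ) :
    ∃ δ : A →+ A, Idem δ ∧ Below δ w ∧ (∀ x, p ^ n • δ x = 0) ∧ SocleDiv p (w - δ) n := by
  obtain ⟨e, he, hen, hes⟩ := exists_bounded_projection hp (hA.subgroup w.range) n
  have hwr : ∀ x : w.range, w.rangeRestrict (x : A) = x := fun x =>
    Subtype.ext (hw.mem_range.mp x.2)
  refine ⟨(AddSubgroup.subtype _).comp (e.comp w.rangeRestrict), fun x => ?_, ⟨fun x => ?_, fun x => ?_⟩,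
    fun x => ?_, fun x hx hpx => ?_⟩
  · simp [hwr, he (w.rangeRestrict x)]
  · exact hw.mem_range.mp (e (w.rangeRestrict x)).2
  · have : w.rangeRestrict (w x) = w.rangeRestrict x := Subtype.ext (hw x)
    simp [this]
  · simpa using congrArg Subtype.val (hen (w.rangeRestrict x))
  · simp only [AddMonoidHom.sub_apply, AddMonoidHom.comp_apply, AddSubgroup.subtype_apply] at hx
    have hwx : w x = x := by
      have h1 := congrArg w hx
      rw [map_sub, hw, hw.mem_range.mp (e (w.rangeRestrict x)).2, hx] at h1
      exact h1.symm
    rw [hwx, sub_eq_self] at hx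
    obtain ⟨z, hz⟩ := hes (w.rangeRestrict x) (Subtype.ext hx) (Subtype.ext (by simp [hwx, hpx]))
    exact ⟨z, by simpa [hwx] using congrArg Subtype.val hz⟩

/-- A homomorphism from a cyclic direct summand, extended by zero. -/
theorem Cyc.exists_hom (hp : p.Prime) (hA : IsAbelianPGroup p A) (h : Cyc p e a k) {y : A}
    (hy : p ^ (k + 1) • y = 0) :
    ∃ f : A →+ A, f a = y ∧ (∀ x, f (e x) = f x) ∧ ∀ x, ∃ c : ℤ, f x = c • y := by
  let L : ℤ →+ (AddSubgroup.zmultiples a) := (zmultiplesHom A a).codRestrict _ (fun c => ⟨c, rfl⟩)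
  have hL : Function.Surjective L := by
    rintro ⟨_, c, rfl⟩
    exact ⟨c, rfl⟩
  have hker : L.ker ≤ (zmultiplesHom A y).ker := by
    intro c hc
    have hc' : c • a = 0 := congrArg Subtype.val (show L c = 0 from hc)
    obtain ⟨t, rfl⟩ := pow_dvd_of_smul_eq_zero hp hA h.ne hc'
    change ((p : ℤ) ^ (k + 1) * t) • y = 0
    rw [mul_comm, mul_smul, show ((p : ℤ) ^ (k + 1)) • y = p ^ (k + 1) • y by
      rw [← natCast_zsmul, Nat.cast_pow], hy, smul_zero]
  let g : AddSubgroup.zmultiples a →+ A := L.liftOfSurjective hL ⟨zmultiplesHom A y, hker⟩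
  have hg : ∀ c : ℤ, g (L c) = c • y := fun c =>
    AddMonoidHom.liftOfRightInverse_comp_apply L _ (Function.rightInverse_surjInv hL)
      ⟨zmultiplesHom A y, hker⟩ c
  let e' : A →+ AddSubgroup.zmultiples a := e.codRestrict _ (fun x => by
    obtain ⟨c, hc⟩ := h.span x; exact ⟨c, hc.symm⟩)
  have he' : ∀ x (c : ℤ), e x = c • a → e' x = L c := fun x c hc => Subtype.ext hc
  refine ⟨g.comp e', ?_, fun x => ?_, fun x => ?_⟩
  · rw [AddMonoidHom.comp_apply, he' a 1 (by rw [h.gen, one_smul]), hg, one_smul]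
  · have : e' (e x) = e' x := Subtype.ext (h.idem x)
    rw [AddMonoidHom.comp_apply, AddMonoidHom.comp_apply, this]
  · obtain ⟨c, hc⟩ := h.span x
    exact ⟨c, by rw [AddMonoidHom.comp_apply, he' x c hc, hg]⟩

/-- A projection that commutes with a projection onto a cyclic group acts on it as `1` or as `0`. -/
theorem Cyc.dichotomy (hp : p.Prime) (hA : IsAbelianPGroup p A) (h : Cyc p e a k) {x : A →+ A}
    (hx : Idem x) (hc : ∀ b, x (e b) = e (x b)) : Below e x ∨ ((∀ b, x (e b) = 0) ∧ ∀ b, e (x b) = 0) := by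
  obtain ⟨c, hca⟩ := h.span (x a)
  rw [← hc, h.gen] at hca
  -- The projection acts on the generator as an idempotent `c` modulo `p ^ (k + 1)`. As `p` cannot
  -- divide both `c` and `c - 1`, one of them absorbs the whole power.
  have h1 : (c * (c - 1)) • a = 0 := by
    have := hx a
    rw [hca, map_zsmul, hca, ← mul_smul] at this
    rw [mul_sub, sub_smul, this, mul_one, sub_self]
  have hd := pow_dvd_of_smul_eq_zero hp hA h.ne h1
  have hz : ∀ t : ℤ, (p : ℤ) ^ (k + 1) ∣ t → t • a = 0 := by
    rintro _ ⟨r, rfl⟩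
    rw [mul_comm, mul_smul, show ((p : ℤ) ^ (k + 1)) • a = p ^ (k + 1) • a by
      rw [← natCast_zsmul, Nat.cast_pow], h.zero, smul_zero]
  have hpi := Nat.prime_iff_prime_int.mp hp
  by_cases hpc : (p : ℤ) ∣ c
  · right
    have hcop : ¬ (p : ℤ) ∣ c - 1 := fun h' => hpi.not_isUnit
      (isUnit_of_dvd_one (by simpa using dvd_sub hpc h'))
    have h2 : x a = 0 := by
      rw [hca]
      exact hz c (hpi.pow_dvd_of_dvd_mul_right _ hcop hd)
    have h3 : ∀ b, x (e b) = 0 := fun b => by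
      obtain ⟨t, ht⟩ := h.span b
      rw [ht, map_zsmul, h2, smul_zero]
    exact ⟨h3, fun b => by rw [← hc, h3]⟩
  · left
    have h2 : x a = a := by
      have := hz (c - 1) (hpi.pow_dvd_of_dvd_mul_left _ hpc hd)
      rw [sub_smul, one_smul, sub_eq_zero] at this
      rw [hca, this]
    have h3 : ∀ b, x (e b) = e b := fun b => by
      obtain ⟨t, ht⟩ := h.span b
      rw [ht, map_zsmul, h2]
    exact ⟨h3, fun b => by rw [← hc, h3]⟩

/-- There are nonzero homomorphisms between nonzero direct summands. -/
theorem exists_hom_ne_zero (hp : p.Prime) (hA : IsAbelianPGroup p A) (hR : IsReducedGroup A)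
    {e e' : A →+ A} (he : Idem e) (hn : ∃ x, e x ≠ 0) (he' : Idem e') (hn' : ∃ x, e' x ≠ 0) :
    ∃ f : A →+ A, (∀ x, e' (f x) = f x) ∧ (∀ x, f (e x) = f x) ∧ ∃ x, f x ≠ 0 := by
  obtain ⟨k, c, a, hc, hce⟩ := exists_cyc_of_ne_zero hp hA hR he hn
  obtain ⟨x, hx⟩ := hn'
  obtain ⟨l, hl, hl'⟩ := hA.exists_order hx
  obtain ⟨f, hfa, hfc, hfs⟩ := hc.exists_hom hp hA (y := p ^ l • e' x) (by
    rw [pow_succ, mul_smul, ← mul_smul p, ← pow_succ', hl', smul_zero])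
  refine ⟨f, fun z => ?_, fun z => ?_, a, by rwa [hfa]⟩
  · obtain ⟨t, ht⟩ := hfs z
    rw [ht, map_zsmul, map_nsmul, he']
  · rw [← hfc, hce.2, hfc]

end Projections

/-! ### Involutions and projections -/

section Involutions

variable {p : ℕ} {A : Type u} [AddCommGroup A]

theorem Setting.eq_zero_of_two (S : Setting p A) {x : A} (h : 2 • x = 0) : x = 0 := by
  refine S.pGroup.eq_zero_of_smul S.prime (u := 2) (fun hd => ?_) (by rw [← h, ← natCast_zsmul]; rfl)
  have : p ∣ 2 := by exact_mod_cast hd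
  exact S.odd ((Nat.prime_dvd_prime_iff_eq S.prime Nat.prime_two).mp this)

theorem Setting.two_injective (S : Setting p A) {x y : A} (h : 2 • x = 2 • y) : x = y := by
  rw [← sub_eq_zero]
  exact S.eq_zero_of_two (by rw [smul_sub, h, sub_self])

/-- The involution `ξ` is `1 - 2 e` or `2 e - 1` for the projection `e`. -/
def Rep (ξ : A ≃+ A) (e : A →+ A) : Prop :=
  Idem e ∧ ((∀ a, ξ a = a - 2 • e a) ∨ ∀ a, ξ a = 2 • e a - a)

variable {ξ : A ≃+ A} {e w : A →+ A} {a : A} {k : ℕ}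

theorem Rep.invol (h : Rep ξ e) (a : A) : ξ (ξ a) = a := by
  obtain ⟨he, h | h⟩ := h
  · rw [h, h, map_sub, map_nsmul, he]; abel
  · rw [h, h, map_sub, map_nsmul, he]; abel

theorem Rep.compl (h : Rep ξ e) : Rep ξ (AddMonoidHom.id A - e) := by
  refine ⟨h.1.compl, ?_⟩
  obtain ⟨he, h | h⟩ := h
  · right; intro a; rw [h]; simp [smul_sub]; abel
  · left; intro a; rw [h]; simp [smul_sub]; abel

/-- This makes `(1 - ξ) / 2`, the projection onto the minus part of an involution, an endomorphism.
-/
theorem Setting.exists_half (S : Setting p A) : ∃ f : A →+ A, ∀ a, 2 • f a = a := by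
  have hinj : Function.Injective (nsmulAddMonoidHom 2 : A →+ A) := fun x y h => S.two_injective h
  have hsurj : Function.Surjective (nsmulAddMonoidHom 2 : A →+ A) := by
    intro a
    obtain ⟨v, hv⟩ := S.pGroup.inverse S.prime (u := 2) (fun hd => by
      have : p ∣ 2 := by exact_mod_cast hd
      exact S.odd ((Nat.prime_dvd_prime_iff_eq S.prime Nat.prime_two).mp this)) a
    refine ⟨v • a, ?_⟩
    rw [nsmulAddMonoidHom_apply, ← natCast_zsmul, ← mul_smul, mul_comm]
    exact hv
  let E := AddEquiv.ofBijective _ ⟨hinj, hsurj⟩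
  exact ⟨E.symm.toAddMonoidHom, fun a => E.apply_symm_apply a⟩

theorem Setting.exists_rep (S : Setting p A) (h : ∀ a, ξ (ξ a) = a) :
    ∃ e : A →+ A, Idem e ∧ ∀ a, ξ a = a - 2 • e a := by
  obtain ⟨f, hf⟩ := S.exists_half
  have h2 : ∀ a, 2 • f (a - ξ a) = a - ξ a := fun a => hf _
  refine ⟨f.comp (AddMonoidHom.id A - ξ.toAddMonoidHom), fun a => ?_, fun a => ?_⟩
  · simp only [AddMonoidHom.comp_apply, AddMonoidHom.sub_apply, AddMonoidHom.id_apply,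
      AddEquiv.coe_toAddMonoidHom]
    apply S.two_injective
    rw [h2]
    apply S.two_injective
    rw [smul_sub, ← map_nsmul ξ, h2, map_sub, h]
    abel
  · simp only [AddMonoidHom.comp_apply, AddMonoidHom.sub_apply, AddMonoidHom.id_apply,
      AddEquiv.coe_toAddMonoidHom]
    rw [h2]; abel

theorem Rep.commutes_iff (S : Setting p A) (h : Rep ξ e) {g : A ≃+ A} :
    Commutes g ξ ↔ ∀ a, g (e a) = e (g a) := by
  obtain ⟨he, h | h⟩ := h
  · constructor
    · intro hc a
      have := hc a
      rw [h, h, map_sub, map_nsmul, sub_right_inj] at this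
      exact S.two_injective this
    · intro hc a
      rw [h, h, map_sub, map_nsmul, hc]
  · constructor
    · intro hc a
      have := hc a
      rw [h, h, map_sub, map_nsmul, sub_left_inj] at this
      exact S.two_injective this
    · intro hc a
      rw [h, h, map_sub, map_nsmul, hc]

theorem Commutes.symm {f g : A ≃+ A} (h : Commutes f g) : Commutes g f := fun a => (h a).symm

theorem Rep.commutes_iff_comm (S : Setting p A) {η : A ≃+ A} {f : A →+ A} (h : Rep ξ e)
    (h' : Rep η f) : Commutes ξ η ↔ ∀ a, e (f a) = f (e a) := by
  rw [h'.commutes_iff S]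
  obtain ⟨he, h | h⟩ := h
  · constructor
    · intro hc a
      have := hc a
      rw [h, h, map_sub, map_nsmul, sub_right_inj] at this
      exact S.two_injective this
    · intro hc a
      rw [h, h, map_sub, map_nsmul, hc]
  · constructor
    · intro hc a
      have := hc a
      rw [h, h, map_sub, map_nsmul, sub_left_inj] at this
      exact S.two_injective this
    · intro hc a
      rw [h, h, map_sub, map_nsmul, hc]

/-- The involution `1 - 2 e` of a projection `e`. -/
def mkInv (e : A →+ A) (he : Idem e) : A ≃+ A where
  toFun a := a - 2 • e a
  invFun a := a - 2 • e a
  left_inv a := by simp only [map_sub, map_nsmul, he a]; abel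
  right_inv a := by simp only [map_sub, map_nsmul, he a]; abel
  map_add' a b := by simp only [map_add, smul_add]; abel

theorem mkInv_apply (he : Idem e) (a : A) : mkInv e he a = a - 2 • e a := rfl

theorem rep_mkInv (he : Idem e) : Rep (mkInv e he) e := ⟨he, Or.inl fun _ => rfl⟩

/-- The automorphism `1 + h` for an endomorphism with `h ^ 2 = 0`. -/
def unipotent (h : A →+ A) (hh : ∀ a, h (h a) = 0) : A ≃+ A where
  toFun a := a + h a
  invFun a := a - h a
  left_inv a := by simp [hh a]
  right_inv a := by simp [hh a]
  map_add' a b := by simp only [map_add]; abel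

theorem unipotent_apply (h : A →+ A) (hh : ∀ a, h (h a) = 0) (a : A) :
    unipotent h hh a = a + h a := rfl

theorem unipotent_symm_apply (h : A →+ A) (hh : ∀ a, h (h a) = 0) (a : A) :
    (unipotent h hh).symm a = a - h a := rfl

/-- The conjugate `f e f⁻¹`. -/
def conjHom (f : A ≃+ A) (e : A →+ A) : A →+ A :=
  f.toAddMonoidHom.comp (e.comp f.symm.toAddMonoidHom)

@[simp] theorem conjHom_apply (f : A ≃+ A) (e : A →+ A) (x : A) :
    conjHom f e x = f (e (f.symm x)) := rfl

theorem conj_apply (f ε : A ≃+ A) (x : A) : conj f ε x = f (ε (f.symm x)) := rfl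

theorem Rep.conj (h : Rep ξ e) (f : A ≃+ A) : Rep (AutFinal.conj f ξ) (conjHom f e) := by
  obtain ⟨he, h⟩ := h
  refine ⟨fun a => by simp [he (f.symm a)], ?_⟩
  rcases h with h | h
  · left; intro a; rw [conj_apply, h]; simp
  · right; intro a; rw [conj_apply, h]; simp

theorem Cyc.conj (h : Cyc p e a k) (f : A ≃+ A) : Cyc p (conjHom f e) (f a) k where
  gen := by simp [h.gen]
  ne := by rw [← map_nsmul]; exact fun h0 => h.ne ((map_eq_zero_iff f f.injective).mp h0)
  zero := by rw [← map_nsmul, h.zero, map_zero]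
  span x := by
    obtain ⟨c, hc⟩ := h.span (f.symm x)
    exact ⟨c, by simp [hc]⟩

/-! ### Extreme involutions -/

/-- Every nonzero subgroup of a cyclic `p`-group contains its elements of order `p`, so two nonzero
subgroups always meet. -/
theorem Cyc.indecomposable (hp : p.Prime) (hA : IsAbelianPGroup p A) (h : Cyc p e a k) :
    Indecomposable e.range := by
  have key : ∀ X : AddSubgroup A, X ≤ AddSubgroup.zmultiples a → X ≠ ⊥ → p ^ k • a ∈ X := by
    intro X hX hne
    obtain ⟨⟨x, hx⟩, hxne⟩ := AddSubgroup.ne_bot_iff_exists_ne_zero.mp hne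
    have hx0 : x ≠ 0 := fun h0 => hxne (Subtype.ext h0)
    obtain ⟨c, hc⟩ := hX hx
    have hc : c • a = x := hc
    have hc0 : c ≠ 0 := by rintro rfl; exact hx0 (by rw [← hc, zero_smul])
    obtain ⟨i, u, rfl, hu⟩ := exists_pow_mul hp hc0
    have hik : i ≤ k := by
      by_contra hlt
      apply hx0
      rw [← hc, mul_comm, mul_smul, show ((p : ℤ) ^ i) • a = p ^ i • a by
        rw [← natCast_zsmul, Nat.cast_pow], pow_smul_eq_zero_of_le (by omega) h.zero, smul_zero]
    obtain ⟨l, rfl⟩ := Nat.exists_eq_add_of_le hik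
    obtain ⟨v, hv⟩ := hA.inverse hp hu (p ^ (i + l) • a)
    rw [← hv]
    have := X.zsmul_mem hx ((p : ℤ) ^ l * v)
    rw [← hc, ← mul_smul] at this
    convert this using 1
    rw [← natCast_zsmul, ← mul_smul]
    congr 1
    push_cast
    ring
  rw [h.range_eq]
  refine ⟨fun h0 => h.ne_zero ?_, fun X Y hXY hsup => ?_⟩
  · rwa [AddSubgroup.zmultiples_eq_bot] at h0
  · by_contra! hcon
    have h1 := key X (hsup ▸ le_sup_left) hcon.1
    have h2 := key Y (hsup ▸ le_sup_right) hcon.2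
    have : p ^ k • a ∈ X ⊓ Y := ⟨h1, h2⟩
    rw [hXY, AddSubgroup.mem_bot] at this
    exact h.ne this

/-- Reducedness provides a cyclic summand inside any nonzero summand; indecomposability leaves it no
complement. -/
theorem exists_cyc_of_indecomposable (hp : p.Prime) (hA : IsAbelianPGroup p A) (hR : IsReducedGroup A)
    (he : Idem e) (h : Indecomposable e.range) : ∃ (a : A) (k : ℕ), Cyc p e a k := by
  have hne : ∃ x, e x ≠ 0 := by
    by_contra! hcon
    apply h.1
    rw [eq_bot_iff]
    rintro _ ⟨x, rfl⟩
    exact hcon x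
  obtain ⟨k, c, a, hc, hce⟩ := exists_cyc_of_ne_zero hp hA hR he hne
  have hd := hce.sub_idem hc.idem he
  have hinf : c.range ⊓ (e - c).range = ⊥ := by
    rw [eq_bot_iff]
    rintro x ⟨h1, h2⟩
    have h1 := hc.idem.mem_range.mp h1
    have h2 := hd.mem_range.mp h2
    rw [AddMonoidHom.sub_apply, h1] at h2
    have h3 : e x = x := by rw [← h1, hce.1]
    rw [h3, sub_self] at h2
    exact h2.symm
  have hsup : c.range ⊔ (e - c).range = e.range := by
    apply le_antisymm
    · rw [sup_le_iff]
      constructor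
      · rintro _ ⟨x, rfl⟩; exact ⟨c x, hce.1 x⟩
      · rintro _ ⟨x, rfl⟩; exact ⟨(e - c) x, (hce.sub he).1 x⟩
    · rintro _ ⟨x, rfl⟩
      rw [AddSubgroup.mem_sup]
      exact ⟨c x, ⟨x, rfl⟩, (e - c) x, ⟨x, rfl⟩, by simp⟩
  rcases h.2 c.range (e - c).range hinf hsup with h0 | h0
  · exact absurd (by rw [← AddSubgroup.mem_bot, ← h0]; exact ⟨a, hc.gen⟩) hc.ne_zero
  · have hec : e = c := by
      ext x
      have : (e - c) x ∈ (e - c).range := ⟨x, rfl⟩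
      rw [h0, AddSubgroup.mem_bot, AddMonoidHom.sub_apply, sub_eq_zero] at this
      exact this
    exact ⟨a, k, hec ▸ hc⟩

theorem parts_of_sub (S : Setting p A) (he : Idem e) (h : ∀ a, ξ a = a - 2 • e a) :
    plusPart ξ = e.ker ∧ minusPart ξ = e.range := by
  constructor
  · ext x
    change ξ x = x ↔ e x = 0
    rw [h, sub_eq_self]
    exact ⟨S.eq_zero_of_two, fun h => by rw [h, smul_zero]⟩
  · ext x
    rw [he.mem_range]
    change ξ x = -x ↔ _
    rw [h, sub_eq_iff_eq_add]
    constructor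
    · intro h
      apply S.two_injective
      rw [two_nsmul x, eq_neg_add_iff_add_eq.mp h]
    · intro h; rw [h]; abel

theorem parts_of_sub' (S : Setting p A) (he : Idem e) (h : ∀ a, ξ a = 2 • e a - a) :
    plusPart ξ = e.range ∧ minusPart ξ = e.ker := by
  constructor
  · ext x
    rw [he.mem_range]
    change ξ x = x ↔ _
    rw [h, sub_eq_iff_eq_add]
    constructor
    · intro h
      apply S.two_injective
      rw [h]; abel
    · intro h; rw [h]; abel
  · ext x
    change ξ x = -x ↔ e x = 0
    rw [h, sub_eq_neg_self]
    exact ⟨S.eq_zero_of_two, fun h => by rw [h, smul_zero]⟩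

theorem Idem.range_compl (he : Idem e) : (AddMonoidHom.id A - e).range = e.ker := by
  ext x
  rw [he.compl.mem_range]
  change x - e x = x ↔ e x = 0
  exact sub_eq_self

/-- Not both summands of a projection can be cyclic. -/
theorem Setting.exists_pow_ne_of_bounded (S : Setting p A) {n : ℕ} (h : ∀ x, p ^ n • e x = 0)
    (m : ℕ) : ∃ x, p ^ m • (AddMonoidHom.id A - e) x ≠ 0 := by
  by_contra! hcon
  obtain ⟨a, ha⟩ := S.unbounded (p ^ (m + n)) (pow_pos S.prime.pos _).ne'
  apply ha
  have h1 := hcon a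
  rw [AddMonoidHom.sub_apply, AddMonoidHom.id_apply, smul_sub, sub_eq_zero] at h1
  rw [pow_add, mul_comm, mul_smul, h1, smul_comm, h, smul_zero]

theorem Setting.extreme_of_cyc (S : Setting p A) (h : Cyc p e a k) (hr : Rep ξ e) : Extreme ξ := by
  refine ⟨hr.invol, fun h1 => ?_, ?_⟩
  · obtain ⟨he, hr | hr⟩ := hr
    · apply h.ne_zero
      rw [← h.gen]
      apply S.eq_zero_of_two
      have := hr a
      rw [h1, AddEquiv.refl_apply, eq_comm, sub_eq_self] at this
      exact this
    · obtain ⟨x, hx⟩ := S.exists_pow_ne_of_bounded h.pow_smul 0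
      apply hx
      have := hr x
      rw [h1, AddEquiv.refl_apply, eq_sub_iff_add_eq, ← two_nsmul] at this
      have h2 := S.two_injective this
      rw [AddMonoidHom.sub_apply, AddMonoidHom.id_apply, ← h2, sub_self, smul_zero]
  · obtain ⟨he, hr | hr⟩ := hr
    · right
      rw [(parts_of_sub S he hr).2]
      exact h.indecomposable S.prime S.pGroup
    · left
      rw [(parts_of_sub' S he hr).1]
      exact h.indecomposable S.prime S.pGroup

theorem Setting.exists_cyc (S : Setting p A) (h : Extreme ξ) :
    ∃ (e : A →+ A) (a : A) (k : ℕ), Cyc p e a k ∧ Rep ξ e := by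
  obtain ⟨e, he, hr⟩ := S.exists_rep h.1
  have hp := parts_of_sub S he hr
  rcases h.2.2 with h | h
  · rw [hp.1, ← he.range_compl] at h
    obtain ⟨a, k, hc⟩ := exists_cyc_of_indecomposable S.prime S.pGroup S.reduced he.compl h
    exact ⟨_, a, k, hc, Rep.compl ⟨he, Or.inl hr⟩⟩
  · rw [hp.2] at h
    obtain ⟨a, k, hc⟩ := exists_cyc_of_indecomposable S.prime S.pGroup S.reduced he h
    exact ⟨_, a, k, hc, ⟨he, Or.inl hr⟩⟩

/-- The case distinction in `core` is harmless: the complement of a cyclic summand is unbounded,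
hence not cyclic, hence not indecomposable. -/
theorem Setting.core_perp_eq (S : Setting p A) (h : Cyc p e a k) (hr : Rep ξ e) :
    core ξ = e.range ∧ perp ξ = e.ker := by
  have hi := h.indecomposable S.prime S.pGroup
  obtain ⟨he, hr | hr⟩ := hr
  · have hp := parts_of_sub S he hr
    rw [core, perp, hp.1, hp.2, if_pos hi, if_pos hi]
    exact ⟨rfl, rfl⟩
  · have hp := parts_of_sub' S he hr
    have hn : ¬ Indecomposable e.ker := by
      intro hk
      rw [← he.range_compl] at hk
      obtain ⟨b, l, hc⟩ := exists_cyc_of_indecomposable S.prime S.pGroup S.reduced he.compl hk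
      obtain ⟨x, hx⟩ := S.exists_pow_ne_of_bounded h.pow_smul (l + 1)
      exact hx (hc.pow_smul x)
    rw [core, perp, hp.1, hp.2, if_neg hn, if_neg hn]
    exact ⟨rfl, rfl⟩

theorem Setting.ord_eq (S : Setting p A) (h : Cyc p e a k) (hr : Rep ξ e) :
    ord ξ = ((p ^ (k + 1) : ℕ) : Cardinal) := by
  rw [ord, (S.core_perp_eq h hr).1, h.mk_range S.prime]

theorem Below.range_le (h : Below e w) : e.range ≤ w.range := by
  rintro _ ⟨x, rfl⟩; exact ⟨e x, h.1 x⟩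

theorem Setting.pairPart_eq (S : Setting p A) {ε : A ≃+ A} (h : Cyc p e a k) (hr : Rep ε e)
    (hw : Rep ξ w) (hew : Below e w) : pairPart ξ ε = w.range ∧ pairCompl ξ ε = w.ker := by
  have hc := (S.core_perp_eq h hr).1
  obtain ⟨hwi, hw | hw⟩ := hw
  · have hp := parts_of_sub S hwi hw
    have : ¬ core ε ≤ plusPart ξ := by
      rw [hc, hp.1]
      intro hle
      have h0 : w a = 0 := hle ⟨a, h.gen⟩
      rw [← h.gen, hew.1, h.gen] at h0
      exact h.ne_zero h0
    rw [pairPart, pairCompl, if_neg this, if_neg this]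
    exact ⟨hp.2, hp.1⟩
  · have hp := parts_of_sub' S hwi hw
    have : core ε ≤ plusPart ξ := by rw [hc, hp.1]; exact hew.range_le
    rw [pairPart, pairCompl, if_pos this, if_pos this]
    exact ⟨hp.1, hp.2⟩

/-- A commuting projection acts on a cyclic summand as 1 or 0. In the second case the complementary
projection represents the same involution. -/
theorem Setting.exists_rep_above (S : Setting p A) {ε : A ≃+ A} (h : Cyc p e a k) (hr : Rep ε e)
    (hξ : ∀ a, ξ (ξ a) = a) (hc : Commutes ξ ε) : ∃ w : A →+ A, Rep ξ w ∧ Below e w := by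
  obtain ⟨w, hw, hξw⟩ := S.exists_rep hξ
  have hw' : Rep ξ w := ⟨hw, Or.inl hξw⟩
  have hcomm := (hw'.commutes_iff_comm S hr).mp hc
  rcases h.dichotomy S.prime S.pGroup hw hcomm with h1 | h1
  · exact ⟨w, hw', h1⟩
  · exact ⟨_, hw'.compl, ⟨fun x => by simp [h1.1], fun x => by simp [h1.2]⟩⟩

end Involutions

/-! ### Cardinalities of layers under direct decompositions, and the pivot condition -/

section Layers

variable {p : ℕ} {A : Type u} [AddCommGroup A]

/-- By induction on the order, every element killed by `p ^ n` is divisible by `p`. Hence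
multiplication by `p ^ n` is injective from the first layer to that of index `n`. -/
theorem layerCard_zero_eq {n : ℕ} (h : ∀ x : A, p • x = 0 → ∃ z, p ^ n • z = x) :
    layerCard p 0 A = layerCard p n A := by
  have key : ∀ j ≤ n, ∀ x : A, p ^ j • x = 0 → ∃ z, p • z = x := by
    intro j
    induction j with
    | zero => exact fun _ x hx => ⟨0, by simpa using hx.symm⟩
    | succ j ih =>
      intro hj x hx
      obtain ⟨z, hz⟩ := h (p ^ j • x) (by rw [← mul_smul, ← pow_succ', hx])
      obtain ⟨l, rfl⟩ := Nat.exists_eq_add_of_le hj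
      obtain ⟨y, hy⟩ := ih (by omega) (x - p • p ^ l • z) (by
        rw [smul_sub, ← hz, ← mul_smul, ← mul_smul, sub_eq_zero]
        congr 1; ring)
      exact ⟨y + p ^ l • z, by rw [smul_add, hy, sub_add_cancel]⟩
  have hle : layerKer p n A ≤ layerKer p 0 A := by
    intro x hx
    obtain ⟨z, hz⟩ := mem_layerKer.mp hx
    obtain ⟨y, hy⟩ := key n le_rfl (x - p • z) (by
      rw [smul_sub, ← hz, ← mul_smul, ← pow_succ, sub_self])
    exact mem_layerKer.mpr ⟨y + z, by simp [hy]⟩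
  rw [layerCard, layerCard, le_antisymm hle (layerKer_le (Nat.zero_le n))]

/-- A complement killed by `p ^ n` contributes nothing to `p ^ n A`. -/
theorem Idem.layerCard_eq {w : A →+ A} (hw : Idem w) {n : ℕ} (h : ∀ x, p ^ n • (x - w x) = 0) :
    layerCard p n w.range = layerCard p n A := by
  let φ : w.range →+ A ⧸ layerKer p n A := (QuotientAddGroup.mk' _).comp w.range.subtype
  have hφ : Function.Surjective φ := by
    intro x
    obtain ⟨x, rfl⟩ := QuotientAddGroup.mk_surjective x
    refine ⟨⟨w x, x, rfl⟩, ?_⟩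
    change ((w x : A) : A ⧸ layerKer p n A) = (x : A ⧸ layerKer p n A)
    rw [QuotientAddGroup.eq, mem_layerKer]
    exact ⟨0, by rw [neg_add_eq_sub, h, smul_zero]⟩
  have hker : layerKer p n w.range = φ.ker := by
    ext x
    have : x ∈ φ.ker ↔ (x : A) ∈ layerKer p n A := by
      change ((x : A) : A ⧸ layerKer p n A) = 0 ↔ _
      rw [QuotientAddGroup.eq_zero_iff]
    rw [this, mem_layerKer, mem_layerKer]
    constructor
    · rintro ⟨z, hz⟩
      exact ⟨z, by simpa using congrArg Subtype.val hz⟩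
    · rintro ⟨z, hz⟩
      refine ⟨⟨w z, z, rfl⟩, Subtype.ext ?_⟩
      have := congrArg w hz
      rw [map_nsmul, map_nsmul, hw.mem_range.mp x.2] at this
      simpa using this
  exact mk_congr ((QuotientAddGroup.quotientAddEquivOfEq hker).trans
    (QuotientAddGroup.quotientKerEquivOfSurjective φ hφ)).toEquiv

theorem SocleDiv.layerCard_eq {w : A →+ A} (hw : Idem w) {n : ℕ} (h : SocleDiv p w n) :
    layerCard p 0 w.range = layerCard p n w.range := by
  apply layerCard_zero_eq
  rintro ⟨x, hx⟩ hpx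
  have hx := hw.mem_range.mp hx
  obtain ⟨b, hb⟩ := h x hx (by simpa using congrArg Subtype.val hpx)
  exact ⟨⟨w b, b, rfl⟩, Subtype.ext (by simp [← map_nsmul, hb, hx])⟩

theorem exists_out_eq (n : ℕ) (x : A) :
    ∃ z, p ^ (n + 1) • z = p ^ n • ((x : A ⧸ layerKer p n A).out - x) := by
  have h := QuotientAddGroup.eq.mp (Quotient.out_eq (x : A ⧸ layerKer p n A))
  obtain ⟨z, hz⟩ := mem_layerKer.mp h
  refine ⟨-z, ?_⟩
  rw [smul_neg, hz, ← smul_neg]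
  congr 1
  abel

theorem Below.layerCard_le {δ w : A →+ A} (hδ : Idem δ) (h : Below δ w) :
    layerCard p 0 δ.range ≤ layerCard p 0 w.range := by
  apply mk_le_of_surjective (f := fun q : w.range ⧸ layerKer p 0 w.range =>
    (δ.rangeRestrict (q.out : w.range) : δ.range ⧸ layerKer p 0 δ.range))
  intro y
  obtain ⟨⟨y, hy⟩, rfl⟩ := QuotientAddGroup.mk_surjective y
  have hy' := hδ.mem_range.mp hy
  let x : w.range := ⟨y, y, by rw [← hy', h.1]⟩
  refine ⟨(x : w.range ⧸ layerKer p 0 w.range), ?_⟩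
  obtain ⟨z, hz⟩ := exists_out_eq (p := p) 0 x
  rw [QuotientAddGroup.eq, mem_layerKer]
  refine ⟨-δ.rangeRestrict z, Subtype.ext ?_⟩
  have := congrArg (fun t : w.range => δ (t : A)) hz
  simp only [zero_add, pow_one, pow_zero, one_smul, AddSubgroup.coe_nsmul, map_nsmul,
    AddSubgroup.coe_sub, map_sub] at this
  simp only [zero_add, pow_one, pow_zero, one_smul, smul_neg, AddSubgroup.coe_neg,
    AddSubgroup.coe_nsmul, AddMonoidHom.coe_rangeRestrict, AddSubgroup.coe_add, this, x, hy']
  abel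

theorem Below.layerCard_le_of_le {δ w : A →+ A} (hw : Idem w) (h : Below δ w)
    {κ : Cardinal.{u}} (hκ : ℵ₀ ≤ κ) (h1 : layerCard p 0 δ.range ≤ κ)
    (h2 : layerCard p 0 (w - δ).range ≤ κ) : layerCard p 0 w.range ≤ κ := by
  have hle1 : δ.range ≤ w.range := h.range_le
  have hle2 : (w - δ).range ≤ w.range := (h.sub hw).range_le
  have hsurj : Function.Surjective
      (fun q : (δ.range ⧸ layerKer p 0 δ.range) × ((w - δ).range ⧸ layerKer p 0 (w - δ).range) =>
        ((AddSubgroup.inclusion hle1 q.1.out + AddSubgroup.inclusion hle2 q.2.out : w.range) :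
          w.range ⧸ layerKer p 0 w.range)) := by
    intro y
    obtain ⟨y, rfl⟩ := QuotientAddGroup.mk_surjective y
    refine ⟨((δ.rangeRestrict (y : A)), ((w - δ).rangeRestrict (y : A))), ?_⟩
    obtain ⟨z1, hz1⟩ := exists_out_eq (p := p) 0 (δ.rangeRestrict (y : A))
    obtain ⟨z2, hz2⟩ := exists_out_eq (p := p) 0 ((w - δ).rangeRestrict (y : A))
    rw [QuotientAddGroup.eq, mem_layerKer]
    refine ⟨-(AddSubgroup.inclusion hle1 z1 + AddSubgroup.inclusion hle2 z2), Subtype.ext ?_⟩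
    have e1 := congrArg Subtype.val hz1
    have e2 := congrArg Subtype.val hz2
    have hwy : w (y : A) = y := hw.mem_range.mp y.2
    simp only [zero_add, pow_one, pow_zero, one_smul, AddSubgroup.coe_nsmul, AddSubgroup.coe_sub,
      AddMonoidHom.coe_rangeRestrict, AddMonoidHom.sub_apply, hwy] at e1 e2
    simp only [zero_add, pow_one, pow_zero, one_smul, smul_neg, smul_add, AddSubgroup.coe_neg,
      AddSubgroup.coe_nsmul, AddSubgroup.coe_add, AddSubgroup.coe_inclusion, e1, e2]
    abel
  refine (mk_le_of_surjective hsurj).trans ?_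
  rw [mk_prod, lift_id, lift_id]
  exact (mul_le_mul' h1 h2).trans (mul_eq_self hκ).le

/-- Extend by zero a projection of a direct summand onto a cyclic subgroup. -/
theorem Cyc.extend {w : A →+ A} (hw : Idem w) {e : w.range →+ w.range} {a : w.range} {k : ℕ}
    (h : Cyc p e a k) : ∃ e' : A →+ A, Cyc p e' (a : A) k ∧ Below e' w ∧
      ∀ x : w.range, e' (x : A) = e x := by
  have hwr : ∀ x : w.range, w.rangeRestrict (x : A) = x := fun x =>
    Subtype.ext (hw.mem_range.mp x.2)
  refine ⟨w.range.subtype.comp (e.comp w.rangeRestrict), ⟨?_, fun h0 => h.ne (Subtype.ext (by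
    simpa using h0)), by simpa using congrArg Subtype.val h.zero, fun x => ?_⟩,
    ⟨fun x => hw.mem_range.mp (e (w.rangeRestrict x)).2, fun x => ?_⟩, fun x => ?_⟩
  · simp [hwr, h.gen]
  · obtain ⟨c, hc⟩ := h.span (w.rangeRestrict x)
    exact ⟨c, by simpa using congrArg Subtype.val hc⟩
  · have : w.rangeRestrict (w x) = w.rangeRestrict x := Subtype.ext (hw x)
    simp [this]
  · simp [hwr]

/-- The range of a projection `w` is a summand `A_fin`, with complement annihilated by `p ^ m`. -/
structure IsFinalProj (p : ℕ) (w : A →+ A) (m : ℕ) : Prop where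
  idem : Idem w
  bounded : ∀ x, p ^ m • (x - w x) = 0
  socle : SocleDiv p w m
  min : ∀ n, layerCard p m A ≤ layerCard p n A

variable {w π : A →+ A} {m k : ℕ}

theorem Setting.exists_pow_ne (S : Setting p A) {n : ℕ} (h : ∀ x, p ^ n • (x - w x) = 0)
    (m : ℕ) : ∃ x, p ^ m • w x ≠ 0 := by
  obtain ⟨x, hx⟩ := S.exists_pow_ne_of_bounded (e := AddMonoidHom.id A - w) (n := n) (by simpa using h) m
  exact ⟨x, by simpa using hx⟩

/-- If the range of `w` is the direct sum of the range of `π` and of a bounded group `D`, there is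
a homomorphism to `D` taking every value at a generator of a cyclic direct summand. -/
theorem IsFinalProj.exists_hom (S : Setting p A) (hw : IsFinalProj p w m) (hπ : Idem π)
    (hπw : Below π w) (hk : ∀ x, p ^ k • (w - π) x = 0) :
    ∃ h : A →+ A, (∀ x, (w - π) (h x) = h x) ∧ (∀ x, h (π x) = h x) ∧
      ∀ d, (w - π) d = d → ∃ (x : A) (e : A →+ A) (j : ℕ), Cyc p e x j ∧ Below e π ∧ h x = d := by
  classical
  set δ := w - π with hδ
  have hδi : Idem δ := hπw.sub_idem hπ hw.idem
  have hδw : Below δ w := hπw.sub hw.idem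
  set K := max k m with hK
  have hkK : k ≤ K := le_max_left _ _
  have hmK : m ≤ K := le_max_right _ _
  have hKδ : ∀ x, p ^ K • δ x = 0 := fun x => pow_smul_eq_zero_of_le hkK (hk x)
  have hKπ : ∀ x, p ^ K • (x - π x) = 0 := by
    intro x
    rw [show x - π x = (x - w x) + δ x by simp [hδ], smul_add,
      pow_smul_eq_zero_of_le hmK (hw.bounded x), hKδ, add_zero]
  have hPA : layerCard p K π.range = layerCard p K A := hπ.layerCard_eq hKπ
  have hinf : ℵ₀ ≤ layerCard p K π.range := by
    rw [hPA]; exact aleph0_le_layerCard S.prime S.pGroup S.reduced S.unbounded K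
  have hP := S.pGroup.subgroup π.range
  obtain ⟨s, hs⟩ := exists_isPBase S.prime hP
  have hcard := hs.layerCard_eq S.prime hP hinf
  -- This is where minimality is used: the bounded group `D` is bounded in size by the first layer
  -- of `w`, which is the layer of `A` of index `m` and so at most that of index `K`, the number of
  -- basis elements of `π` not killed by `p ^ K`.
  have hD : #δ.range ≤ #(highPart p K s) := by
    rw [← hcard]
    refine mk_le_of_bounded S.prime (S.pGroup.subgroup δ.range) hinf ?_ (k := K) ?_
    · refine (hδw.layerCard_le hδi).trans ?_
      rw [hw.socle.layerCard_eq hw.idem, hw.idem.layerCard_eq hw.bounded, hPA]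
      exact hw.min K
    · rintro ⟨_, x, rfl⟩
      exact Subtype.ext (by simpa using hKδ x)
  obtain ⟨ι⟩ := hD
  have : Nonempty δ.range := ⟨0⟩
  set σ := Function.invFun ι with hσ
  have hσι : ∀ d, σ (ι d) = d := Function.leftInverse_invFun ι.injective
  -- The high basis elements are mapped onto all of `D`. Any values are allowed there, since the
  -- orders of these elements exceed the exponent `p ^ K`.
  obtain ⟨h, hh⟩ := hs.exists_hom (D := δ.range) (k := K)
    (by rintro ⟨_, x, rfl⟩; exact Subtype.ext (by simpa using hKδ x))
    (fun b => if hb : b ∈ highPart p K s then σ ⟨b, hb⟩ else 0)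
    (by
      intro b _ c hc
      split_ifs with hb
      · obtain ⟨t, rfl⟩ := pow_dvd_of_smul_eq_zero S.prime hP hb.2 hc
        obtain ⟨y, hy⟩ := (σ ⟨b, hb⟩).2
        apply Subtype.ext
        rw [AddSubgroup.coe_zsmul, ← hy, mul_comm, mul_smul, show ((p : ℤ) ^ (K + 1)) • δ y =
          p ^ (K + 1) • δ y by rw [← natCast_zsmul, Nat.cast_pow],
          pow_smul_eq_zero_of_le (Nat.le_succ K) (hKδ y), smul_zero]
        rfl
      · simp)
  have hπr : ∀ x : π.range, π.rangeRestrict (x : A) = x := fun x =>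
    Subtype.ext (hπ.mem_range.mp x.2)
  refine ⟨δ.range.subtype.comp (h.comp π.rangeRestrict), fun x => ?_, fun x => ?_, fun d hd => ?_⟩
  · exact hδi.mem_range.mp (h (π.rangeRestrict x)).2
  · have : π.rangeRestrict (π x) = π.rangeRestrict x := Subtype.ext (hπ x)
    simp [this]
  · have hb := (ι ⟨d, d, hd⟩).2
    set b : π.range := (ι ⟨d, d, hd⟩ : π.range) with hbdef
    obtain ⟨j, hj, hj'⟩ := hP.exists_order (x := b) (fun h0 => hb.2 (by rw [h0, smul_zero]))
    obtain ⟨e, he⟩ := hs.exists_cyc hb.1 hj hj'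
    obtain ⟨e', he', hew, -⟩ := he.extend hπ
    refine ⟨b, e', j, he', hew, ?_⟩
    have h1 : h b = ⟨d, d, hd⟩ := by rw [hh b hb.1, dif_pos hb]; exact hσι _
    simp [hπr, h1]

/-- If the layers of `A` are not minimal from `p ^ m` on, the range of `w` is the direct sum of the range
of a projection `π` with small layers and of a bounded group with a large basis. -/
theorem Setting.exists_small_summand (S : Setting p A) (hw : Idem w)
    (hb : ∀ x, p ^ m • (x - w x) = 0) (hs : SocleDiv p w m) {n : ℕ}
    (hn : layerCard p n A < layerCard p m A) :
    ∃ (π : A →+ A) (k : ℕ) (e : A →+ A) (a : A) (s : Set (w - π).range), Idem π ∧ Below π w ∧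
      (∀ x, p ^ k • (x - π x) = 0) ∧ SocleDiv p π k ∧ Cyc p e a k ∧ Below e π ∧ IsPBase p s ∧
      layerCard p k A < #s ∧ layerCard p 0 π.range = layerCard p k A := by
  have hmn : m ≤ n := by
    by_contra hlt
    exact absurd (layerCard_anti (p := p) (M := A) (not_le.mp hlt).le) (not_le.mpr hn)
  obtain ⟨δ, hδ, hδw, hδn, hsoc⟩ := exists_bounded_decomposition S.prime S.pGroup hw n
  have hπ : Idem (w - δ) := hδw.sub_idem hδ hw
  have hπn : ∀ x, p ^ n • (x - (w - δ) x) = 0 := by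
    intro x
    rw [show x - (w - δ) x = (x - w x) + δ x by simp; abel, smul_add,
      pow_smul_eq_zero_of_le hmn (hb x), hδn, add_zero]
  obtain ⟨x, hx⟩ := S.exists_pow_ne hπn 0
  obtain ⟨k, e, a, he, heπ, hsk⟩ := exists_cyc_socleDiv S.prime S.pGroup S.reduced hπ
    ⟨x, by simpa using hx⟩
  have hnk : n ≤ k := he.le_of_socleDiv heπ hsoc
  have hπk : ∀ x, p ^ k • (x - (w - δ) x) = 0 := fun x => pow_smul_eq_zero_of_le hnk (hπn x)
  have hP : layerCard p 0 (w - δ).range = layerCard p k A := by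
    rw [hsk.layerCard_eq hπ, hπ.layerCard_eq hπk]
  have hwδ : w - (w - δ) = δ := sub_sub_cancel w δ
  obtain ⟨s, hs'⟩ := exists_isPBase S.prime (S.pGroup.subgroup (w - (w - δ)).range)
  refine ⟨w - δ, k, e, a, s, hπ, hδw.sub hw, hπk, hsk, he, heπ, hs', ?_, hP⟩
  -- If the basis of `δ` were small as well, the first layer of `w`, which is the layer of `A` of
  -- index `m`, would not exceed the layer of index `k ≥ n`.
  by_contra hle
  have hinf := aleph0_le_layerCard S.prime S.pGroup S.reduced S.unbounded k
  have h1 := hs'.layerCard_le_of_mk_le 0 hinf (not_lt.mp hle)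
  rw [hwδ] at h1
  have h2 := hδw.layerCard_le_of_le hw hinf h1 hP.le
  rw [hs.layerCard_eq hw, hw.layerCard_eq hb] at h2
  exact absurd (h2.trans (layerCard_anti hnk)) (not_le.mpr hn)

/-- Such a map factors through the range of `π` modulo `p ^ k`, a quotient controlled by the first
layer. -/
theorem mk_range_le (S : Setting p A) {κ : Cardinal.{u}} (hκ : ℵ₀ ≤ κ)
    (h : layerCard p 0 π.range ≤ κ) {φ : A →+ A} (hφ : ∀ x, φ (π x) = φ x)
    (hk : ∀ x, p ^ k • φ x = 0) : #φ.range ≤ κ := by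
  refine le_trans ?_ (mk_quotient_pow_le S.prime (S.pGroup.subgroup π.range) hκ h k)
  apply mk_le_of_surjective
    (f := fun q : π.range ⧸ (nsmulAddMonoidHom (p ^ k) : π.range →+ π.range).range =>
      φ.rangeRestrict ((q.out : π.range) : A))
  rintro ⟨_, x, rfl⟩
  refine ⟨(π.rangeRestrict x : π.range), Subtype.ext ?_⟩
  obtain ⟨z, hz⟩ := QuotientAddGroup.eq.mp (Quotient.out_eq ((π.rangeRestrict x : π.range) :
    π.range ⧸ (nsmulAddMonoidHom (p ^ k) : π.range →+ π.range).range))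
  have := congrArg (fun t : π.range => φ (t : A)) hz
  simp only [nsmulAddMonoidHom_apply, AddSubgroup.coe_nsmul, map_nsmul, hk, AddSubgroup.coe_add,
    map_add, AddSubgroup.coe_neg, map_neg, AddMonoidHom.coe_rangeRestrict, hφ] at this
  rw [AddMonoidHom.coe_rangeRestrict]
  exact neg_add_eq_zero.mp this.symm

/-- At most `κ` cyclic groups generated by elements of a basis meet a set of `κ` elements
nontrivially. -/
theorem mk_meeting_le (hA : IsAbelianPGroup p A) {s : Set A} (hs : PureIndep p s)
    {κ : Cardinal.{u}} {T : Set A} (hT : #T ≤ κ) :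
    #{d ∈ s | ∃ c : ℤ, c • d ∈ T ∧ c • d ≠ 0} ≤ κ := by
  refine le_trans ?_ hT
  choose c hc hc0 using fun d : {d ∈ s | ∃ c : ℤ, c • d ∈ T ∧ c • d ≠ 0} => d.2.2
  apply mk_le_of_injective (f := fun d => (⟨c d • (d : A), hc d⟩ : T))
  intro d d' h
  have h : c d • (d : A) = c d' • (d' : A) := congrArg Subtype.val h
  by_contra hne
  have hne' : (d : A) ≠ d' := fun h => hne (Subtype.ext h)
  have := hs.independent hA (c := Finsupp.single (d : A) (c d) - Finsupp.single (d' : A) (c d'))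
    (sub_mem (Finsupp.single_mem_supported _ _ d.2.1) (Finsupp.single_mem_supported _ _ d'.2.1))
    (by simp only [comb, map_sub, Finsupp.linearCombination_single, id]; rw [h, sub_self]) d
  rw [Finsupp.sub_apply, Finsupp.single_eq_same, Finsupp.single_eq_of_ne hne', sub_zero] at this
  exact hc0 d this

end Layers

/-! ### The condition `Final` -/

section Final

variable {p : ℕ} {A : Type u} [AddCommGroup A] {ξ ε : A ≃+ A} {w e : A →+ A} {a : A} {m : ℕ}

/-- A commuting extreme involution lies on exactly one side of `ξ`. Testing `ByOrd` on a large
cyclic summand of the complement gives boundedness, and on a small one inside `w` gives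
divisibility; conversely the two properties bound the orders on each side. -/
theorem Setting.byOrd_iff (S : Setting p A) (h : Cyc p e a m) (hr : Rep ε e) (hw : Rep ξ w)
    (hew : Below e w) : ByOrd ξ ε ↔ (∀ x, p ^ m • (x - w x) = 0) ∧ SocleDiv p w m := by
  have hpp := (S.pairPart_eq h hr hw hew).1
  have hnot : ∀ {e' : A →+ A} {a' : A} {k : ℕ}, Cyc p e' a' k → (∀ b, w (e' b) = 0) →
      ¬ e'.range ≤ w.range := by
    intro e' a' k he' h0 hle
    apply he'.ne_zero
    have := hw.1.mem_range.mp (hle ⟨a', he'.gen⟩)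
    rw [← this, ← he'.gen, h0]
  constructor
  · intro hB
    constructor
    · by_contra! hcon
      obtain ⟨x, hx⟩ := hcon
      obtain ⟨k, e', a', hmk, he', hb⟩ := exists_cyc_of_pow_ne S.prime S.pGroup S.reduced hw.1.compl
        (n := m) ⟨x, by simpa using hx⟩
      have h1 : ∀ b, w (e' b) = 0 := fun b => by
        have := hb.1 b
        rwa [AddMonoidHom.sub_apply, AddMonoidHom.id_apply, sub_eq_self] at this
      have h2 : ∀ b, e' (w b) = 0 := fun b => by
        have := hb.2 b
        rwa [AddMonoidHom.sub_apply, AddMonoidHom.id_apply, map_sub, sub_eq_self] at this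
      have hr' := rep_mkInv he'.idem
      have := (hB (mkInv e' he'.idem) (S.extreme_of_cyc he' hr')
        ((hw.commutes_iff_comm S hr').mpr fun b => by rw [h1, h2])).mpr (by
          rw [S.ord_eq h hr, S.ord_eq he' hr', pow_card_le_iff S.prime]; exact hmk)
      rw [(S.core_perp_eq he' hr').1, hpp] at this
      exact hnot he' h1 this
    · by_contra hcon
      obtain ⟨k, e', a', hkm, he', hb⟩ := exists_cyc_of_not_socleDiv S.prime S.pGroup hw.1 hcon
      have hr' := rep_mkInv he'.idem
      have := (hB (mkInv e' he'.idem) (S.extreme_of_cyc he' hr')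
        ((hw.commutes_iff_comm S hr').mpr fun b => by rw [hb.1, hb.2])).mp (by
          rw [(S.core_perp_eq he' hr').1, hpp]; exact hb.range_le)
      rw [S.ord_eq h hr, S.ord_eq he' hr', pow_card_le_iff S.prime] at this
      omega
  · rintro ⟨hb, hs⟩ ε' hε' hc
    obtain ⟨e', a', k, he', hr'⟩ := S.exists_cyc hε'
    rw [S.ord_eq h hr, S.ord_eq he' hr', pow_card_le_iff S.prime, (S.core_perp_eq he' hr').1, hpp]
    have hcomm := (hw.commutes_iff_comm S hr').mp hc
    rcases he'.dichotomy S.prime S.pGroup hw.1 hcomm with h1 | h1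
    · exact ⟨fun _ => he'.le_of_socleDiv h1 hs, fun _ => h1.range_le⟩
    · refine ⟨fun h2 => absurd h2 (hnot he' h1.1), fun h2 => ?_⟩
      have hlt : k < m := he'.lt_of_bounded (w := AddMonoidHom.id A - w)
        ⟨fun b => by simp [h1.1], fun b => by simp [h1.2]⟩ (by simpa using hb)
      omega

theorem AddSubgroup.zmultiples_map {f : A ≃+ A} {x : A} :
    (AddSubgroup.zmultiples x).map f.toAddMonoidHom = AddSubgroup.zmultiples (f x) :=
  AddMonoidHom.map_zmultiples _ _

/-- The automorphism is `1 + φ v`, with `φ` from `IsFinalProj.exists_hom`. It is the identity on the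
kernel of `v`, and a target generator `d = φ x` is reached because `x` goes to `x + d`. -/
theorem IsFinalProj.final (S : Setting p A) (h : Cyc p e a m) (hr : Rep ε e) (hξ : Rep ξ w)
    (hew : Below e w) (hw : IsFinalProj p w m) : Final ξ ε := by
  refine ⟨(S.byOrd_iff h hr hξ hew).mpr ⟨hw.bounded, hw.socle⟩, fun ξ₁ ε₁ hP hlt hB => ?_⟩
  obtain ⟨e₁, a₁, k, he₁, hr₁⟩ := S.exists_cyc hP.2.1
  obtain ⟨v, hv, hev⟩ := S.exists_rep_above he₁ hr₁ hP.1 hP.2.2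
  have hpp₁ := S.pairPart_eq he₁ hr₁ hv hev
  have hpp := S.pairPart_eq h hr hξ hew
  rw [hpp₁.1, hpp.1] at hlt
  rw [hpp₁.1, hpp₁.2, hpp.1]
  have hvk := ((S.byOrd_iff he₁ hr₁ hv hev).mp hB).1
  have hwv : ∀ x, w (v x) = v x := fun x => hw.idem.mem_range.mp (hlt.le ⟨x, rfl⟩)
  have hπ : Idem (v.comp w) := fun x => by simp [hwv, hv.1 (w x)]
  have hπw : Below (v.comp w) w := ⟨fun x => by simp [hwv], fun x => by simp [hw.idem x]⟩
  obtain ⟨φ, hφδ, hφπ, hφ⟩ := hw.exists_hom S hπ hπw (k := k) (fun x => by simpa using hvk (w x))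
  have hvφ : ∀ x, v (φ x) = 0 := fun x => by
    rw [← hφδ x]
    simp [hv.1 (w (φ x))]
  have hsq : ∀ x, (φ.comp v) ((φ.comp v) x) = 0 := fun x => by simp [hvφ]
  set f := unipotent (φ.comp v) hsq with hf
  refine ⟨f, fun ε' hε' hle => ?_, fun ε' hε' hle => ?_⟩
  · rw [Sends]
    ext x
    have hfix : ∀ y ∈ core ε', f y = y := fun y hy => by
      have : v y = 0 := hle hy
      rw [hf, unipotent_apply, AddMonoidHom.comp_apply, this, map_zero, add_zero]
    constructor
    · rintro ⟨y, hy, rfl⟩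
      change f y ∈ _
      rw [hfix y hy]; exact hy
    · intro hx
      exact ⟨x, hx, hfix x hx⟩
  · obtain ⟨b, d, l, hb, hrb⟩ := S.exists_cyc hε'
    have hcore := S.core_perp_eq hb hrb
    rw [hcore.1] at hle
    obtain ⟨hd1, hd2⟩ := hle ⟨d, hb.gen⟩
    have hd1 : w d = d := hw.idem.mem_range.mp hd1
    have hd2 : v d = 0 := hd2
    obtain ⟨x, c, j, hc, hcπ, hx⟩ := hφ d (by simp [hd1, hd2])
    have hvx : v x = x := by
      rw [← hc.gen, ← hcπ.1, AddMonoidHom.comp_apply, hv.1]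
    -- `v` and `w` need not commute, so `c` need not vanish on the kernel of `v`. Composing with `v`
    -- repairs this without changing the generator.
    obtain ⟨hcv, hcv'⟩ := hc.comp hv.1 hvx
    have hrc := rep_mkInv hcv.idem
    have hcorec := S.core_perp_eq hcv hrc
    have hcoref := S.core_perp_eq (hcv.conj f) (hrc.conj f)
    have hfx : f x = x + d := by rw [hf, unipotent_apply, AddMonoidHom.comp_apply, hvx, hx]
    refine ⟨mkInv _ hcv.idem, S.extreme_of_cyc hcv hrc, ?_, S.extreme_of_cyc hcv hrc, hε', ⟨?_, ?_, ?_⟩,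
      ?_, ?_⟩
    · rw [hcorec.1]; exact hcv'.range_le
    · rw [hcorec.1, hcore.1, eq_bot_iff]
      rintro y ⟨hy1, hy2⟩
      have h1 : v y = y := hv.1.mem_range.mp (hcv'.range_le hy1)
      have h2 : v y = 0 := (hle hy2).2
      rw [AddSubgroup.mem_bot, ← h1, h2]
    · rw [hcoref.1, hcorec.1, hcore.1, (hcv.conj f).range_eq, hcv.range_eq, hb.range_eq,
        AddSubgroup.zmultiples_le, hfx]
      exact AddSubgroup.add_mem_sup (AddSubgroup.mem_zmultiples x) (AddSubgroup.mem_zmultiples d)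
    · rw [hcoref.2, hcorec.2]
      rintro y ⟨hy, -⟩
      have hy : c (v y) = 0 := hy
      change f (c (v (f.symm y))) = 0
      rw [hf, unipotent_symm_apply]
      simp [hvφ, hy]
    · rw [Sends, hcorec.1, hcv.range_eq, AddSubgroup.zmultiples_map, hfx]
      intro heq
      obtain ⟨t, ht⟩ : x + d ∈ AddSubgroup.zmultiples x := by
        rw [← heq]; exact AddSubgroup.mem_zmultiples _
      have ht : t • x = x + d := ht
      have h1 := congrArg v ht
      rw [map_zsmul, map_add, hvx, hd2, add_zero, ht] at h1
      exact hb.ne_zero (add_eq_left.mp h1)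
    · rw [Sends, hcorec.1, hcv.range_eq, AddSubgroup.zmultiples_map, hfx, hcore.1, hb.range_eq]
      intro heq
      obtain ⟨t, ht⟩ : x + d ∈ AddSubgroup.zmultiples d := by
        rw [← heq]; exact AddSubgroup.mem_zmultiples _
      have ht : t • d = x + d := ht
      have h1 := congrArg v ht
      rw [map_zsmul, map_add, hvx, hd2, add_zero, smul_zero] at h1
      exact hc.ne_zero h1.symm

theorem Setting.pair_of_below (S : Setting p A) (h : Cyc p e a m) (hr : Rep ε e) (hξ : Rep ξ w)
    (hew : Below e w) : Pair ξ ε :=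
  ⟨hξ.invol, S.extreme_of_cyc h hr, (hξ.commutes_iff_comm S hr).mpr fun b => by rw [hew.1, hew.2]⟩

/-- Without minimality, choose a basis element `d` of the large complement with no nonzero multiple
in the image of `δ f π`. If `f x = α x + β d`, then `β d` lies in that image and vanishes, so `f`
preserves the cyclic group of `x`. -/
theorem Setting.isFinalProj_of_final (S : Setting p A) (h : Cyc p e a m) (hr : Rep ε e)
    (hξ : Rep ξ w) (hew : Below e w) (hF : Final ξ ε) : IsFinalProj p w m := by
  obtain ⟨hb, hs⟩ := (S.byOrd_iff h hr hξ hew).mp hF.1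
  refine ⟨hξ.1, hb, hs, fun n => ?_⟩
  by_contra hlt
  obtain ⟨π, k, e₁, a₁, s, hπ, hπw, hπk, hsk, he₁, heπ, hsB, hcard, hP⟩ :=
    S.exists_small_summand hξ.1 hb hs (not_le.mp hlt)
  have hδ : Idem (w - π) := hπw.sub_idem hπ hξ.1
  have hinf := aleph0_le_layerCard S.prime S.pGroup S.reduced S.unbounded k
  have hδk : ∀ x, p ^ k • (w - π) x = 0 := fun x => by
    have := hπk (w x)
    rwa [hπw.2] at this
  have hπδ : ∀ x, π ((w - π) x) = 0 := fun x => by simp [hπw.2, hπ x]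
  have hδπ : ∀ x, (w - π) (π x) = 0 := fun x => by simp [hπw.1, hπ x]
  have hrep := rep_mkInv hπ
  have hrep₁ := rep_mkInv he₁.idem
  have hpp := S.pairPart_eq he₁ hrep₁ hrep heπ
  have hpp₀ := S.pairPart_eq h hr hξ hew
  -- A nonzero element lies in at most one of the independent cyclic groups, so a small `T` spoils
  -- fewer basis elements than there are.
  have hgood : ∀ T : Set A, #T ≤ layerCard p k A →
      ∃ d ∈ s, ∀ c : ℤ, c • (d : A) ∈ T → c • (d : A) = 0 := by
    intro T hT
    by_contra! hcon
    have := mk_meeting_le (S.pGroup.subgroup _) hsB.pureIndep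
      ((mk_preimage_of_injective Subtype.val T Subtype.val_injective).trans hT)
    rw [Set.sep_eq_self_iff_mem_true.mpr (by
      intro d hd
      obtain ⟨c, hc, hc0⟩ := hcon d hd
      exact ⟨c, by simpa using hc, fun h0 => hc0 (by simpa using congrArg Subtype.val h0)⟩)] at this
    exact absurd this (not_le.mpr hcard)
  obtain ⟨f, -, hf⟩ := hF.2 _ _ (S.pair_of_below he₁ hrep₁ hrep heπ) (by
      rw [hpp.1, hpp₀.1]
      refine lt_of_le_of_ne hπw.range_le fun heq => ?_
      obtain ⟨d, hd, -⟩ := hgood ∅ (by simp)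
      have hd0 : (d : A) ≠ 0 := fun h0 => hsB.zero_notMem (by
        rw [show (0 : (w - π).range) = d from Subtype.ext h0.symm]; exact hd)
      have h1 : (d : A) ∈ π.range := by
        rw [heq]; exact (hπw.sub hξ.1).range_le d.2
      have h2 := hπδ d
      rw [hδ.mem_range.mp d.2, hπ.mem_range.mp h1] at h2
      exact hd0 h2)
    ((S.byOrd_iff he₁ hrep₁ hrep heπ).mpr ⟨hπk, hsk⟩)
  rw [hpp.1, hpp.2, hpp₀.1] at hf
  set g : A →+ A := ((w - π).comp f.toAddMonoidHom).comp π with hg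
  obtain ⟨d, hd, hdT⟩ := hgood (g.range : Set A) (mk_range_le S hinf hP.le
    (φ := g) (fun x => by simp [hg, hπ x]) (fun x => hδk _))
  obtain ⟨l, hl, hl'⟩ := (S.pGroup.subgroup (w - π).range).exists_order (x := d)
    (fun h0 => hsB.zero_notMem (h0 ▸ hd))
  obtain ⟨b', hb'⟩ := hsB.exists_cyc hd hl hl'
  obtain ⟨b, hbc, hbδ, -⟩ := hb'.extend hδ
  have hrb := rep_mkInv hbc.idem
  have hcoreb := S.core_perp_eq hbc hrb
  obtain ⟨ε', hε', hcore', -, -, hin, hns, -⟩ := hf (mkInv b hbc.idem) (S.extreme_of_cyc hbc hrb) (by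
    rw [hcoreb.1]
    refine le_inf ((hbδ.trans (hπw.sub hξ.1)).range_le) ?_
    rintro _ ⟨x, rfl⟩
    change π (b x) = 0
    rw [← hbδ.1, hπδ])
  obtain ⟨c, x, j, hc, hrc⟩ := S.exists_cyc hε'
  have hcorec := S.core_perp_eq hc hrc
  have hcoref := S.core_perp_eq (hc.conj f) (hrc.conj f)
  rw [hcorec.1] at hcore'
  have hπx : π x = x := hπ.mem_range.mp (hcore' ⟨x, hc.gen⟩)
  have hsum := hin.2.1
  rw [hcoref.1, hcorec.1, hcoreb.1, (hc.conj f).range_eq, hc.range_eq, hbc.range_eq,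
    AddSubgroup.zmultiples_le, AddSubgroup.mem_sup] at hsum
  obtain ⟨_, ⟨α, rfl⟩, _, ⟨β, rfl⟩, hfx⟩ := hsum
  have hfx : α • x + β • (d : A) = f x := hfx
  have hgx : g x = β • (d : A) := by
    rw [hg]
    simp only [AddMonoidHom.comp_apply, AddEquiv.coe_toAddMonoidHom, hπx, ← hfx, map_add, map_zsmul]
    rw [hδ.mem_range.mp d.2, ← hπx, hδπ, smul_zero, zero_add]
  have hβ := hdT β ⟨x, hgx⟩
  rw [hβ, add_zero] at hfx
  apply hns
  rw [Sends, hcorec.1, hc.range_eq, AddSubgroup.zmultiples_map]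
  -- The image of the cyclic group of `x` is contained in it and has the same finite order, so the
  -- two coincide.
  have hc1 := hc.conj f
  have hcard1 := mk_zmultiples S.prime hc1.ne hc1.zero
  have hcard2 := mk_zmultiples S.prime hc.ne hc.zero
  have hfin : Finite (AddSubgroup.zmultiples x) := by
    rw [← lt_aleph0_iff_finite, hcard2]; exact natCast_lt_aleph0
  apply AddSubgroup.eq_of_le_of_card_ge
  · rw [AddSubgroup.zmultiples_le]
    exact ⟨α, hfx⟩
  · rw [Nat.card, Nat.card, hcard1, hcard2]

/-! ### The decompositions `A = A_low ⊕ A_fin` -/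

theorem exists_idem_of_isCompl {X Y : AddSubgroup A} (h : IsCompl X Y) :
    ∃ v : A →+ A, Idem v ∧ v.range = X ∧ v.ker = Y := by
  have h' : IsCompl (AddSubgroup.toIntSubmodule X) (AddSubgroup.toIntSubmodule Y) :=
    OrderIso.isCompl AddSubgroup.toIntSubmodule h
  refine ⟨(Submodule.projection _ _ h').toAddMonoidHom, fun x => ?_, ?_, ?_⟩
  · simp
  · ext x
    change (∃ y, Submodule.projection _ _ h' y = x) ↔ _
    rw [← LinearMap.mem_range, Submodule.range_projection]
    rfl
  · ext x
    change Submodule.projection _ _ h' x = 0 ↔ _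
    rw [← LinearMap.mem_ker, Submodule.ker_projection]
    rfl

theorem Idem.isCompl (hw : Idem w) : IsCompl w.ker w.range := by
  constructor
  · rw [AddSubgroup.disjoint_def]
    intro x h1 h2
    rw [← hw.mem_range.mp h2]; exact h1
  · rw [codisjoint_iff, eq_top_iff]
    intro x _
    rw [AddSubgroup.mem_sup]
    exact ⟨x - w x, by rw [AddMonoidHom.mem_ker, map_sub, hw, sub_self], w x, ⟨x, rfl⟩, by simp⟩

/-- Adding the kernel of `w` to the complement turns a summand of the range into a summand of `A`.
-/
theorem IsIndecSummand.exists_cyc (S : Setting p A) {X : AddSubgroup A} (hw : Idem w)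
    (h : IsIndecSummand X w.range) :
    ∃ (e : A →+ A) (a : A) (k : ℕ), Cyc p e a k ∧ Below e w ∧ e.range = X := by
  obtain ⟨hX, Y, hXY, hsup⟩ := h
  have hc : IsCompl X (Y ⊔ w.ker) := by
    constructor
    · rw [AddSubgroup.disjoint_def]
      intro x hx hx'
      obtain ⟨y, hy, z, hz, rfl⟩ := AddSubgroup.mem_sup.mp hx'
      have hyw : y ∈ w.range := hsup ▸ le_sup_right (a := X) hy
      have h1 : w (y + z) = y + z := hw.mem_range.mp (hsup ▸ le_sup_left (b := Y) hx)
      rw [map_add, hw.mem_range.mp hyw, show w z = 0 from hz, add_zero, left_eq_add] at h1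
      rw [h1, add_zero] at hx ⊢
      have : y ∈ X ⊓ Y := ⟨hx, hy⟩
      rwa [hXY] at this
    · rw [codisjoint_iff, ← sup_assoc, hsup, sup_comm]
      exact hw.isCompl.sup_eq_top
  obtain ⟨v, hv, hvX, hvk⟩ := exists_idem_of_isCompl hc
  obtain ⟨a, k, hcyc⟩ := exists_cyc_of_indecomposable S.prime S.pGroup S.reduced hv (by rwa [hvX])
  refine ⟨v, a, k, hcyc, ⟨fun x => ?_, fun x => ?_⟩, hvX⟩
  · apply hw.mem_range.mp
    rw [← hsup, ← hvX]
    exact le_sup_left (b := Y) (show v x ∈ v.range from ⟨x, rfl⟩)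
  · have : x - w x ∈ v.ker := by
      rw [hvk]
      apply AddSubgroup.mem_sup_right
      rw [AddMonoidHom.mem_ker, map_sub, hw, sub_self]
    rw [AddMonoidHom.mem_ker, map_sub, sub_eq_zero] at this
    exact this.symm

theorem Cyc.isIndecSummand (hp : p.Prime) (hA : IsAbelianPGroup p A) (hw : Idem w) (h : Cyc p e a m)
    (hew : Below e w) : IsIndecSummand e.range w.range := by
  refine ⟨h.indecomposable hp hA, (w - e).range, ?_, ?_⟩
  · rw [eq_bot_iff]
    rintro x ⟨h1, y, hy⟩
    rw [AddSubgroup.mem_bot, ← h.idem.mem_range.mp h1, ← hy]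
    simp [hew.2, h.idem y]
  · apply le_antisymm
    · exact sup_le hew.range_le (hew.sub hw).range_le
    · rintro _ ⟨x, rfl⟩
      rw [AddSubgroup.mem_sup]
      exact ⟨e x, ⟨x, rfl⟩, (w - e) x, ⟨x, rfl⟩, by simp⟩

theorem Setting.hasFinalRank (S : Setting p A) (hmin : ∀ n, layerCard p m A ≤ layerCard p n A) :
    HasFinalRank p A (layerCard p m A) := by
  have h := hasFinalRank_iInf S.prime S.pGroup
    (aleph0_le_layerCard S.prime S.pGroup S.reduced S.unbounded)
  have heq : ⨅ n, layerCard p n A = layerCard p m A :=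
    le_antisymm (ciInf_le' _ m) (le_ciInf hmin)
  rwa [heq] at h

theorem IsFinalProj.isLowFin (S : Setting p A) (hw : IsFinalProj p w m) :
    IsLowFin p w.ker w.range where
  compl := hw.idem.isCompl
  order_lt X Y hX hY := by
    rw [← hw.idem.range_compl] at hX
    obtain ⟨e, a, k, he, hew, rfl⟩ := hX.exists_cyc S hw.idem.compl
    obtain ⟨e', a', k', he', hew', rfl⟩ := hY.exists_cyc S hw.idem
    rw [he.mk_range S.prime, he'.mk_range S.prime, ← not_le, pow_card_le_iff S.prime]
    have h1 : k < m := he.lt_of_bounded hew (by simpa using hw.bounded)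
    have h2 := he'.le_of_socleDiv hew' hw.socle
    omega
  rank_eq := by
    refine ⟨layerCard p m A, S.hasFinalRank hw.min, ?_⟩
    have heq : layerCard p 0 w.range = layerCard p m A := by
      rw [hw.socle.layerCard_eq hw.idem, hw.idem.layerCard_eq hw.bounded]
    have := hasBasicRank_layerCard S.prime (S.pGroup.subgroup w.range) (by
      rw [heq]; exact aleph0_le_layerCard S.prime S.pGroup S.reduced S.unbounded m)
    rwa [heq] at this

theorem exists_min_layer (p : ℕ) (A : Type u) [AddCommGroup A] :
    ∃ m, ∀ n, layerCard p m A ≤ layerCard p n A := by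
  obtain ⟨_, ⟨m, rfl⟩, hm⟩ := Cardinal.lt_wf.has_min (Set.range fun n => layerCard p n A) ⟨_, 0, rfl⟩
  exact ⟨m, fun n => not_lt.mp (hm _ ⟨n, rfl⟩)⟩

theorem Setting.exists_isFinalProj (S : Setting p A) : ∃ (w : A →+ A) (m : ℕ), IsFinalProj p w m := by
  obtain ⟨m, hm⟩ := exists_min_layer p A
  obtain ⟨e, he, hb, hs⟩ := exists_bounded_projection S.prime S.pGroup m
  refine ⟨AddMonoidHom.id A - e, m, he.compl, by simpa using hb, fun x hx hpx => hs x ?_ hpx, hm⟩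
  simpa using hx

/-- The decompositions into `A_low` and `A_fin`, with a cyclic summand of the least order in `A_fin`. -/
theorem Setting.isLowFin_iff (S : Setting p A) {A₁ A₂ : AddSubgroup A} :
    IsLowFin p A₁ A₂ ↔ ∃ (w e : A →+ A) (a : A) (m : ℕ), IsFinalProj p w m ∧ Cyc p e a m ∧
      Below e w ∧ w.ker = A₁ ∧ w.range = A₂ := by
  constructor
  · intro h
    obtain ⟨w, hw, rfl, rfl⟩ := exists_idem_of_isCompl h.compl.symm
    obtain ⟨κ, hκ, hκ'⟩ := h.rank_eq
    obtain ⟨n₀, hn₀⟩ := exists_min_layer p A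
    have hκn := hκ.unique (S.hasFinalRank hn₀)
    have hinf := aleph0_le_layerCard S.prime S.pGroup S.reduced S.unbounded
    -- The prescribed rank is infinite, so the second summand cannot vanish.
    have hne : ∃ x, w x ≠ 0 := by
      by_contra! hcon
      obtain ⟨B, hB⟩ := hκ'.1
      have h1 : rank B ≤ 1 := by
        refine (rank_le_mk B).trans ?_
        have : Subsingleton B := by
          constructor
          rintro ⟨⟨_, x, rfl⟩, hx⟩ ⟨⟨_, y, rfl⟩, hy⟩
          simp [hcon]
        exact le_one_iff_subsingleton.mpr this
      rw [hκ'.2 B hB, hκn] at h1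
      exact absurd ((hinf n₀).trans h1) (not_le.mpr one_lt_aleph0)
    obtain ⟨m, e, a, he, hew, hs⟩ := exists_cyc_socleDiv S.prime S.pGroup S.reduced hw hne
    have hb : ∀ x, p ^ m • (x - w x) = 0 := by
      by_contra! hcon
      obtain ⟨x, hx⟩ := hcon
      obtain ⟨k, e', a', hmk, he', hb⟩ := exists_cyc_of_pow_ne S.prime S.pGroup S.reduced hw.compl
        (n := m) ⟨x, by simpa using hx⟩
      have := h.order_lt _ _ (hw.range_compl ▸ he'.isIndecSummand S.prime S.pGroup hw.compl hb)
        (he.isIndecSummand S.prime S.pGroup hw hew)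
      rw [he.mk_range S.prime, he'.mk_range S.prime, ← not_le, pow_card_le_iff S.prime] at this
      exact this hmk
    refine ⟨w, e, a, m, ⟨hw, hb, hs, fun n => ?_⟩, he, hew, rfl, rfl⟩
    have heq : layerCard p 0 w.range = layerCard p m A := by
      rw [hs.layerCard_eq hw, hw.layerCard_eq hb]
    have h2 := hκ'.unique (hasBasicRank_layerCard S.prime (S.pGroup.subgroup w.range) (by
      rw [heq]; exact hinf m))
    rw [← heq, ← h2, hκn]
    exact hn₀ n
  · rintro ⟨w, e, a, m, hw, -, -, rfl, rfl⟩
    exact hw.isLowFin S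

theorem Setting.exists_pair_iff (S : Setting p A) {A₁ A₂ : AddSubgroup A} :
    (∃ ξ₀ ε₀ : A ≃+ A, Pair ξ₀ ε₀ ∧ Final ξ₀ ε₀ ∧ pairCompl ξ₀ ε₀ = A₁ ∧ pairPart ξ₀ ε₀ = A₂) ↔
      IsLowFin p A₁ A₂ := by
  rw [S.isLowFin_iff]
  constructor
  · rintro ⟨ξ, ε, hP, hF, h1, h2⟩
    obtain ⟨e, a, m, he, hr⟩ := S.exists_cyc hP.2.1
    obtain ⟨w, hw, hew⟩ := S.exists_rep_above he hr hP.1 hP.2.2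
    have hpp := S.pairPart_eq he hr hw hew
    exact ⟨w, e, a, m, S.isFinalProj_of_final he hr hw hew hF, he, hew, by rw [← hpp.2, h1],
      by rw [← hpp.1, h2]⟩
  · rintro ⟨w, e, a, m, hw, he, hew, h1, h2⟩
    have hr := rep_mkInv he.idem
    have hwr := rep_mkInv hw.idem
    have hpp := S.pairPart_eq he hr hwr hew
    exact ⟨mkInv w hw.idem, mkInv e he.idem, S.pair_of_below he hr hwr hew, hw.final S he hr hwr hew,
      by rw [hpp.2, h1], by rw [hpp.1, h2]⟩

end Final

/-! ### Predicates of the group `Aut A` -/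

section Predicates

variable {A : Type u} [AddCommGroup A]

def Central (x : A ≃+ A) : Prop := ∀ g : A ≃+ A, Commutes g x

/-- The group-theoretic description of extreme involutions. -/
def GroupExtreme (e : A ≃+ A) : Prop :=
  (∀ a, e (e a) = a) ∧ ¬ Central e ∧
    ∀ ξ : A ≃+ A, (∀ a, ξ (ξ a) = a) → Commutes ξ e →
      ∀ x : A ≃+ A, (∀ a, x (x a) = a) →
        (∀ g : A ≃+ A, Commutes g e → Commutes g ξ → Commutes g x) →
        Central x ∨ Central (e.trans x) ∨ Central (ξ.trans x) ∨ Central ((e.trans ξ).trans x)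

/-- For extreme involutions `a`, `b` commuting with `ξ`: their cores lie in the same part of `ξ`. -/
def SameSide (ξ a b : A ≃+ A) : Prop :=
  ∃ g : A ≃+ A, Commutes g ξ ∧ ¬ Commutes (conj g a) b

/-- For commuting extreme involutions: the order of `a` is at most that of `b`. -/
def OrdLe (a b : A ≃+ A) : Prop :=
  ∀ u : A ≃+ A, (∀ g, Commutes g a → Commutes g u) →
    (∀ g, Commutes g (b.trans a) → Commutes g u) → Central u

/-- The test involutions also commute with `a`, which is the range where `OrdLe` compares orders.
The case `b = a` is not idle: it forces `SameSide ξ a a`, so that the side of `a` is larger than its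
core. -/
def GroupByOrd (ξ a : A ≃+ A) : Prop :=
  ∀ b : A ≃+ A, GroupExtreme b → Commutes b ξ → Commutes b a → (SameSide ξ a b ↔ OrdLe a b)

/-- `b` is an extreme involution in the sum of the parts of `ξ₀` and `ξ₁` containing `ε₀` and `ε₁`. -/
def LiesUpper (ξ₀ ε₀ ξ₁ ε₁ b : A ≃+ A) : Prop :=
  GroupExtreme b ∧ Commutes b ξ₀ ∧ Commutes b ξ₁ ∧ SameSide ξ₀ ε₀ b ∧ SameSide ξ₁ ε₁ b

/-- `b` is an extreme involution in the part of `ξ₀` containing `ε₀`, and in the part of `ξ₁` not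
containing `ε₁`. -/
def LiesLower (ξ₀ ε₀ ξ₁ ε₁ b : A ≃+ A) : Prop :=
  GroupExtreme b ∧ Commutes b ξ₀ ∧ Commutes b ξ₁ ∧ SameSide ξ₀ ε₀ b ∧ ¬ SameSide ξ₁ ε₁ b

/-- For orthogonal cores, `b.trans a` is an involution whose projection is the sum of those of `a`
and `b`. Commuting with it replaces containment of the moved core in the sum; failing to commute
with `b` rules out an `f` that creates no link. -/
def Couples (f a b : A ≃+ A) : Prop :=
  Commutes (conj f a) (b.trans a) ∧ ¬ Commutes (conj f a) b

/-- The group-theoretic description of the pairs with the property `Final`. -/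
def GroupFinal (ξ₀ ε₀ : A ≃+ A) : Prop :=
  (∀ a, ξ₀ (ξ₀ a) = a) ∧ GroupExtreme ε₀ ∧ Commutes ξ₀ ε₀ ∧ GroupByOrd ξ₀ ε₀ ∧
    ∀ ξ₁ ε₁ : A ≃+ A, (∀ a, ξ₁ (ξ₁ a) = a) → Commutes ξ₁ ξ₀ → LiesUpper ξ₀ ε₀ ξ₁ ε₁ ε₁ →
      (∀ b, LiesLower ξ₀ ε₀ ξ₁ ε₁ b → OrdLe b ε₁) →
      ∃ f : A ≃+ A, ∀ b, LiesLower ξ₀ ε₀ ξ₁ ε₁ b →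
        ∃ a, LiesUpper ξ₀ ε₀ ξ₁ ε₁ a ∧ Couples f a b

end Predicates

/-! ### The predicates of the group in terms of projections -/

section Meaning

variable {p : ℕ} {A : Type u} [AddCommGroup A] {ξ ε : A ≃+ A} {w e : A →+ A} {a : A} {m k : ℕ}

/-- If both parts are nonzero, there is a nonzero homomorphism `f` from one to the other, and `1 +
f` does not commute with the involution. -/
theorem Setting.eq_zero_or_of_central (S : Setting p A) (h : Rep ξ e) (hc : Central ξ) :
    (∀ a, e a = 0) ∨ ∀ a, e a = a := by
  by_contra! hcon
  obtain ⟨h1, x, hx⟩ := hcon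
  obtain ⟨f, hf1, hf2, y, hy⟩ := exists_hom_ne_zero S.prime S.pGroup S.reduced h.1 h1 h.1.compl
    ⟨x, by simpa [sub_eq_zero] using hx.symm⟩
  have hef : ∀ x, e (f x) = 0 := fun x => by simpa using hf1 x
  have hff : ∀ x, f (f x) = 0 := fun x => by rw [← hf2, hef, map_zero]
  have := (h.commutes_iff S).mp (hc (unipotent f hff)) y
  rw [unipotent_apply, unipotent_apply, map_add, hef, hf2, add_zero,
    _root_.add_eq_left] at this
  exact hy this

/-- An idempotent commuting with all `1 + f`, for `f` of square zero in a corner, is trivial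
there. -/
theorem Setting.corner_trivial (S : Setting p A) {q y : A →+ A} (hq : Idem q) (hy : Idem y)
    (hqy : ∀ b, q (y b) = y (q b))
    (h : ∀ f : A →+ A, (∀ b, f (f b) = 0) → (∀ b, q (f b) = f b) → (∀ b, f (q b) = f b) →
      ∀ b, y (f b) = f (y b)) :
    (∀ b, y (q b) = 0) ∨ ∀ b, y (q b) = q b := by
  by_contra! hcon
  obtain ⟨⟨x, hx⟩, x', hx'⟩ := hcon
  have h1 : Idem (y.comp q) := fun b => by simp [hqy, hq b, hy (q b)]
  have h2 : Idem (q - y.comp q) := fun b => by simp [hqy, hq b, hy (q b)]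
  obtain ⟨f, hf1, hf2, z, hz⟩ := exists_hom_ne_zero S.prime S.pGroup S.reduced h1 ⟨x, hx⟩ h2
    ⟨x', by simpa [sub_eq_zero] using hx'.symm⟩
  have hyf : ∀ b, y (f b) = 0 := fun b => by
    rw [← hf1 b]; simp [hy (q (f b))]
  have hqf : ∀ b, q (f b) = f b := fun b => by
    rw [← hf1 b]; simp [hqy, hq (f b)]
  have hfq : ∀ b, f (q b) = f b := fun b => by
    rw [← hf2 (q b), ← hf2 b]; simp [hq b]
  have hff : ∀ b, f (f b) = 0 := fun b => by
    rw [← hf2 (f b), AddMonoidHom.comp_apply, hqf, hyf, map_zero]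
  have := h f hff hqf hfq z
  have hfz := hf2 z
  rw [AddMonoidHom.comp_apply] at hfz
  rw [hyf, ← hf2 (y z), AddMonoidHom.comp_apply, hqy, hy, hfz] at this
  exact hz this.symm

theorem central_of_scalar {T : A ≃+ A} {t : ℤ} (h : ∀ b, T b = t • b) : Central T := fun g b => by
  rw [h, h, map_zsmul]

/-- Since the core of `ε` is indecomposable, `ε` and `ξ` cut `A` into at most three pieces: `e`, `x
- e x` and the rest. An involution commuting with their common centralizer is a sign on each, and up
to a global sign the eight patterns are those of `1`, `ε`, `ξ` and `ε ξ`. -/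
theorem Setting.groupExtreme_of_extreme (S : Setting p A) (hε : Extreme ε) : GroupExtreme ε := by
  obtain ⟨e, a, k, hc, hr⟩ := S.exists_cyc hε
  have he := hc.idem
  refine ⟨hr.invol, fun hcen => ?_, fun ξ hξ hξε X hX hcX => ?_⟩
  · rcases S.eq_zero_or_of_central hr hcen with h | h
    · exact hc.ne_zero (by rw [← hc.gen, h])
    · obtain ⟨x, hx⟩ := S.exists_pow_ne_of_bounded hc.pow_smul 0
      exact hx (by simp [h])
  obtain ⟨x, hx, hξx⟩ := S.exists_rep hξ
  obtain ⟨y, hy, hXy⟩ := S.exists_rep hX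
  have hrx : Rep ξ x := ⟨hx, Or.inl hξx⟩
  have hry : Rep X y := ⟨hy, Or.inl hXy⟩
  have hxe := (hrx.commutes_iff_comm S hr).mp hξε
  have hye := (hr.commutes_iff_comm S hry).mp (hcX ε (fun _ => rfl) hξε.symm)
  have hyx := (hrx.commutes_iff_comm S hry).mp (hcX ξ hξε (fun _ => rfl))
  have key : ∀ q : A →+ A, Idem q → (∀ b, e (q b) = 0) → (∀ b, q (e b) = 0) →
      (∀ b, x (q b) = q (x b)) → (∀ b, q (y b) = y (q b)) →
      (∀ f : A →+ A, (∀ b, q (f b) = f b) → (∀ b, f (q b) = f b) → ∀ b, x (f b) = f (x b)) →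
      ∃ t : ℤ, (t = 1 ∨ t = -1) ∧ ∀ b, X (q b) = t • q b := by
    intro q hq heq hqe hxq hqy hfx
    rcases S.corner_trivial hq hy hqy (fun f hff hqf hfq b => by
      have := (hry.commutes_iff S).mp (hcX (unipotent f hff)
        ((hr.commutes_iff S).mpr fun b => by
          rw [unipotent_apply, unipotent_apply, map_add, ← hqf b, heq, ← hfq (e b), hqe, map_zero])
        ((hrx.commutes_iff S).mpr fun b => by
          rw [unipotent_apply, unipotent_apply, map_add, hfx f hqf hfq b])) b
      rw [unipotent_apply, unipotent_apply, map_add, add_right_inj] at this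
      exact this.symm) with h | h
    · exact ⟨1, Or.inl rfl, fun b => by rw [hXy, h]; simp⟩
    · refine ⟨-1, Or.inr rfl, fun b => ?_⟩
      rw [hXy, h, neg_smul, one_smul]; abel
  obtain ⟨t₂, ht₂, hX₂⟩ := key (x - e.comp x) (fun b => by simp [hx b, he (x b), hxe])
    (fun b => by simp [he (x b)]) (fun b => by simp [hxe, he (x b)])
    (fun b => by simp [hx b, hxe]) (fun b => by simp [hyx, hye])
    (fun f hqf hfq b => by
      have h1 : x (f b) = f b := by
        rw [← hqf b]; simp [hx (f b), hxe]
      have h2 : f (x b) = f b := by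
        rw [← hfq (x b), ← hfq b]; simp [hx b]
      rw [h1, h2])
  obtain ⟨t₃, ht₃, hX₃⟩ := key (AddMonoidHom.id A - e - (x - e.comp x))
    (fun b => by simp [hx b, he b, hxe, he (x b)])
    (fun b => by simp [he b, he (x b)]) (fun b => by simp [hxe, he b, he (x b)])
    (fun b => by simp [hx b, hxe]) (fun b => by simp [hyx, hye])
    (fun f hqf hfq b => by
      have h1 : x (f b) = 0 := by
        rw [← hqf b]; simp [hx (f b), hxe]
      have h2 : f (x b) = 0 := by
        rw [← hfq (x b)]; simp [hx b]
      rw [h1, h2])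
  obtain ⟨t₁, ht₁, hX₁⟩ : ∃ t : ℤ, (t = 1 ∨ t = -1) ∧ ∀ b, X (e b) = t • e b := by
    rcases hc.dichotomy S.prime S.pGroup hy (fun b => (hye b).symm) with h | h
    · refine ⟨-1, Or.inr rfl, fun b => ?_⟩
      rw [hXy, h.1, neg_smul, one_smul]; abel
    · exact ⟨1, Or.inl rfl, fun b => by rw [hXy, h.1]; simp⟩
  obtain ⟨r, hr₁, hξ₁⟩ : ∃ t : ℤ, (t = 1 ∨ t = -1) ∧ ∀ b, ξ (e b) = t • e b := by
    rcases hc.dichotomy S.prime S.pGroup hx hxe with h | h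
    · refine ⟨-1, Or.inr rfl, fun b => ?_⟩
      rw [hξx, h.1, neg_smul, one_smul]; abel
    · exact ⟨1, Or.inl rfl, fun b => by rw [hξx, h.1]; simp⟩
  obtain ⟨σ, hσ⟩ : ∃ σ : ℤ, ∀ b, ε b = σ • (b - 2 • e b) := by
    rcases hr.2 with h | h
    · exact ⟨1, fun b => by rw [h, one_smul]⟩
    · exact ⟨-1, fun b => by rw [h, neg_smul, one_smul, neg_sub]⟩
  have hε₁ : ∀ b, ε (e b) = (-σ) • e b := fun b => by
    rw [hσ, he, two_smul, neg_smul, ← smul_neg]; congr 1; abel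
  have hεq : ∀ b, e b = 0 → ε b = σ • b := fun b hb => by
    rw [hσ, hb, smul_zero, sub_zero]
  have hε₂ : ∀ b, ε ((x - e.comp x) b) = σ • (x - e.comp x) b := fun b =>
    hεq _ (by simp [he (x b)])
  have hε₃ : ∀ b, ε ((AddMonoidHom.id A - e - (x - e.comp x)) b) =
      σ • (AddMonoidHom.id A - e - (x - e.comp x)) b := fun b => hεq _ (by simp [he b, he (x b)])
  have hξ₂ : ∀ b, ξ ((x - e.comp x) b) = (-1 : ℤ) • (x - e.comp x) b := fun b => by
    rw [hξx]
    have : x ((x - e.comp x) b) = (x - e.comp x) b := by simp [hx b, hxe]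
    rw [this, neg_smul, one_smul]; abel
  have hξ₃ : ∀ b, ξ ((AddMonoidHom.id A - e - (x - e.comp x)) b) =
      (1 : ℤ) • (AddMonoidHom.id A - e - (x - e.comp x)) b := fun b => by
    rw [hξx]
    have : x ((AddMonoidHom.id A - e - (x - e.comp x)) b) = 0 := by simp [hx b, hxe]
    rw [this]; simp
  have hfin : ∀ (T : A ≃+ A) (s₁ s₂ s₃ : ℤ), (∀ b, T (e b) = s₁ • e b) →
      (∀ b, T ((x - e.comp x) b) = s₂ • (x - e.comp x) b) →
      (∀ b, T ((AddMonoidHom.id A - e - (x - e.comp x)) b) =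
        s₃ • (AddMonoidHom.id A - e - (x - e.comp x)) b) → s₁ = s₂ → s₁ = s₃ → Central T := by
    rintro T t s₂ s₃ h1 h2 h3 rfl rfl
    apply central_of_scalar (t := t)
    intro b
    have hb : b = e b + (x - e.comp x) b + (AddMonoidHom.id A - e - (x - e.comp x)) b := by
      simp only [AddMonoidHom.sub_apply, AddMonoidHom.id_apply]; abel
    conv_lhs => rw [hb]
    rw [map_add, map_add, h1, h2, h3, ← smul_add, ← smul_add, ← hb]
  -- `ε` has signs `(-σ, σ, σ)` and `ξ` has signs `(r, -1, 1)`. Equal `t₂`, `t₃` call for a factor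
  -- `1` or `ε`; opposite ones for `ξ` or `ε ξ`.
  by_cases h23 : t₂ = t₃
  · by_cases h12 : t₁ = t₂
    · left
      exact hfin X t₁ t₂ t₃ hX₁ hX₂ hX₃ h12 (h12.trans h23)
    · have h12' : t₁ = - t₂ := by omega
      right; left
      refine hfin _ (-σ * t₁) (σ * t₂) (σ * t₃) (fun b => ?_) (fun b => ?_) (fun b => ?_)
        (by rw [h12']; ring) (by rw [h12', h23]; ring)
      · rw [AddEquiv.trans_apply, hε₁, map_zsmul, hX₁, mul_smul]
      · rw [AddEquiv.trans_apply, hε₂, map_zsmul, hX₂, mul_smul]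
      · rw [AddEquiv.trans_apply, hε₃, map_zsmul, hX₃, mul_smul]
  · have h23' : t₃ = - t₂ := by omega
    by_cases h12 : r * t₁ = - t₂
    · right; right; left
      refine hfin _ (r * t₁) (-1 * t₂) (1 * t₃) (fun b => ?_) (fun b => ?_) (fun b => ?_)
        (by rw [h12]; ring) (by rw [h12, h23']; ring)
      · rw [AddEquiv.trans_apply, hξ₁, map_zsmul, hX₁, mul_smul]
      · rw [AddEquiv.trans_apply, hξ₂, map_zsmul, hX₂, mul_smul]
      · rw [AddEquiv.trans_apply, hξ₃, map_zsmul, hX₃, mul_smul]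
    · have h12' : r * t₁ = t₂ := by
        rcases hr₁ with rfl | rfl <;> omega
      right; right; right
      refine hfin _ (-σ * (r * t₁)) (σ * (-1 * t₂)) (σ * (1 * t₃)) (fun b => ?_) (fun b => ?_)
        (fun b => ?_) (by rw [h12']; ring) (by rw [h12', h23']; ring)
      · rw [AddEquiv.trans_apply, AddEquiv.trans_apply, hε₁, map_zsmul, hξ₁, map_zsmul, map_zsmul, hX₁,
          mul_smul, mul_smul]
      · rw [AddEquiv.trans_apply, AddEquiv.trans_apply, hε₂, map_zsmul, hξ₂, map_zsmul, map_zsmul, hX₂,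
          mul_smul, mul_smul]
      · rw [AddEquiv.trans_apply, AddEquiv.trans_apply, hε₃, map_zsmul, hξ₃, map_zsmul, map_zsmul, hX₃,
          mul_smul, mul_smul]

/-- If neither part is cyclic, split a cyclic summand `c` off one and `c'` off the other, and let
`ξ` belong to `c + c'`. Since `c = e (c + c')`, the involution of `c` commutes with the common
centralizer. Its four products with `1`, `ε`, `ξ` and `ε ξ` belong to `c`, `e - c`, `c'` and `e +
c'`, none of which is 0 or 1. -/
theorem Setting.extreme_of_groupExtreme (S : Setting p A) (hε : GroupExtreme ε) : Extreme ε := by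
  obtain ⟨h1, h2, h3⟩ := hε
  obtain ⟨e, he, hr⟩ := S.exists_rep h1
  have hrep : Rep ε e := ⟨he, Or.inl hr⟩
  by_contra hne
  have hcyc : ∀ a k, ¬ Cyc p e a k := fun a k hc => hne (S.extreme_of_cyc hc hrep)
  have hcyc' : ∀ a k, ¬ Cyc p (AddMonoidHom.id A - e) a k := fun a k hc =>
    hne (S.extreme_of_cyc hc hrep.compl)
  have hne0 : ∃ x, e x ≠ 0 := by
    by_contra! h0
    exact h2 (central_of_scalar (t := 1) fun b => by rw [hr, h0]; simp)
  have hne1 : ∃ x, (AddMonoidHom.id A - e) x ≠ 0 := by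
    by_contra! h0
    refine h2 (central_of_scalar (t := -1) fun b => ?_)
    have : e b = b := by
      have := h0 b
      rw [AddMonoidHom.sub_apply, AddMonoidHom.id_apply, sub_eq_zero] at this
      exact this.symm
    rw [hr, this, neg_smul, one_smul]; abel
  obtain ⟨k, c, a, hc, hce⟩ := exists_cyc_of_ne_zero S.prime S.pGroup S.reduced he hne0
  obtain ⟨k', c', a', hc', hce'⟩ := exists_cyc_of_ne_zero S.prime S.pGroup S.reduced he.compl hne1
  obtain ⟨y, hy⟩ : ∃ y, e y ≠ c y := by
    by_contra! h
    exact hcyc a k (by rwa [show e = c from AddMonoidHom.ext h])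
  obtain ⟨y', hy'⟩ : ∃ y, y - e y ≠ c' y := by
    by_contra! h
    exact hcyc' a' k' (by rwa [show AddMonoidHom.id A - e = c' from AddMonoidHom.ext h])
  have hec' : ∀ b, e (c' b) = 0 := fun b => by simpa using hce'.1 b
  have hc'e : ∀ b, c' (e b) = 0 := fun b => by simpa using hce'.2 b
  have hcc' : ∀ b, c (c' b) = 0 := fun b => by rw [← hce.2, hec', map_zero]
  have hc'c : ∀ b, c' (c b) = 0 := fun b => by rw [← hce.1, hc'e]
  have hsum : Idem (c + c') := fun b => by simp [hc.idem b, hc'.idem b, hcc', hc'c]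
  have hrs := rep_mkInv hsum
  have hrc := rep_mkInv hc.idem
  rcases h3 (mkInv _ hsum) hrs.invol ((hrs.commutes_iff_comm S hrep).mpr fun b => by
      simp [hce.1, hce.2, hec', hc'e]) (mkInv c hc.idem) hrc.invol (by
      intro g hge hgs
      rw [hrep.commutes_iff S] at hge
      rw [hrs.commutes_iff S] at hgs
      rw [hrc.commutes_iff S]
      intro b
      have hcs : ∀ b, c b = e ((c + c') b) := fun b => by simp [hce.1, hec']
      rw [hcs, hge, hgs, ← hcs]) with h | h | h | h
  · rcases S.eq_zero_or_of_central hrc h with h0 | h0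
    · exact hc.ne_zero (by rw [← hc.gen, h0])
    · exact hy (by rw [← h0 y, hce.1, hc.idem])
  · have hrep' : Rep (ε.trans (mkInv c hc.idem)) (e - c) := by
      refine ⟨hce.sub_idem hc.idem he, Or.inl fun b => ?_⟩
      rw [AddEquiv.trans_apply, mkInv_apply, hr, map_sub, map_nsmul, hce.2, AddMonoidHom.sub_apply]
      abel
    rcases S.eq_zero_or_of_central hrep' h with h0 | h0
    · exact hy (by simpa [sub_eq_zero] using h0 y)
    · apply hc.ne_zero
      have := h0 a
      rw [AddMonoidHom.sub_apply, hc.gen, show e a = a by rw [← hc.gen, hce.1], sub_self] at this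
      exact this.symm
  · have hrep' : Rep ((mkInv _ hsum).trans (mkInv c hc.idem)) c' := by
      refine ⟨hc'.idem, Or.inl fun b => ?_⟩
      rw [AddEquiv.trans_apply, mkInv_apply, mkInv_apply, map_sub, map_nsmul, AddMonoidHom.add_apply,
        map_add, hc.idem, hcc']
      abel
    rcases S.eq_zero_or_of_central hrep' h with h0 | h0
    · exact hc'.ne_zero (by rw [← hc'.gen, h0])
    · exact hy' (by rw [← h0 y', hec', hc'.idem, sub_zero])
  · have hrep' : Rep ((ε.trans (mkInv _ hsum)).trans (mkInv c hc.idem)) (e + c') := by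
      refine ⟨fun b => by simp [he b, hc'.idem b, hec', hc'e], Or.inl fun b => ?_⟩
      rw [AddEquiv.trans_apply, AddEquiv.trans_apply, mkInv_apply, mkInv_apply, hr]
      simp only [map_sub, map_nsmul, AddMonoidHom.add_apply, map_add, hc.idem b, hcc', hce.2, hc'e,
        map_zero]
      abel
    rcases S.eq_zero_or_of_central hrep' h with h0 | h0
    · apply hc'.ne_zero
      have := h0 a'
      rwa [AddMonoidHom.add_apply, hc'.gen, show e a' = 0 by rw [← hc'.gen, hec'], zero_add] at this
    · exact hy' (by
        have := h0 y'
        rw [AddMonoidHom.add_apply] at this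
        rw [sub_eq_iff_eq_add, add_comm, this])

theorem Setting.groupExtreme_of_cyc (S : Setting p A) (h : Cyc p e a k) (hr : Rep ε e) :
    GroupExtreme ε := S.groupExtreme_of_extreme (S.extreme_of_cyc h hr)

theorem Setting.exists_cyc_of_groupExtreme (S : Setting p A) (h : GroupExtreme ε) :
    ∃ (e : A →+ A) (a : A) (k : ℕ), Cyc p e a k ∧ Rep ε e :=
  S.exists_cyc (S.extreme_of_groupExtreme h)

/-! #### Sides of an involution -/

variable {ε' : A ≃+ A} {e' : A →+ A} {a' : A} {k' : ℕ}

/-- Conjugation by an automorphism commuting with `ξ` keeps the projection of `ε` below `w`, hence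
orthogonal to that of `ε'`. -/
theorem Setting.not_sameSide (S : Setting p A) (hw : Rep ξ w) (hr : Rep ε e) (hr' : Rep ε' e')
    (hew : Below e w) (h1 : ∀ b, w (e' b) = 0) (h2 : ∀ b, e' (w b) = 0) : ¬ SameSide ξ ε ε' := by
  rintro ⟨g, hg, hn⟩
  rw [hw.commutes_iff S] at hg
  apply hn
  rw [(hr.conj g).commutes_iff_comm S hr']
  have hg' : ∀ b, g.symm (w b) = w (g.symm b) := fun b => by
    apply g.injective
    rw [hg]; simp
  intro b
  rw [conjHom_apply, conjHom_apply, ← hew.2, ← hg', h1, ← hew.1 (g.symm b), hg, h2]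
  simp

/-- For `f` from `e` to `w - e`, conjugation by `1 + f` turns `e` into `e + f`. If all these commute
with `e'`, so does every such `f`. A nonzero `f`, with values in `w - e` when `e'` lies below `e`
and in `e'` when it is orthogonal to `e`, contradicts this. -/
theorem Setting.sameSide (S : Setting p A) (hw : Rep ξ w) (h : Cyc p e a k) (hr : Rep ε e)
    (h' : Cyc p e' a' k') (hr' : Rep ε' e') (hew : Below e w) (hew' : Below e' w)
    (hne : ∃ x, (w - e) x ≠ 0) : SameSide ξ ε ε' := by
  by_contra hcon
  have hcomm : ∀ f : A →+ A, (∀ b, (w - e) (f b) = f b) → (∀ b, f (e b) = f b) →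
      ∀ b, e (e' b) + f (e' b) = e' (e b) + e' (f b) := by
    intro f hf1 hf2 b
    have hef : ∀ b, e (f b) = 0 := fun b => by
      rw [← hf1 b]; simp [hew.2, h.idem (f b)]
    have hwf : ∀ b, w (f b) = f b := fun b => by
      rw [← hf1 b]; simp [hew.1, hw.1 (f b)]
    have hfw : ∀ b, f (w b) = f b := fun b => by rw [← hf2, hew.2, hf2]
    have hff : ∀ b, f (f b) = 0 := fun b => by rw [← hf2, hef, map_zero]
    have hg : Commutes (unipotent f hff) ξ := by
      rw [hw.commutes_iff S]
      intro b
      rw [unipotent_apply, unipotent_apply, map_add, hwf, hfw]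
    have hc : Commutes (conj (unipotent f hff) ε) ε' := by
      by_contra hn
      exact hcon ⟨_, hg, hn⟩
    have := ((hr.conj _).commutes_iff_comm S hr').mp hc b
    simp only [conjHom_apply, unipotent_apply, unipotent_symm_apply, map_sub, map_add, hef, hf2,
      sub_zero] at this
    exact this
  have h0 : ∀ b, e (e' b) = e' (e b) := fun b => by
    simpa using hcomm 0 (by simp) (by simp) b
  have hf : ∀ f : A →+ A, (∀ b, (w - e) (f b) = f b) → (∀ b, f (e b) = f b) →
      ∀ b, f (e' b) = e' (f b) := fun f h1 h2 b => by
    have := hcomm f h1 h2 b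
    rwa [h0, add_right_inj] at this
  rcases h'.dichotomy S.prime S.pGroup h.idem h0 with h1 | h1
  · obtain ⟨f, hf1, hf2, y, hy⟩ := exists_hom_ne_zero S.prime S.pGroup S.reduced h.idem
      ⟨a, by rw [h.gen]; exact h.ne_zero⟩ (hew.sub_idem h.idem hw.1) hne
    have hef : ∀ b, e (f b) = 0 := fun b => by
      rw [← hf1 b]; simp [hew.2, h.idem (f b)]
    have h2 : ∀ b, f (e' b) = 0 := fun b => by
      rw [hf f hf1 hf2, ← h1.2, hef, map_zero]
    rcases h.dichotomy S.prime S.pGroup h'.idem (fun b => (h0 b).symm) with h3 | h3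
    · apply hy
      rw [← hf2, ← h3.1, h2]
    · apply h'.ne_zero
      rw [← h'.gen, ← h1.1, h3.2]
  · obtain ⟨f, hf1, hf2, y, hy⟩ := exists_hom_ne_zero S.prime S.pGroup S.reduced h.idem
      ⟨a, by rw [h.gen]; exact h.ne_zero⟩ h'.idem ⟨a', by rw [h'.gen]; exact h'.ne_zero⟩
    have hwf : ∀ b, (w - e) (f b) = f b := fun b => by
      rw [← hf1 b]; simp [hew'.1, h1.1]
    apply hy
    rw [← hf1, ← hf f hwf hf2, ← hf2, h1.1, map_zero]

/-- The sides of an involution `ξ` in terms of projections. -/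
theorem Setting.sameSide_iff (S : Setting p A) (hw : Rep ξ w) (h : Cyc p e a k) (hr : Rep ε e)
    (h' : Cyc p e' a' k') (hr' : Rep ε' e') (hew : Below e w) (hne : ∃ x, (w - e) x ≠ 0) :
    Commutes ε' ξ ∧ SameSide ξ ε ε' ↔ Below e' w := by
  constructor
  · rintro ⟨hc, hs⟩
    have hcomm := (hw.commutes_iff_comm S hr').mp hc.symm
    rcases h'.dichotomy S.prime S.pGroup hw.1 hcomm with h1 | h1
    · exact h1
    · exact absurd hs (S.not_sameSide hw hr hr' hew h1.1 h1.2)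
  · intro hb
    exact ⟨(hr'.commutes_iff_comm S hw).mpr fun b => by rw [hb.1, hb.2],
      S.sameSide hw h hr h' hr' hew hb hne⟩

theorem Setting.not_sameSide_iff (S : Setting p A) (hw : Rep ξ w) (h : Cyc p e a k) (hr : Rep ε e)
    (h' : Cyc p e' a' k') (hr' : Rep ε' e') (hew : Below e w) (hne : ∃ x, (w - e) x ≠ 0) :
    Commutes ε' ξ ∧ ¬ SameSide ξ ε ε' ↔ (∀ b, w (e' b) = 0) ∧ ∀ b, e' (w b) = 0 := by
  constructor
  · rintro ⟨hc, hs⟩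
    have hcomm := (hw.commutes_iff_comm S hr').mp hc.symm
    rcases h'.dichotomy S.prime S.pGroup hw.1 hcomm with h1 | h1
    · exact absurd (S.sameSide hw h hr h' hr' hew h1 hne) hs
    · exact h1
  · rintro ⟨h1, h2⟩
    exact ⟨(hr'.commutes_iff_comm S hw).mpr fun b => by rw [h1, h2],
      S.not_sameSide hw hr hr' hew h1 h2⟩

/-! #### Comparison of orders -/

/-- The product of two extreme involutions with independent cores. -/
theorem Rep.mul (hr : Rep ε e) (hr' : Rep ε' e') (h1 : ∀ b, e (e' b) = 0) (h2 : ∀ b, e' (e b) = 0) :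
    Rep (ε'.trans ε) (e + e') := by
  refine ⟨fun b => by simp [hr.1 b, hr'.1 b, h1, h2], ?_⟩
  obtain ⟨he, h | h⟩ := hr <;> obtain ⟨he', h' | h'⟩ := hr'
  · left; intro b
    rw [AddEquiv.trans_apply, h', h, map_sub, map_nsmul, h1, AddMonoidHom.add_apply]; abel
  · right; intro b
    rw [AddEquiv.trans_apply, h', h, map_sub, map_nsmul, h1, AddMonoidHom.add_apply]; abel
  · right; intro b
    rw [AddEquiv.trans_apply, h', h, map_sub, map_nsmul, h1, AddMonoidHom.add_apply]; abel
  · left; intro b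
    rw [AddEquiv.trans_apply, h', h, map_sub, map_nsmul, h1, AddMonoidHom.add_apply]; abel

theorem Setting.exists_large_cyc (S : Setting p A) {q : A →+ A} (hq : Idem q)
    (hb : ∃ n, ∀ x, p ^ n • q x = 0) (N : ℕ) :
    ∃ (k : ℕ) (c : A →+ A) (z : A), N ≤ k ∧ Cyc p c z k ∧ (∀ b, c (q b) = 0) ∧ ∀ b, q (c b) = 0 := by
  obtain ⟨n, hn⟩ := hb
  obtain ⟨k, c, z, hk, hc, hcq⟩ := exists_cyc_of_pow_ne S.prime S.pGroup S.reduced hq.compl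
    (S.exists_pow_ne_of_bounded hn N)
  exact ⟨k, c, z, hk, hc, fun b => by simpa using hcq.2 b, fun b => by simpa using hcq.1 b⟩

/-- Automorphisms `1 + f` commuting with `ε` force `u` to act as one scalar on the elements of
bounded order outside `e`, including `a'`. Because `k ≤ k'`, some `f` sends `a'` to `a`; then `1 +
f` commutes with the product and carries the scalar over to `a`. -/
theorem Setting.ordLe_of_le (S : Setting p A) (h : Cyc p e a k) (hr : Rep ε e) (h' : Cyc p e' a' k')
    (hr' : Rep ε' e') (h1 : ∀ b, e (e' b) = 0) (h2 : ∀ b, e' (e b) = 0) (hk : k ≤ k') :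
    OrdLe ε ε' := by
  intro u hu hu'
  have hF := hr.mul hr' h1 h2
  have comm1 : ∀ f : A →+ A, (∀ b, f (f b) = 0) → (∀ b, e (f b) = 0) → (∀ b, f (e b) = 0) →
      ∀ b, u (f b) = f (u b) := by
    intro f hff hef hfe b
    have := hu (unipotent f hff) ((hr.commutes_iff S).mpr fun b => by
      rw [unipotent_apply, unipotent_apply, map_add, hef, hfe]) b
    rw [unipotent_apply, unipotent_apply, map_add, add_right_inj] at this
    exact this.symm
  have comm2 : ∀ f : A →+ A, (∀ b, f (f b) = 0) → (∀ b, e (f b) = f b) → (∀ b, f (e' b) = f b) →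
      ∀ b, u (f b) = f (u b) := by
    intro f hff hef hfe b
    have he'f : ∀ b, e' (f b) = 0 := fun b => by rw [← hef, h2]
    have hfe' : ∀ b, f (e b) = 0 := fun b => by rw [← hfe, h2, map_zero]
    have := hu' (unipotent f hff) ((hF.commutes_iff S).mpr fun b => by
      simp only [unipotent_apply, map_add, AddMonoidHom.add_apply, hef, hfe, he'f, hfe']
      abel) b
    rw [unipotent_apply, unipotent_apply, map_add, add_right_inj] at this
    exact this.symm
  have hscalar : ∀ N : ℕ, ∃ s : ℤ, ∀ x, p ^ N • x = 0 → u x = s • x := by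
    intro N
    -- The cyclic summand is orthogonal to both cores. Its order exceeds `p ^ (N + k')`, so its
    -- generator can be mapped to any element killed by `p ^ N`, and to `a'`.
    obtain ⟨K, c, z, hK, hc, hc1, hc2⟩ := S.exists_large_cyc hF.1 ⟨max k k' + 1, fun x => by
      rw [AddMonoidHom.add_apply, smul_add, pow_smul_eq_zero_of_le (by omega) (h.pow_smul x),
        pow_smul_eq_zero_of_le (by omega) (h'.pow_smul x), add_zero]⟩ (N + k')
    have hce : ∀ b, c (e b) = 0 := fun b => by
      have := hc1 (e b)
      rwa [AddMonoidHom.add_apply, h.idem, h2, add_zero] at this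
    have hec : ∀ b, e (c b) = 0 := fun b => by
      have := congrArg e (hc2 b)
      rwa [AddMonoidHom.add_apply, map_add, h.idem, h1, add_zero, map_zero] at this
    have huc : ∀ b, u (c b) = c (u b) := fun b => by
      have := hu (mkInv c hc.idem) (((rep_mkInv hc.idem).commutes_iff_comm S hr).mpr fun b => by
        rw [hce, hec])
      exact ((rep_mkInv hc.idem).commutes_iff S).mp this.symm b
    obtain ⟨s, hs⟩ := hc.span (u z)
    rw [← huc, hc.gen] at hs
    have hout : ∀ y, e y = 0 → p ^ (N + k' + 1) • y = 0 → u y = s • y := by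
      intro y hy hNy
      have hcy : u (c y) = s • c y := by
        obtain ⟨t, ht⟩ := hc.span y
        rw [ht, map_zsmul, hs, smul_comm]
      have hy' : u (y - c y) = s • (y - c y) := by
        obtain ⟨f, hfz, hfc, hfs⟩ := hc.exists_hom S.prime S.pGroup (y := y - c y) (by
          apply pow_smul_eq_zero_of_le (m := N + k' + 1) (by omega)
          rw [smul_sub, ← map_nsmul c, hNy, map_zero, sub_zero])
        have hcf : ∀ b, c (f b) = 0 := fun b => by
          obtain ⟨t, ht⟩ := hfs b
          rw [ht, map_zsmul, map_sub, hc.idem, sub_self, smul_zero]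
        have hef : ∀ b, e (f b) = 0 := fun b => by
          obtain ⟨t, ht⟩ := hfs b
          rw [ht, map_zsmul, map_sub, hy, hec, sub_zero, smul_zero]
        have hff : ∀ b, f (f b) = 0 := fun b => by rw [← hfc, hcf, map_zero]
        have := comm1 f hff hef (fun b => by rw [← hfc, hce, map_zero]) z
        rw [hs, map_zsmul, hfz] at this
        exact this
      have : y = c y + (y - c y) := by abel
      conv_lhs => rw [this]
      rw [map_add, hcy, hy', ← smul_add, ← this]
    refine ⟨s, fun x hx => ?_⟩
    have hua' : u a' = s • a' := hout a' (by rw [← h'.gen, h1])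
      (pow_smul_eq_zero_of_le (by omega) h'.zero)
    have hua : u a = s • a := by
      obtain ⟨f, hfa, hfe, hfs⟩ := h'.exists_hom S.prime S.pGroup (y := a)
        (pow_smul_eq_zero_of_le (by omega) h.zero)
      have hef : ∀ b, e (f b) = f b := fun b => by
        obtain ⟨t, ht⟩ := hfs b
        rw [ht, map_zsmul, h.gen]
      have hff : ∀ b, f (f b) = 0 := fun b => by rw [← hfe, ← hef b, h2, map_zero]
      have := comm2 f hff hef hfe a'
      rw [hua', map_zsmul, hfa] at this
      exact this
    have hex : u (e x) = s • e x := by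
      obtain ⟨t, ht⟩ := h.span x
      rw [ht, map_zsmul, hua, smul_comm]
    have hxe : u (x - e x) = s • (x - e x) := hout _ (by rw [map_sub, h.idem, sub_self])
      (pow_smul_eq_zero_of_le (m := N) (by omega) (by rw [smul_sub, ← map_nsmul, hx, map_zero, sub_zero]))
    have : x = e x + (x - e x) := by abel
    conv_lhs => rw [this]
    rw [map_add, hex, hxe, ← smul_add, ← this]
  intro g x
  obtain ⟨N, hN⟩ := S.pGroup x
  obtain ⟨s, hs⟩ := hscalar N
  rw [hs x hN, hs (g x) (by rw [← map_nsmul, hN, map_zero]), map_zsmul]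

/-- If `k' < k`, take `u = 1 + p ^ (k' + 1) e`. It commutes with the centralizer of `ε`, and also
with that of the product, because `p ^ (k' + 1)` kills `e'` and so does not distinguish `e` from `e
+ e'`. A homomorphism from `e` into a larger cyclic summand shows that `u` is not central. -/
theorem Setting.le_of_ordLe (S : Setting p A) (h : Cyc p e a k) (hr : Rep ε e) (h' : Cyc p e' a' k')
    (hr' : Rep ε' e') (h1 : ∀ b, e (e' b) = 0) (h2 : ∀ b, e' (e b) = 0) (hle : OrdLe ε ε') :
    k ≤ k' := by
  by_contra hlt
  have hF := hr.mul hr' h1 h2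
  let q : AddMonoid.End A := (p ^ (k' + 1)) • e
  have hq : ∀ b, q b = p ^ (k' + 1) • e b := fun b => rfl
  have hnil : IsNilpotent q := by
    have hpow : ∀ n, ∀ b, (q ^ (n + 1)) b = p ^ ((k' + 1) * (n + 1)) • e b := by
      intro n
      induction n with
      | zero => intro b; simp [hq]
      | succ n ih =>
        intro b
        rw [pow_succ]
        change (q ^ (n + 1)) (q b) = _
        rw [ih, hq, map_nsmul, h.idem, ← mul_smul, ← pow_add]
        congr 2
    refine ⟨k + 1, ?_⟩
    ext b
    rw [hpow]
    exact pow_smul_eq_zero_of_le (Nat.le_mul_of_pos_left _ (by omega)) (h.pow_smul b)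
  obtain ⟨U, hU⟩ := hnil.isUnit_one_add
  have hUb : ∀ b, (U : AddMonoid.End A) b = b + p ^ (k' + 1) • e b := fun b => by rw [hU]; rfl
  let u : A ≃+ A :=
    { toFun := (U : AddMonoid.End A)
      invFun := ((U⁻¹ : (AddMonoid.End A)ˣ) : AddMonoid.End A)
      left_inv := fun b => DFunLike.congr_fun (Units.inv_mul U) b
      right_inv := fun b => DFunLike.congr_fun (Units.mul_inv U) b
      map_add' := map_add _ }
  have hu : ∀ b, u b = b + p ^ (k' + 1) • e b := hUb
  have hcen := hle u
    (fun g hg b => by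
      rw [hr.commutes_iff S] at hg
      rw [hu, hu, map_add, map_nsmul, hg])
    (fun g hg b => by
      rw [hF.commutes_iff S] at hg
      have hpe : ∀ b, p ^ (k' + 1) • e b = p ^ (k' + 1) • (e + e') b := fun b => by
        rw [AddMonoidHom.add_apply, smul_add, h'.pow_smul, add_zero]
      rw [hu, hu, map_add, hpe, hpe, map_nsmul, hg])
  obtain ⟨K, c, z, hK, hc, hce, hec⟩ := S.exists_large_cyc h.idem ⟨k + 1, h.pow_smul⟩ k
  obtain ⟨f, hfa, hfe, hfs⟩ := h.exists_hom S.prime S.pGroup (y := p ^ (K - k) • z) (by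
    rw [← mul_smul, ← pow_add]
    exact pow_smul_eq_zero_of_le (by omega) hc.zero)
  have hez : e z = 0 := by rw [← hc.gen, hec]
  have hef : ∀ b, e (f b) = 0 := fun b => by
    obtain ⟨t, ht⟩ := hfs b
    rw [ht, map_zsmul, map_nsmul, hez, smul_zero, smul_zero]
  have hff : ∀ b, f (f b) = 0 := fun b => by rw [← hfe, hef, map_zero]
  have := hcen (unipotent f hff) a
  rw [unipotent_apply, unipotent_apply, hu, hu, map_add, map_nsmul, map_add, hef, h.gen, add_zero, hfa]
    at this
  have h0 : p ^ (k' + 1) • p ^ (K - k) • z = 0 := by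
    have h3 : a + p ^ (k' + 1) • a + (p ^ (K - k) • z + p ^ (k' + 1) • p ^ (K - k) • z) =
      a + p ^ (k' + 1) • a + p ^ (K - k) • z := by rw [this]; abel
    rwa [add_right_inj, _root_.add_eq_left] at h3
  apply hc.ne
  rw [← mul_smul, ← pow_add] at h0
  exact pow_smul_eq_zero_of_le (by omega) h0

/-- The product of two involutions with the same projection is `1` or `-1`, so its centralizer is
everything. -/
theorem Rep.ordLe (hr : Rep ε e) (hr' : Rep ε' e) : OrdLe ε ε' := by
  have hs : ∃ t : ℤ, ∀ b, ε'.trans ε b = t • b := by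
    obtain ⟨he, h | h⟩ := hr <;> obtain ⟨-, h' | h'⟩ := hr'
    · exact ⟨1, fun b => by rw [AddEquiv.trans_apply, h', h, map_sub, map_nsmul, he]; abel⟩
    · exact ⟨-1, fun b => by rw [AddEquiv.trans_apply, h', h, map_sub, map_nsmul, he]; abel⟩
    · exact ⟨-1, fun b => by rw [AddEquiv.trans_apply, h', h, map_sub, map_nsmul, he]; abel⟩
    · exact ⟨1, fun b => by rw [AddEquiv.trans_apply, h', h, map_sub, map_nsmul, he]; abel⟩
  obtain ⟨t, ht⟩ := hs
  exact fun u _ hu' g => hu' g (central_of_scalar ht g)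

theorem Cyc.eq_or_orthogonal (hp : p.Prime) (hA : IsAbelianPGroup p A) (h : Cyc p e a k)
    (h' : Cyc p e' a' k') (hc : ∀ b, e (e' b) = e' (e b)) :
    e' = e ∨ (∀ b, e (e' b) = 0) ∧ ∀ b, e' (e b) = 0 := by
  rcases h'.dichotomy hp hA h.idem hc with h1 | h1
  · rcases h.dichotomy hp hA h'.idem (fun b => (hc b).symm) with h2 | h2
    · left
      ext b
      rw [← h2.1, h1.2]
    · exact Or.inr ⟨h2.2, h2.1⟩
  · exact Or.inr h1

/-- If `w = e`, every automorphism commuting with `ξ` commutes with `ε`, and no conjugate of `ε`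
differs from it. -/
theorem Setting.exists_sub_ne_of_sameSide (S : Setting p A) (hr : Rep ε e) (hw : Rep ξ w)
    (hs : SameSide ξ ε ε) : ∃ x, (w - e) x ≠ 0 := by
  by_contra! hcon
  have hwe : w = e := by
    ext x
    simpa [sub_eq_zero] using hcon x
  obtain ⟨g, hg, hn⟩ := hs
  rw [hw.commutes_iff S, hwe] at hg
  apply hn
  rw [(hr.conj g).commutes_iff_comm S hr]
  have hge : ∀ b, conjHom g e b = e b := fun b => by
    rw [conjHom_apply, hg, AddEquiv.apply_symm_apply]
  intro b
  rw [hge, hge]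

theorem Setting.exists_sub_ne (S : Setting p A) (h : Cyc p e a k) {n : ℕ}
    (hb : ∀ x, p ^ n • (x - w x) = 0) : ∃ x, (w - e) x ≠ 0 := by
  obtain ⟨x, hx⟩ := S.exists_pow_ne hb (k + 1)
  refine ⟨x, fun h0 => hx ?_⟩
  rw [AddMonoidHom.sub_apply, sub_eq_zero] at h0
  rw [h0, h.pow_smul]

/-- The argument of `Setting.byOrd_iff`, except that the test involutions must commute with `ε`.
Divisibility is therefore obtained on `w - e` only, and added to that of the cyclic group itself. -/
theorem Setting.groupByOrd_iff (S : Setting p A) (h : Cyc p e a m) (hr : Rep ε e) (hw : Rep ξ w)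
    (hew : Below e w) : GroupByOrd ξ ε ↔ (∀ x, p ^ m • (x - w x) = 0) ∧ SocleDiv p w m := by
  constructor
  · intro hB
    have hne := S.exists_sub_ne_of_sameSide hr hw ((hB ε (S.groupExtreme_of_cyc h hr)
      ((hr.commutes_iff_comm S hw).mpr fun b => by rw [hew.1, hew.2]) (fun _ => rfl)).mpr
      (hr.ordLe hr))
    constructor
    · by_contra! hcon
      obtain ⟨x, hx⟩ := hcon
      obtain ⟨k, e', a', hmk, he', hb⟩ := exists_cyc_of_pow_ne S.prime S.pGroup S.reduced hw.1.compl
        (n := m) ⟨x, by simpa using hx⟩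
      have h1 : ∀ b, w (e' b) = 0 := fun b => by simpa using hb.1 b
      have h2 : ∀ b, e' (w b) = 0 := fun b => by simpa using hb.2 b
      have h3 : ∀ b, e (e' b) = 0 := fun b => by rw [← hew.2, h1, map_zero]
      have h4 : ∀ b, e' (e b) = 0 := fun b => by rw [← hew.1, h2]
      have hr' := rep_mkInv he'.idem
      exact S.not_sameSide hw hr hr' hew h1 h2 ((hB _ (S.groupExtreme_of_cyc he' hr')
        ((hr'.commutes_iff_comm S hw).mpr fun b => by rw [h1, h2])
        ((hr'.commutes_iff_comm S hr).mpr fun b => by rw [h3, h4])).mpr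
        (S.ordLe_of_le h hr he' hr' h3 h4 hmk))
    · have hsoc : SocleDiv p (w - e) m := by
        by_contra hcon
        obtain ⟨k, e', a', hkm, he', hb⟩ := exists_cyc_of_not_socleDiv S.prime S.pGroup
          (hew.sub_idem h.idem hw.1) hcon
        have h3 : ∀ b, e (e' b) = 0 := fun b => by
          rw [← hb.1]; simp [hew.2, h.idem (e' b)]
        have h4 : ∀ b, e' (e b) = 0 := fun b => by
          rw [← hb.2]; simp [hew.1, h.idem b]
        have hbw := hb.trans (hew.sub hw.1)
        have hr' := rep_mkInv he'.idem
        have hle := (hB _ (S.groupExtreme_of_cyc he' hr')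
          ((hr'.commutes_iff_comm S hw).mpr fun b => by rw [hbw.1, hbw.2])
          ((hr'.commutes_iff_comm S hr).mpr fun b => by rw [h3, h4])).mp
          (S.sameSide hw h hr he' hr' hew hbw hne)
        exact absurd (S.le_of_ordLe h hr he' hr' h3 h4 hle) (not_le.mpr hkm)
      intro x hx hpx
      obtain ⟨y, hy⟩ := h.socleDiv S.prime S.pGroup (e x) (h.idem x) (by rw [← map_nsmul, hpx, map_zero])
      obtain ⟨z, hz⟩ := hsoc ((w - e) x) (hew.sub_idem h.idem hw.1 x)
        (by rw [← map_nsmul, hpx, map_zero])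
      exact ⟨y + z, by rw [smul_add, hy, hz, AddMonoidHom.sub_apply, hx]; abel⟩
  · rintro ⟨hb, hs⟩ ε' hε' hcξ hcε
    obtain ⟨e', a', k, he', hr'⟩ := S.exists_cyc_of_groupExtreme hε'
    have hne := S.exists_sub_ne h hb
    rcases h.eq_or_orthogonal S.prime S.pGroup he' ((hr.commutes_iff_comm S hr').mp hcε.symm) with
      rfl | ⟨h3, h4⟩
    · exact ⟨fun _ => hr.ordLe hr', fun _ => S.sameSide hw h hr he' hr' hew hew hne⟩
    · have hside := S.sameSide_iff hw h hr he' hr' hew hne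
      rcases he'.dichotomy S.prime S.pGroup hw.1 ((hw.commutes_iff_comm S hr').mp hcξ.symm) with h1 | h1
      · exact ⟨fun _ => S.ordLe_of_le h hr he' hr' h3 h4 (he'.le_of_socleDiv h1 hs),
          fun _ => (hside.mpr h1).2⟩
      · refine ⟨fun h2 => absurd h2 (S.not_sameSide hw hr hr' hew h1.1 h1.2), fun h2 => ?_⟩
        have hlt : k < m := he'.lt_of_bounded (w := AddMonoidHom.id A - w)
          ⟨fun b => by simp [h1.1], fun b => by simp [h1.2]⟩ (by simpa using hb)
        exact absurd (S.le_of_ordLe h hr he' hr' h3 h4 h2) (not_le.mpr hlt)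

end Meaning

/-! ### Coupled extreme involutions and the group-theoretic form of `Final` -/

section Coupling

variable {p : ℕ} {A : Type u} [AddCommGroup A]

theorem exists_fiber_gt {κ : Cardinal.{u}} (hκ : ℵ₀ ≤ κ) {α β : Type u} (f : β → α) (hα : #α ≤ κ)
    (hβ : κ < #β) : ∃ y, κ < #(f ⁻¹' {y}) := by
  by_contra! hcon
  apply absurd hβ (not_lt.mpr _)
  rw [← mk_congr (Equiv.sigmaFiberEquiv f), mk_sigma]
  calc sum (fun y => #{x // f x = y}) ≤ sum fun _ : α => κ := sum_le_sum _ _ hcon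
    _ = #α * κ := sum_const' α κ
    _ ≤ κ * κ := mul_le_mul_left hα κ
    _ = κ := mul_eq_self hκ

/-- In a large bounded group `D`, a homomorphism `g` to a small group is, on suitable elements that
a fixed projection maps to the generator of a cyclic summand, divisible by every power of `p`. -/
theorem Setting.exists_cyc_divisible (S : Setting p A) {δ π g : A →+ A} {k : ℕ} (hδ : Idem δ)
    (hδk : ∀ x, p ^ k • δ x = 0) {s : Set δ.range} (hs : IsPBase p s) {κ : Cardinal.{u}}
    (hκ : ℵ₀ ≤ κ) (hcard : κ < #s) (hP : layerCard p 0 π.range ≤ κ) {T : Set A} (hT : #T ≤ κ)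
    (hg : ∀ x, ∃ y, g x = π y) :
    ∃ (b : A →+ A) (d : A) (l : ℕ), Cyc p b d l ∧ Below b δ ∧ (∀ c : ℤ, c • d ∈ T → c • d = 0) ∧
      ∀ j, ∃ v, δ v = v ∧ b v = d ∧ ∃ z, g v = p ^ j • z := by
  classical
  have hD := S.pGroup.subgroup δ.range
  have hord : ∀ d : s, ∃ l, p ^ l • (d : δ.range) ≠ 0 ∧ p ^ (l + 1) • (d : δ.range) = 0 := fun d =>
    hD.exists_order fun h0 => hs.zero_notMem (h0 ▸ d.2)
  choose o ho ho' using hord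
  set R : Set δ.range := {d ∈ s | ∃ c : ℤ, c • d ∈ Subtype.val ⁻¹' T ∧ c • d ≠ 0} with hR
  have hRκ : #R ≤ κ := mk_meeting_le hD hs.pureIndep
    ((mk_preimage_of_injective Subtype.val T Subtype.val_injective).trans hT)
  have hdiff : ∀ X Y : Set δ.range, κ < #X → #Y ≤ κ → κ < #(X \ Y : Set δ.range) := by
    intro X Y hX hY
    by_contra hle
    refine absurd hX (not_lt.mpr ((le_mk_sdiff_add_mk X Y).trans ?_))
    exact (add_le_add (not_lt.mp hle) hY).trans (add_eq_self hκ).le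
  -- There are countably many orders, so more than `κ` of the unspoiled basis elements share one.
  obtain ⟨⟨l⟩, hl⟩ := exists_fiber_gt hκ (β := (s \ R : Set δ.range))
    (fun d => ULift.up.{u} (o ⟨d, d.2.1⟩)) (by simpa using hκ) (hdiff s R hcard hRκ)
  set J : Set δ.range := {d | ∃ h : d ∈ s \ R, o ⟨d, h.1⟩ = l} with hJ
  have hJκ : κ < #J := by
    refine hl.trans_le (mk_le_of_injective (f := fun d => (⟨d.1.1, d.1.2, by
      simpa using congrArg ULift.down d.2⟩ : J)) ?_)
    intro d d' h
    exact Subtype.ext (Subtype.ext (congrArg (fun t : J => (t : δ.range)) h))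
  have hJs : ∀ d ∈ J, d ∈ s := fun d hd => hd.1.1
  have hJne : ∀ d ∈ J, p ^ l • d ≠ 0 := by
    rintro d ⟨hd, rfl⟩
    exact ho ⟨d, hd.1⟩
  have hJ0 : ∀ d ∈ J, p ^ (l + 1) • d = 0 := by
    rintro d ⟨hd, rfl⟩
    exact ho' ⟨d, hd.1⟩
  obtain ⟨d₀, hd₀⟩ : J.Nonempty := by
    rw [Set.nonempty_iff_ne_empty]
    rintro h0
    rw [h0, mk_eq_zero] at hJκ
    exact not_lt_zero hJκ
  let γ : δ.range → π.range := fun d => ⟨g d, by obtain ⟨y, hy⟩ := hg d; exact ⟨y, hy.symm⟩⟩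
  -- The range of `π` modulo `p ^ n` has at most `κ` elements, so outside any finite set two
  -- elements of `J` have images congruent modulo `p ^ n`.
  have hpair : ∀ (F : Finset δ.range) (n : ℕ), ∃ x y, x ∈ J ∧ y ∈ J ∧ x ∉ F ∧ y ∉ F ∧ x ≠ y ∧
      ∃ z : A, g (x - y : δ.range) = p ^ n • z := by
    intro F n
    have hJF := hdiff J F hJκ ((mk_lt_aleph0 (α := F)).le.trans hκ)
    have hq := mk_quotient_pow_le S.prime (S.pGroup.subgroup π.range) hκ hP n
    obtain ⟨⟨x, hx⟩, ⟨y, hy⟩, hxy, hne⟩ := Function.not_injective_iff.mp fun hinj =>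
      absurd (hJF.trans_le (mk_le_of_injective (f := fun d : (J \ F : Set δ.range) =>
        (γ d : π.range ⧸ (nsmulAddMonoidHom (p ^ n) : π.range →+ π.range).range)) hinj))
        (not_lt.mpr hq)
    obtain ⟨z, hz⟩ := QuotientAddGroup.eq.mp hxy.symm
    refine ⟨x, y, hx.1, hy.1, hx.2, hy.2, fun h => hne (Subtype.ext h), z, ?_⟩
    have hz := congrArg Subtype.val hz
    simp only [nsmulAddMonoidHom_apply, AddSubgroup.coe_nsmul, AddSubgroup.coe_add,
      AddSubgroup.coe_neg, γ] at hz
    rw [hz, AddSubgroup.coe_sub, map_sub]; abel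
  obtain ⟨q, hqP, hqr⟩ := exists_seq_of_forall_finset_exists
    (fun t : ℕ × δ.range × δ.range => t.2.1 ∈ J ∧ t.2.2 ∈ J ∧ t.2.2 ≠ d₀ ∧ t.2.1 ≠ t.2.2 ∧
      ∃ z : A, g (t.2.1 - t.2.2 : δ.range) = p ^ t.1 • z)
    (fun t t' => t.1 < t'.1 ∧ t'.2.2 ≠ t.2.1 ∧ t'.2.1 ≠ t.2.2)
    (by
      intro F _
      obtain ⟨x, y, hx, hy, hxF, hyF, hxy, hz⟩ := hpair
        (insert d₀ (F.image (fun t => t.2.1) ∪ F.image (fun t => t.2.2))) (F.sup (fun t => t.1) + 1)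
      simp only [Finset.mem_insert, Finset.mem_union, Finset.mem_image, not_or, not_exists,
        not_and] at hxF hyF
      refine ⟨⟨_, x, y⟩, ⟨hx, hy, hyF.1, hxy, hz⟩, fun t ht => ⟨?_, ?_, ?_⟩⟩
      · exact Nat.lt_succ_of_le (Finset.le_sup (f := fun t : ℕ × δ.range × δ.range => t.1) ht)
      · exact fun h => hyF.2.1 t ht h.symm
      · exact fun h => hxF.2.2 t ht h.symm)
  have hqn : ∀ n, n ≤ (q n).1 := by
    intro n
    induction n with
    | zero => exact Nat.zero_le _
    | succ n ih => exact Nat.succ_le_of_lt (ih.trans_lt (hqr n (n + 1) n.lt_succ_self).1)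
  have hsep : ∀ i j, (q i).2.2 ≠ (q j).2.1 := by
    intro i j
    rcases lt_trichotomy i j with h | h | h
    · exact fun h' => (hqr i j h).2.2 h'.symm
    · rw [h]; exact (hqP j).2.2.2.1.symm
    · exact (hqr j i h).2.1
  have hkD : ∀ x : δ.range, p ^ k • x = 0 := by
    rintro ⟨_, x, rfl⟩
    exact Subtype.ext (by simpa using hδk x)
  set u : AddSubgroup.zmultiples d₀ := ⟨d₀, AddSubgroup.mem_zmultiples d₀⟩ with hu
  -- The projection sends `d₀` and the first member of each chosen pair to `d₀`, and every other
  -- basis element to 0. No second member is a first one or `d₀`, so each difference goes to `d₀`,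
  -- while its image under `g` is highly divisible.
  obtain ⟨h, hh⟩ := hs.exists_hom (D := AddSubgroup.zmultiples d₀) (k := k)
    (fun x => Subtype.ext (by simpa using hkD x))
    (fun d => if d = d₀ ∨ ∃ i, d = (q i).2.1 then u else 0)
    (by
      intro d _ c hc
      split_ifs with hd
      · have hdJ : d ∈ J := by
          rcases hd with rfl | ⟨i, rfl⟩
          · exact hd₀
          · exact (hqP i).1
        obtain ⟨t, rfl⟩ := pow_dvd_of_smul_eq_zero S.prime hD (hJne d hdJ) hc
        apply Subtype.ext
        rw [AddSubgroup.coe_zsmul, mul_comm, mul_smul, ← Nat.cast_pow, natCast_zsmul, hJ0 d₀ hd₀, smul_zero]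
        rfl
      · simp)
  have hcyc : Cyc p ((AddSubgroup.zmultiples d₀).subtype.comp h) d₀ l := by
    refine ⟨?_, hJne d₀ hd₀, hJ0 d₀ hd₀, fun x => ?_⟩
    · rw [AddMonoidHom.comp_apply, hh d₀ (hJs d₀ hd₀), if_pos (Or.inl rfl)]; rfl
    · obtain ⟨c, hc⟩ := (h x).2
      exact ⟨c, hc.symm⟩
  obtain ⟨b, hb, hbδ, hbx⟩ := hcyc.extend hδ
  refine ⟨b, d₀, l, hb, hbδ, fun c hc => ?_, fun j => ?_⟩
  · by_contra hne
    exact hd₀.1.2 ⟨hJs d₀ hd₀, c, by simpa using hc, fun h0 => hne (by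
      simpa using congrArg Subtype.val h0)⟩
  · obtain ⟨ha, hb', hbd, hab, z, hz⟩ := hqP j
    refine ⟨((q j).2.1 - (q j).2.2 : δ.range), hδ.mem_range.mp (Subtype.prop _), ?_,
      p ^ ((q j).1 - j) • z, ?_⟩
    · have h1 : h (q j).2.1 = u := by rw [hh _ (hJs _ ha), if_pos (Or.inr ⟨j, rfl⟩)]
      have h2 : h (q j).2.2 = 0 := by
        rw [hh _ (hJs _ hb'), if_neg]
        rintro (h' | ⟨i, h'⟩)
        · exact hbd h'
        · exact hsep j i h'
      rw [hbx, AddMonoidHom.comp_apply, map_sub, h1, h2, sub_zero]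
      rfl
    · rw [hz, ← mul_smul, ← pow_add, Nat.add_sub_cancel' (hqn j)]

variable {ξ ε ε' f : A ≃+ A} {w e b π δ : A →+ A} {a d x : A} {m k l j : ℕ}

theorem Setting.couples_unipotent (S : Setting p A) {h : A →+ A} (hh : ∀ x, h (h x) = 0)
    (hc : Cyc p e x j) (hr : Rep ε e) (hb : Cyc p b d l) (hrb : Rep ε' b) (hhx : h x = d)
    (heh : ∀ y, e (h y) = 0) (heb : ∀ y, e (b y) = 0) (hbe : ∀ y, b (e y) = 0) :
    Couples (unipotent h hh) ε ε' := by
  have hT : ∀ y, conjHom (unipotent h hh) e y = e y + h (e y) := fun y => by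
    rw [conjHom_apply, unipotent_apply, unipotent_symm_apply, map_sub, heh, sub_zero]
  have hbh : ∀ y, b (h (e y)) = h (e y) := fun y => by
    obtain ⟨c, hc⟩ := hc.span y
    rw [hc, map_zsmul, hhx, map_zsmul, hb.gen]
  constructor
  · rw [(hr.conj _).commutes_iff_comm S (hr.mul hrb heb hbe)]
    intro y
    simp only [hT, AddMonoidHom.add_apply, map_add, hc.idem y, heb, heh, hbe, hbh, map_zero]
    abel
  · rw [(hr.conj _).commutes_iff_comm S hrb]
    intro hcom
    have := hcom x
    rw [hT, hT, heb, map_zero, add_zero, map_add, hbe, hbh, hc.gen, hhx, zero_add] at this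
    exact hb.ne_zero this.symm

/-- Let `T` be the conjugate of `e`. If it commutes with `e + b`, it is orthogonal to it or below
it. In the second case `hT` yields `b T = 0`, and `hv` yields `T b = 0`: on a suitable lift `v` of
`d`, a high power of `p` kills the cyclic value. Either way `T` commutes with `b`. -/
theorem Setting.not_couples (S : Setting p A) (hc : Cyc p e x j) (hr : Rep ε e) (hb : Cyc p b d l)
    (hrb : Rep ε' b) (heπ : Below e π) (hbδ : Below b δ) (hπδ : ∀ y, π (δ y) = 0)
    (hδπ : ∀ y, δ (π y) = 0) (hT : ∀ (c : ℤ) (y : A), c • d = δ (f (π y)) → c • d = 0)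
    (hv : ∀ j, ∃ v, δ v = v ∧ b v = d ∧ ∃ z, π (f.symm v) = p ^ j • z) : ¬ Couples f ε ε' := by
  rintro ⟨h1, h2⟩
  have heδ : ∀ y, e (δ y) = 0 := fun y => by rw [← heπ.2, hπδ, map_zero]
  have hδe : ∀ y, δ (e y) = 0 := fun y => by rw [← heπ.1, hδπ]
  have heb : ∀ y, e (b y) = 0 := fun y => by rw [← hbδ.1, heδ]
  have hbe : ∀ y, b (e y) = 0 := fun y => by rw [← hbδ.2, hδe, map_zero]
  have hF := hr.mul hrb heb hbe
  rw [(hr.conj f).commutes_iff_comm S hF] at h1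
  rw [(hr.conj f).commutes_iff_comm S hrb] at h2
  apply h2
  have hFb : ∀ y, (e + b) (b y) = b y := fun y => by rw [AddMonoidHom.add_apply, heb, hb.idem, zero_add]
  have hbF : ∀ y, b ((e + b) y) = b y := fun y => by
    rw [AddMonoidHom.add_apply, map_add, hbe, hb.idem, zero_add]
  rcases (hc.conj f).dichotomy S.prime S.pGroup hF.1 (fun y => (h1 y).symm) with h3 | h3
  · have hfx : e (f x) + b (f x) = f x := by
      have := h3.1 (f x)
      rwa [(hc.conj f).gen] at this
    have hbfx : b (f x) = 0 := by
      obtain ⟨c, hcd⟩ := hb.span (f x)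
      rw [hcd]
      refine hT c x ?_
      have hπx : π x = x := by rw [← hc.gen, heπ.1]
      have hδf := congrArg δ hfx
      rw [map_add, hδe, zero_add, hbδ.1] at hδf
      rw [← hcd, hπx, hδf]
    have hTd : conjHom f e d = 0 := by
      -- Since `e v = 0`, `T d = T (e v + b v) = T v`. The exponent `j + 1` is the one that kills
      -- the range of `e`.
      obtain ⟨v, hδv, hbv, z, hz⟩ := hv (j + 1)
      rw [← hbv]
      have hev : e v = 0 := by rw [← hδv, heδ]
      have := h3.2 v
      rw [AddMonoidHom.add_apply, hev, zero_add] at this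
      rw [this, conjHom_apply, ← heπ.2, hz, map_nsmul, hc.pow_smul, map_zero]
    intro y
    obtain ⟨c, hcd⟩ := hb.span y
    obtain ⟨c', hcd'⟩ := (hc.conj f).span y
    rw [hcd, map_zsmul, hTd, hcd', map_zsmul, hbfx, smul_zero, smul_zero]
  · intro y
    rw [← hFb, h3.2, ← hbF, h3.1, map_zero]

/-! #### The condition `Final` in the group `Aut A` -/

/-- Here `ξ₁` commutes with `ξ`, so `v w` is a projection, and the upper and lower involutions are
those below `v w` and below `w - v w`. The automorphism is again `1 + φ`. -/
theorem IsFinalProj.groupFinal (S : Setting p A) (h : Cyc p e a m) (hr : Rep ε e) (hξ : Rep ξ w)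
    (hew : Below e w) (hw : IsFinalProj p w m) : GroupFinal ξ ε := by
  obtain ⟨hinv, hE, hcom⟩ := S.pair_of_below h hr hξ hew
  refine ⟨hinv, S.groupExtreme_of_extreme hE, hcom,
    (S.groupByOrd_iff h hr hξ hew).mpr ⟨hw.bounded, hw.socle⟩, fun ξ₁ ε₁ hξ₁ hcξ hup hlow => ?_⟩
  obtain ⟨hε₁, hc₀, hc₁, hs₀, hs₁⟩ := hup
  obtain ⟨e₁, a₁, k, he₁, hr₁⟩ := S.exists_cyc_of_groupExtreme hε₁
  obtain ⟨v, hv, hev⟩ := S.exists_rep_above he₁ hr₁ hξ₁ hc₁.symm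
  have hne := S.exists_sub_ne h hw.bounded
  have hne₁ := S.exists_sub_ne_of_sameSide hr₁ hv hs₁
  have he₁w : Below e₁ w := (S.sameSide_iff hξ h hr he₁ hr₁ hew hne).mp ⟨hc₀, hs₀⟩
  have hvw : ∀ y, v (w y) = w (v y) := (hv.commutes_iff_comm S hξ).mp hcξ
  have hπ : Idem (v.comp w) := fun y => by simp [← hvw, hv.1 (w y), hw.idem y]
  have hπw : Below (v.comp w) w :=
    ⟨fun y => by simp [← hvw, hw.idem y], fun y => by simp [hw.idem y]⟩
  have hπv : Below (v.comp w) v :=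
    ⟨fun y => by simp [hv.1 (w y)], fun y => by simp [← hvw, hv.1 (w y)]⟩
  have hvδ : ∀ y, v ((w - v.comp w) y) = 0 := fun y => by simp [hv.1 (w y)]
  have hδv : ∀ y, (w - v.comp w) (v y) = 0 := fun y => by simp [← hvw, hv.1 (w y)]
  have hδ := hπw.sub_idem hπ hw.idem
  have hδw := hπw.sub hw.idem
  have hupper : ∀ {c : A →+ A} {x : A} {j : ℕ} {η : A ≃+ A}, Cyc p c x j → Rep η c →
      Below c (v.comp w) → LiesUpper ξ ε ξ₁ ε₁ η := by
    intro c x j η hc hη hcπ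
    obtain ⟨h1, h2⟩ := (S.sameSide_iff hξ h hr hc hη hew hne).mpr (hcπ.trans hπw)
    obtain ⟨h3, h4⟩ := (S.sameSide_iff hv he₁ hr₁ hc hη hev hne₁).mpr (hcπ.trans hπv)
    exact ⟨S.groupExtreme_of_cyc hc hη, h1, h3, h2, h4⟩
  have hlower : ∀ {c : A →+ A} {x : A} {j : ℕ} {η : A ≃+ A}, Cyc p c x j → Rep η c →
      Below c (w - v.comp w) → LiesLower ξ ε ξ₁ ε₁ η := by
    intro c x j η hc hη hcδ
    obtain ⟨h1, h2⟩ := (S.sameSide_iff hξ h hr hc hη hew hne).mpr (hcδ.trans hδw)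
    obtain ⟨h3, h4⟩ := (S.not_sameSide_iff hv he₁ hr₁ hc hη hev hne₁).mpr
      ⟨fun y => by rw [← hcδ.1, hvδ], fun y => by rw [← hcδ.2, hδv, map_zero]⟩
    exact ⟨S.groupExtreme_of_cyc hc hη, h1, h3, h2, h4⟩
  -- The bound `OrdLe b ε₁` on lower involutions replaces `ByOrd` for the smaller pair. It allows
  -- orders up to `p ^ (k + 1)`, hence the exponent `k + 1`.
  have hbd : ∀ y, p ^ (k + 1) • (w - v.comp w) y = 0 := by
    by_contra! hcon
    obtain ⟨j, c, x, hj, hc, hcδ⟩ := exists_cyc_of_pow_ne S.prime S.pGroup S.reduced hδ hcon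
    have hrc := rep_mkInv hc.idem
    have := S.le_of_ordLe hc hrc he₁ hr₁ (fun y => by rw [← hcδ.2, ← hev.1, hδv, map_zero])
      (fun y => by rw [← hcδ.1, ← hev.2, hvδ, map_zero]) (hlow _ (hlower hc hrc hcδ))
    omega
  obtain ⟨φ, hφδ, hφπ, hφ⟩ := hw.exists_hom S hπ hπw hbd
  have hφφ : ∀ y, φ (φ y) = 0 := fun y => by
    rw [← hφπ, AddMonoidHom.comp_apply, hvw, ← hφδ y, hvδ, map_zero, map_zero]
  refine ⟨unipotent φ hφφ, fun η hη => ?_⟩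
  obtain ⟨hη, hη₀, hη₁, hηs₀, hηs₁⟩ := hη
  obtain ⟨b, d, l, hb, hrb⟩ := S.exists_cyc_of_groupExtreme hη
  have hbw := (S.sameSide_iff hξ h hr hb hrb hew hne).mp ⟨hη₀, hηs₀⟩
  have hbv := (S.not_sameSide_iff hv he₁ hr₁ hb hrb hev hne₁).mp ⟨hη₁, hηs₁⟩
  obtain ⟨x, c, j, hc, hcπ, hx⟩ := hφ d (by
    rw [← hb.gen, AddMonoidHom.sub_apply, AddMonoidHom.comp_apply, hbw.1, hbv.1, sub_zero])
  have hcv := hcπ.trans hπv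
  refine ⟨mkInv c hc.idem, hupper hc (rep_mkInv hc.idem) hcπ,
    S.couples_unipotent hφφ hc (rep_mkInv hc.idem) hb hrb hx (fun y => ?_) (fun y => ?_) fun y => ?_⟩
  · rw [← hcv.2, ← hφδ, hvδ, map_zero]
  · rw [← hcv.2, hbv.1, map_zero]
  · rw [← hcv.1, hbv.2]

/-- The small summand `π` gives an admissible pair. For any `f`, `Setting.exists_cyc_divisible`
finds a lower involution that avoids the image of `δ f π` and has lifts with divisible image under
`π f⁻¹`, so that no upper involution couples with it. -/
theorem Setting.isFinalProj_of_groupFinal (S : Setting p A) (h : Cyc p e a m) (hr : Rep ε e)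
    (hξ : Rep ξ w) (hew : Below e w) (hF : GroupFinal ξ ε) : IsFinalProj p w m := by
  obtain ⟨-, -, -, hB, hF⟩ := hF
  obtain ⟨hb, hs⟩ := (S.groupByOrd_iff h hr hξ hew).mp hB
  refine ⟨hξ.1, hb, hs, fun n => ?_⟩
  by_contra hlt
  obtain ⟨π, k, e₁, a₁, s, hπ, hπw, hπk, hsk, he₁, heπ, hsB, hcard, hP⟩ :=
    S.exists_small_summand hξ.1 hb hs (not_le.mp hlt)
  have hδ : Idem (w - π) := hπw.sub_idem hπ hξ.1
  have hδw := hπw.sub hξ.1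
  have hinf := aleph0_le_layerCard S.prime S.pGroup S.reduced S.unbounded k
  have hδk : ∀ x, p ^ k • (w - π) x = 0 := fun x => by
    have := hπk (w x)
    rwa [hπw.2] at this
  have hπδ : ∀ x, π ((w - π) x) = 0 := fun x => by simp [hπw.2, hπ x]
  have hδπ : ∀ x, (w - π) (π x) = 0 := fun x => by simp [hπw.1, hπ x]
  have hrep := rep_mkInv hπ
  have hrep₁ := rep_mkInv he₁.idem
  have hne := S.exists_sub_ne h hb
  have hne₁ := S.exists_sub_ne he₁ hπk
  have hup := (S.sameSide_iff hξ h hr he₁ hrep₁ hew hne).mpr (heπ.trans hπw)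
  have hup₁ := (S.sameSide_iff hrep he₁ hrep₁ he₁ hrep₁ heπ hne₁).mpr heπ
  obtain ⟨f, hf⟩ := hF (mkInv π hπ) (mkInv e₁ he₁.idem) hrep.invol
    ((hrep.commutes_iff_comm S hξ).mpr fun y => by rw [hπw.1, hπw.2])
    ⟨S.groupExtreme_of_cyc he₁ hrep₁, hup.1, hup₁.1, hup.2, hup₁.2⟩
    (by
      rintro η ⟨hη, -, hη₁, -, hηs₁⟩
      obtain ⟨b, d, l, hb, hrb⟩ := S.exists_cyc_of_groupExtreme hη
      obtain ⟨hπb, hbπ⟩ := (S.not_sameSide_iff hrep he₁ hrep₁ hb hrb heπ hne₁).mp ⟨hη₁, hηs₁⟩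
      refine S.ordLe_of_le hb hrb he₁ hrep₁ (fun y => ?_) (fun y => ?_) ?_
      · rw [← heπ.1, hbπ]
      · rw [← heπ.2, hπb, map_zero]
      · exact (hb.lt_of_bounded (w := AddMonoidHom.id A - π)
          ⟨fun y => by simp [hπb], fun y => by simp [hbπ]⟩ (by simpa using hπk)).le)
  obtain ⟨b, d, l, hb, hbδ, hdT, hv⟩ := S.exists_cyc_divisible hδ hδk hsB hinf hcard hP.le
    (mk_range_le S hinf hP.le (φ := ((w - π).comp f.toAddMonoidHom).comp π)
      (fun x => by simp [hπ x]) (fun x => hδk _))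
    (g := π.comp f.symm.toAddMonoidHom) (fun x => ⟨_, rfl⟩)
  have hrb := rep_mkInv hb.idem
  have hlow := (S.sameSide_iff hξ h hr hb hrb hew hne).mpr (hbδ.trans hδw)
  have hlow₁ := (S.not_sameSide_iff hrep he₁ hrep₁ hb hrb heπ hne₁).mpr
    ⟨fun y => by rw [← hbδ.1, hπδ], fun y => by rw [← hbδ.2, hδπ, map_zero]⟩
  obtain ⟨η, ⟨hη, -, hη₁, -, hηs₁⟩, hcou⟩ := hf (mkInv b hb.idem)
    ⟨S.groupExtreme_of_cyc hb hrb, hlow.1, hlow₁.1, hlow.2, hlow₁.2⟩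
  obtain ⟨c, x, j, hc, hrc⟩ := S.exists_cyc_of_groupExtreme hη
  have hcπ := (S.sameSide_iff hrep he₁ hrep₁ hc hrc heπ hne₁).mp ⟨hη₁, hηs₁⟩
  exact S.not_couples hc hrc hb hrb hcπ hbδ hπδ hδπ (fun t y hty => hdT t ⟨y, hty.symm⟩) hv hcou

theorem Setting.groupFinal_iff (S : Setting p A) : GroupFinal ξ ε ↔ Pair ξ ε ∧ Final ξ ε := by
  constructor
  · intro hF
    have hε := S.extreme_of_groupExtreme hF.2.1
    obtain ⟨e, a, m, h, hr⟩ := S.exists_cyc hε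
    obtain ⟨w, hw, hew⟩ := S.exists_rep_above h hr hF.1 hF.2.2.1
    exact ⟨⟨hF.1, hε, hF.2.2.1⟩,
      (S.isFinalProj_of_groupFinal h hr hw hew hF).final S h hr hw hew⟩
  · rintro ⟨hP, hF⟩
    obtain ⟨e, a, m, h, hr⟩ := S.exists_cyc hP.2.1
    obtain ⟨w, hw, hew⟩ := S.exists_rep_above h hr hP.1 hP.2.2
    exact (S.isFinalProj_of_final h hr hw hew hF).groupFinal S h hr hw hew

end Coupling

/-! ### Expressibility in the language of groups -/

section Formulas

open FirstOrder Language

variable {α : Type}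

/-- The elements `f` of the groups `Aut A` are values of one term of the language of groups. -/
def ExpressibleTerm (α : Type) (f : ∀ (A : Type u) [AddCommGroup A], (α → A ≃+ A) → A ≃+ A) : Prop :=
  ∃ t : groupLang.Term α, ∀ (A : Type u) [AddCommGroup A] (v : α → A ≃+ A), t.realize v = f A v

/-- The relation `R` on the groups `Aut A` is expressed by one formula of the language of groups. -/
def Expressible (α : Type) (R : ∀ (A : Type u) [AddCommGroup A], (α → A ≃+ A) → Prop) : Prop :=
  ∃ φ : groupLang.Formula α, ∀ (A : Type u) [AddCommGroup A] (v : α → A ≃+ A), φ.Realize v ↔ R A v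

variable {f g h a b : ∀ (A : Type u) [AddCommGroup A], (α → A ≃+ A) → A ≃+ A}
  {R Q : ∀ (A : Type u) [AddCommGroup A], (α → A ≃+ A) → Prop}

theorem ExpressibleTerm.var (i : α) : ExpressibleTerm.{u} α fun _ _ v => v i :=
  ⟨Term.var i, fun _ _ _ => rfl⟩

theorem ExpressibleTerm.lift (hf : ExpressibleTerm α f) :
    ExpressibleTerm (Option α) fun A _ v => f A fun i => v (some i) := by
  obtain ⟨t, ht⟩ := hf
  exact ⟨t.relabel some, fun A _ v => by
    rw [Term.realize_relabel, ht]; rfl⟩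

theorem ExpressibleTerm.refl : ExpressibleTerm.{u} α fun A _ _ => AddEquiv.refl A :=
  ⟨Term.func GroupFunc.one ![], fun _ _ _ => rfl⟩

theorem ExpressibleTerm.trans (hf : ExpressibleTerm α f) (hg : ExpressibleTerm α g) :
    ExpressibleTerm α fun A _ v => (f A v).trans (g A v) := by
  obtain ⟨t, ht⟩ := hf
  obtain ⟨s, hs⟩ := hg
  refine ⟨Term.func GroupFunc.mul ![s, t], fun A _ v => ?_⟩
  beta_reduce
  rw [← ht, ← hs]
  rfl

theorem ExpressibleTerm.conj (hf : ExpressibleTerm α f) (hg : ExpressibleTerm α g) :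
    ExpressibleTerm α fun A _ v => conj (f A v) (g A v) := by
  refine ExpressibleTerm.trans (.trans ?_ hg) hf
  obtain ⟨t, ht⟩ := hf
  refine ⟨Term.func GroupFunc.inv ![t], fun A _ v => ?_⟩
  beta_reduce
  rw [← ht]
  rfl

theorem Expressible.eq (hf : ExpressibleTerm α f) (hg : ExpressibleTerm α g) :
    Expressible α fun A _ v => f A v = g A v := by
  obtain ⟨t, ht⟩ := hf
  obtain ⟨s, hs⟩ := hg
  exact ⟨t.equal s, fun A _ v => by rw [Formula.realize_equal, ht, hs]⟩

theorem Expressible.not (hR : Expressible α R) : Expressible α fun A _ v => ¬ R A v := by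
  obtain ⟨φ, hφ⟩ := hR
  exact ⟨φ.not, fun A _ v => by rw [Formula.realize_not, hφ]⟩

theorem Expressible.imp (hR : Expressible α R) (hQ : Expressible α Q) :
    Expressible α fun A _ v => R A v → Q A v := by
  obtain ⟨φ, hφ⟩ := hR
  obtain ⟨ψ, hψ⟩ := hQ
  exact ⟨φ.imp ψ, fun A _ v => by rw [Formula.realize_imp, hφ, hψ]⟩

theorem Expressible.of_iff (hR : Expressible α R)
    (h : ∀ (A : Type u) [AddCommGroup A] (v : α → A ≃+ A), R A v ↔ Q A v) : Expressible α Q := by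
  obtain ⟨φ, hφ⟩ := hR
  exact ⟨φ, fun A _ v => (hφ A v).trans (h A v)⟩

theorem Expressible.and (hR : Expressible α R) (hQ : Expressible α Q) :
    Expressible α fun A _ v => R A v ∧ Q A v :=
  (hR.imp hQ.not).not.of_iff fun _ _ _ => by rw [← not_and, not_not]

theorem Expressible.or (hR : Expressible α R) (hQ : Expressible α Q) :
    Expressible α fun A _ v => R A v ∨ Q A v :=
  (hR.not.imp hQ).of_iff fun _ _ _ => or_iff_not_imp_left.symm

theorem Expressible.iff (hR : Expressible α R) (hQ : Expressible α Q) :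
    Expressible α fun A _ v => R A v ↔ Q A v :=
  ((hR.imp hQ).and (hQ.imp hR)).of_iff fun _ _ _ => iff_iff_implies_and_implies.symm

/-- In `Option α` the index `none` is the bound variable; it is moved to the summand `Unit` over
which the formula quantifies. -/
theorem Expressible.all {P : ∀ (A : Type u) [AddCommGroup A], (α → A ≃+ A) → A ≃+ A → Prop}
    (hP : Expressible (Option α) fun A _ v => P A (fun i => v (some i)) (v none)) :
    Expressible α fun A _ v => ∀ x, P A v x := by
  obtain ⟨φ, hφ⟩ := hP
  refine ⟨(φ.relabel fun o => o.elim (Sum.inr ()) Sum.inl).iAlls Unit, fun A _ v => ?_⟩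
  rw [Formula.realize_iAlls]
  constructor
  · intro h x
    have := h fun _ => x
    rw [Formula.realize_relabel, hφ] at this
    exact this
  · intro h i
    rw [Formula.realize_relabel, hφ]
    exact h (i ())

theorem Expressible.ex {P : ∀ (A : Type u) [AddCommGroup A], (α → A ≃+ A) → A ≃+ A → Prop}
    (hP : Expressible (Option α) fun A _ v => P A (fun i => v (some i)) (v none)) :
    Expressible α fun A _ v => ∃ x, P A v x :=
  (Expressible.all (P := fun A _ v x => ¬ P A v x) hP.not).not.of_iff fun _ _ _ => by
    rw [not_forall_not]

theorem Expressible.invol (hf : ExpressibleTerm α f) :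
    Expressible α fun A _ v => ∀ x, f A v (f A v x) = x :=
  (Expressible.eq (hf.trans hf) .refl).of_iff fun _ _ _ => DFunLike.ext_iff

theorem Expressible.commutes (hf : ExpressibleTerm α f) (hg : ExpressibleTerm α g) :
    Expressible α fun A _ v => Commutes (f A v) (g A v) :=
  (Expressible.eq (hg.trans hf) (hf.trans hg)).of_iff fun _ _ _ => DFunLike.ext_iff

theorem Expressible.central (hf : ExpressibleTerm α f) :
    Expressible α fun A _ v => Central (f A v) :=
  .all (.commutes (.var none) hf.lift)

theorem Expressible.groupExtreme (hf : ExpressibleTerm α f) :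
    Expressible α fun A _ v => GroupExtreme (f A v) := by
  refine .and (.invol hf) (.and (.not (.central hf)) (.all (.imp (.invol (.var none))
    (.imp (.commutes (.var none) hf.lift) (.all (.imp (.invol (.var none)) (.imp
      (.all (.imp (.commutes (.var none) hf.lift.lift.lift) (.imp
        (.commutes (.var none) (.var (some (some none)))) (.commutes (.var none) (.var (some none))))))
      ?_)))))))
  have hx : ExpressibleTerm.{u} (Option (Option α)) fun _ _ v => v none := .var none
  have hξ : ExpressibleTerm.{u} (Option (Option α)) fun _ _ v => v (some none) := .var _
  have he := hf.lift.lift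
  exact .or (.central hx) (.or (.central (he.trans hx)) (.or (.central (hξ.trans hx))
    (.central ((he.trans hξ).trans hx))))

theorem Expressible.sameSide (hf : ExpressibleTerm α f) (ha : ExpressibleTerm α a)
    (hb : ExpressibleTerm α b) : Expressible α fun A _ v => SameSide (f A v) (a A v) (b A v) :=
  .ex (.and (.commutes (.var none) hf.lift) (.not (.commutes (.conj (.var none) ha.lift) hb.lift)))

theorem Expressible.ordLe (ha : ExpressibleTerm α a) (hb : ExpressibleTerm α b) :
    Expressible α fun A _ v => OrdLe (a A v) (b A v) :=
  .all (.imp (.all (.imp (.commutes (.var none) ha.lift.lift) (.commutes (.var none) (.var (some none)))))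
    (.imp (.all (.imp (.commutes (.var none) (hb.lift.lift.trans ha.lift.lift))
      (.commutes (.var none) (.var (some none))))) (.central (.var none))))

theorem Expressible.groupByOrd (hf : ExpressibleTerm α f) (ha : ExpressibleTerm α a) :
    Expressible α fun A _ v => GroupByOrd (f A v) (a A v) :=
  .all (.imp (.groupExtreme (.var none)) (.imp (.commutes (.var none) hf.lift)
    (.imp (.commutes (.var none) ha.lift)
      (.iff (.sameSide hf.lift ha.lift (.var none)) (.ordLe ha.lift (.var none))))))

theorem Expressible.liesUpper (hf : ExpressibleTerm α f) (hg : ExpressibleTerm α g)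
    (hh : ExpressibleTerm α h) (ha : ExpressibleTerm α a) (hb : ExpressibleTerm α b) :
    Expressible α fun A _ v => LiesUpper (f A v) (g A v) (h A v) (a A v) (b A v) :=
  .and (.groupExtreme hb) (.and (.commutes hb hf) (.and (.commutes hb hh)
    (.and (.sameSide hf hg hb) (.sameSide hh ha hb))))

theorem Expressible.liesLower (hf : ExpressibleTerm α f) (hg : ExpressibleTerm α g)
    (hh : ExpressibleTerm α h) (ha : ExpressibleTerm α a) (hb : ExpressibleTerm α b) :
    Expressible α fun A _ v => LiesLower (f A v) (g A v) (h A v) (a A v) (b A v) :=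
  .and (.groupExtreme hb) (.and (.commutes hb hf) (.and (.commutes hb hh)
    (.and (.sameSide hf hg hb) (.not (.sameSide hh ha hb)))))

theorem Expressible.couples (hf : ExpressibleTerm α f) (ha : ExpressibleTerm α a)
    (hb : ExpressibleTerm α b) : Expressible α fun A _ v => Couples (f A v) (a A v) (b A v) :=
  .and (.commutes (hf.conj ha) (hb.trans ha)) (.not (.commutes (hf.conj ha) hb))

theorem Expressible.groupFinal (hf : ExpressibleTerm α f) (hg : ExpressibleTerm α g) :
    Expressible α fun A _ v => GroupFinal (f A v) (g A v) := by
  refine .and (.invol hf) (.and (.groupExtreme hg) (.and (.commutes hf hg) (.and (.groupByOrd hf hg)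
    (.all (.all ?_)))))
  have hξ : ExpressibleTerm.{u} (Option (Option α)) fun _ _ v => v (some none) := .var _
  have hε : ExpressibleTerm.{u} (Option (Option α)) fun _ _ v => v none := .var _
  have hf := hf.lift.lift
  have hg := hg.lift.lift
  refine .imp (.invol hξ) (.imp (.commutes hξ hf) (.imp (.liesUpper hf hg hξ hε hε) (.imp
    (.all (.imp (.liesLower hf.lift hg.lift hξ.lift hε.lift (.var none)) (.ordLe (.var none) hε.lift)))
    (.ex (.all (.imp (.liesLower hf.lift.lift hg.lift.lift hξ.lift.lift hε.lift.lift (.var none))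
      (.ex (.and (.liesUpper hf.lift.lift.lift hg.lift.lift.lift hξ.lift.lift.lift hε.lift.lift.lift
        (.var none)) (.couples (.var (some (some none))) (.var none) (.var (some none)))))))))))

end Formulas

end AutFinal

theorem lemma1 :
    ∃ φ : AutFinal.groupLang.Formula (Fin 2),
      ∀ (p : ℕ), p.Prime → p ≠ 2 →
      ∀ (A : Type*) [AddCommGroup A], AutFinal.IsAbelianPGroup p A →
        AutFinal.IsReducedGroup A → AutFinal.IsUnboundedGroup A →
        (∀ ξ ε : A ≃+ A,
          φ.Realize ![ξ, ε] ↔ AutFinal.Pair ξ ε ∧ AutFinal.Final ξ ε) ∧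
        (∀ A₁ A₂ : AddSubgroup A,
          (∃ ξ₀ ε₀ : A ≃+ A, AutFinal.Pair ξ₀ ε₀ ∧ AutFinal.Final ξ₀ ε₀ ∧
            AutFinal.pairCompl ξ₀ ε₀ = A₁ ∧ AutFinal.pairPart ξ₀ ε₀ = A₂) ↔
          AutFinal.IsLowFin p A₁ A₂) ∧
        (∃ A₁ A₂ : AddSubgroup A, AutFinal.IsLowFin p A₁ A₂) := by
  -- The formula is fixed before `p` and `A`: it expresses `GroupFinal` over every Abelian group,
  -- and the hypotheses on `A` serve only to identify `GroupFinal` with `Final`.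
  obtain ⟨φ, hφ⟩ := AutFinal.Expressible.groupFinal (AutFinal.ExpressibleTerm.var (0 : Fin 2))
    (AutFinal.ExpressibleTerm.var (1 : Fin 2))
  refine ⟨φ, fun p hp hp2 A _ hA hR hU => ?_⟩
  have S : AutFinal.Setting p A := ⟨hp, hp2, hA, hR, hU⟩
  refine ⟨fun ξ ε => ?_, fun _ _ => S.exists_pair_iff, ?_⟩
  · rw [hφ]
    exact S.groupFinal_iff
  · obtain ⟨w, m, hw⟩ := S.exists_isFinalProj
    exact ⟨_, _, hw.isLowFin S⟩
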